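/- Let $d\in\mathbb N$, let $r,k>0$, let $A$ be a symmetric real $d\times d$ matrix, let $\hat Q,\hat B,\hat C,\hat D$ be real $d\times d$ matrices with $\hat Q$ symmetric positive definite and $\hat B$ symmetric, and let $H,\Delta\in\mathbb R^d$. For a probability density $m$ on $\mathbb R^d$ with finite second moment put $$\hat V[m](x)=(x-H)^T\hat Q(x-H)+\int\Big((x-H)^T\tfrac{\hat B}{2}(\xi-\Delta)+(\xi-\Delta)^T\tfrac{\hat B}{2}(x-H)\Big)m(\xi)\,d\xi+\int(\xi-\Delta)^T\hat C(\xi-\Delta)\,m(\xi)\,d\xi+\bar\xi^T\hat D\,\bar\xi,$$ where $\bar\xi=\int(\xi-\Delta)\,m(\xi)\,d\xi$. For $\ell>0$ consider the discounted mean field system $$\text{(MF)}\quad\begin{cases}-k\,\Delta v+\frac1{2r}|\nabla v|^2-\nabla v^TAx+\ell v=\hat V[m](x),\\ -k\,\Delta m-\operatorname{div}\big(m\,(\frac{\nabla v}{r}-Ax)\big)=0,\\ \int_{\mathbb R^d}m\,dx=1,\quad m>0,\end{cases}$$ whose solutions are pairs $(v,m)$ of $C^2$ functions on $\mathbb R^d$,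 $m$ having finite second moment. A solution is called Quadratic--Gaussian (QG) if $$v(x)=x^T\tfrac{\Lambda}{2}x+\rho\cdot x+c,\qquad m=\text{density of }\mathcal N(\mu,\Sigma^{-1}),$$ for some symmetric matrices $\Lambda,\Sigma$ with $\Sigma$ positive definite, vectors $\mu,\rho$ and $c\in\mathbb R$. Then there is $\hat\ell>0$ such that the following hold for all $0<\ell<\hat\ell$. (a) (MF) has a unique QG solution if and only if the matrix $\mathcal B^\infty_\ell=\hat Q+\frac r2A^2-\frac{\ell r}2A+\frac12\hat B$ is invertible. (b) If $\hat B$ is positive semidefinite, then (MF) has a QG solution $(v,m)$, and, with $c=v(0)$, it is the only solution of (MF), QG or not, whose first component takes the value $c$ at $0$. (c) For every $N\ge1$ let an $N$-player game be given with dynamics $dX^i_t=(AX^i_t-\alpha^i_t)\,dt+\sigma\,dW^i_t$, discounted costs with control cost $\frac12\alpha^TR\alpha$, and displacement costs $F^i(X)=\sum_{j,l}(X^j-\overline{X_i}^j)^TQ^i_{jl}(X^l-\overline{X_i}^l)$, such that $A$, $\sigma$, $R$, $H$, $\Delta$ do not depend on $N$ and: $\sigma$ is invertible, $\frac12\sigma^T\sigma=k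 I_d$, $R=rI_d$; the $Nd\times Nd$ matrices $Q^i=(Q^i_{jl})_{j,l}$ are symmetric; for all $i$ one has $Q^i_{ii}=Q^N$ symmetric positive definite, $\overline{X_i}^i=H$, and, for all $j\ne i$, $Q^i_{ij}=\frac12B^N$, $Q^i_{jj}=C^N_i$, $\overline{X_i}^j=\Delta$, and $Q^i_{jl}=D^N_i$ for distinct $j,l\neq i$. Assume that, as $N\to\infty$, $Q^N\to\hat Q$, $(N-1)B^N\to\hat B$, and, for every $i$, $(N-1)C^N_i\to\hat C$ and $(N-1)^2D^N_i\to\hat D$, and that (MF) has a unique QG solution. Consider the system, for $i=1,\dots,N$, $$\begin{cases}-k\,\Delta v^i+\frac1{2r}|\nabla v^i|^2-(\nabla v^i)^TAx+\ell v^i=\int_{\mathbb R^{d(N-1)}}F^i(\xi^1,\dots,\xi^{i-1},x,\xi^{i+1},\dots,\xi^N)\prod_{j\ne i}m^j(\xi^j)\,d\xi^j,\\ -k\,\Delta m^i-\operatorname{div}\big(m^i(\frac{\nabla v^i}{r}-Ax)\big)=0,\\ \int_{\mathbb R^d}m^i\,dx=1,\quad m^i>0\end{cases}$$ (solutions being understood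 as for (MF)). Then for all large $N$ this system has a unique solution of the form $v^i_N(x)=x^T\frac{\Lambda}{2}x+\rho\cdot x+c^i$, $m^i_N=$ density of $\mathcal N(\mu,\Sigma^{-1})$, with symmetric $\Lambda,\Sigma$, $\Sigma$ positive definite, $\Lambda,\Sigma,\mu,\rho$ common to all the players, and $c^i\in\mathbb R$. Moreover, as $N\to\infty$ these solutions converge to the QG solution $(v,m)$ of (MF): for every $i$, $v^i_N\to v$ in $C^1_{loc}(\mathbb R^d)$ with second derivatives converging uniformly on $\mathbb R^d$, and $m^i_N\to m$ in $C^n(\mathbb R^d)$ for every $n$. -/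

import Mathlib

open MeasureTheory Filter Topology Matrix

noncomputable section

namespace LQMFG

/-- The state space `ℝᵈ` with its Euclidean norm. -/
abbrev E (d : ℕ) : Type := EuclideanSpace ℝ (Fin d)

/-- Real `d × d` matrices. -/
abbrev Mat (d : ℕ) : Type := Matrix (Fin d) (Fin d) ℝ

/-- The matrix-vector product `M x`, as a vector of the Euclidean space. -/
def app {d : ℕ} (M : Mat d) (x : E d) : E d := WithLp.toLp 2 (M *ᵥ x.ofLp)

/-- The bilinear form `xᵀ M y`. -/
def bil {d : ℕ} (M : Mat d) (x y : E d) : ℝ := inner ℝ x (app M y)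

/-- The divergence of a vector field, the trace of its derivative. -/
def divergence {d : ℕ} (F : E d → E d) (x : E d) : ℝ :=
  ∑ i : Fin d, (fderiv ℝ F x (EuclideanSpace.single i 1)) i

/-- `(v, m)` is a classical solution of the pair of equations
`-k Δv + |∇v|² / (2r) - ∇vᵀ A x + ℓ v = f(x)`,
`-k Δm - div (m (∇v / r - A x)) = 0`, with `∫ m = 1` and `m > 0`.
The second moment of `m` is finite, so that averages of quadratic functions against `m` exist. -/
structure SolvesHJBKFP {d : ℕ} (A : Mat d) (r k ℓ : ℝ) (f : E d → ℝ) (v m : E d → ℝ) :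
    Prop where
  contDiff_v : ContDiff ℝ 2 v
  contDiff_m : ContDiff ℝ 2 m
  hjb : ∀ x, -k * Laplacian.laplacian v x + 1 / (2 * r) * ‖gradient v x‖ ^ 2
      - inner ℝ (gradient v x) (app A x) + ℓ * v x = f x
  kfp : ∀ x, -k * Laplacian.laplacian m x
      - divergence (fun y => m y • ((1 / r) • gradient v y - app A y)) x = 0
  integrable_m : Integrable m
  integral_m : ∫ x, m x = 1
  pos_m : ∀ x, 0 < m x
  second_moment : Integrable (fun x => ‖x‖ ^ 2 * m x)

/-- The quadratic function `xᵀ (Λ/2) x + ρ x + c`. -/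
def quadratic {d : ℕ} (L : Mat d) (ρ : E d) (c : ℝ) (x : E d) : ℝ :=
  bil L x x / 2 + inner ℝ ρ x + c

/-- The density of the Gaussian law with mean `μ` and covariance matrix `S⁻¹`. -/
def gaussianDensity {d : ℕ} (μ : E d) (S : Mat d) (x : E d) : ℝ :=
  Real.sqrt (S.det / (2 * Real.pi) ^ d) * Real.exp (-(bil S (x - μ) (x - μ) / 2))

/-! ### The mean field system -/

/-- The mean field cost `V̂[m]`, where the measure is given by its density `m`. -/
def meanFieldCost {d : ℕ} (Q B C D : Mat d) (H Δ₀ : E d) (m : E d → ℝ) (x : E d) : ℝ :=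
  bil Q (x - H) (x - H)
    + (∫ ξ, (bil ((1 / 2 : ℝ) • B) (x - H) (ξ - Δ₀)
        + bil ((1 / 2 : ℝ) • B) (ξ - Δ₀) (x - H)) * m ξ)
    + (∫ ξ, bil C (ξ - Δ₀) (ξ - Δ₀) * m ξ)
    + bil D (∫ ξ, m ξ • (ξ - Δ₀)) (∫ ξ, m ξ • (ξ - Δ₀))

/-- `(v, m)` solves the discounted mean field system. -/
def IsMFSolution {d : ℕ} (A : Mat d) (r k ℓ : ℝ) (Q B C D : Mat d) (H Δ₀ : E d)
    (v m : E d → ℝ) : Prop :=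
  SolvesHJBKFP A r k ℓ (meanFieldCost Q B C D H Δ₀ m) v m

/-- The Quadratic-Gaussian form: `v` is quadratic and `m` is a Gaussian density. -/
def IsQG {d : ℕ} (v m : E d → ℝ) : Prop :=
  ∃ (L S : Mat d) (μ ρ : E d) (c : ℝ), L.IsSymm ∧ S.PosDef ∧
    v = quadratic L ρ c ∧ m = gaussianDensity μ S

/-- The matrix `Q + r A² / 2 - ℓ r A / 2 + B / 2`. -/
def limitMatrix {d : ℕ} (A : Mat d) (r ℓ : ℝ) (Q B : Mat d) : Mat d :=
  Q + (r / 2) • (A * A) - (ℓ * r / 2) • A + (1 / 2 : ℝ) • B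

/-! ### Games with `N` players -/

/-- The data of an `N`-player linear-quadratic game with dynamics
`dXⁱ = (A Xⁱ - αⁱ) dt + σ dWⁱ`, control cost `αᵀ R α / 2` and displacement costs
`Fⁱ(X) = ∑ⱼₖ (Xʲ - refⁱʲ)ᵀ Qⁱⱼₖ (Xᵏ - refⁱᵏ)`. Here `Q i j k` is the `(j, k)` block of the
cost matrix of player `i`. -/
structure LQGame (d N : ℕ) where
  A : Mat d
  σ : Mat d
  R : Mat d
  Q : Fin N → Fin N → Fin N → Mat d
  ref : Fin N → Fin N → E d

namespace LQGame

variable {d N : ℕ}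

/-- `σ` is invertible, `R` is symmetric positive definite, and the `Nd × Nd` cost matrices are
symmetric. -/
structure H1 (G : LQGame d N) : Prop where
  σ_inv : IsUnit G.σ
  R_posDef : G.R.PosDef
  Q_symm : ∀ i j k, (G.Q i j k)ᵀ = G.Q i k j

/-- Nearly identical players. -/
structure H2 (G : LQGame d N) (Q B : Mat d) (C D : Fin N → Mat d) (H Δ₀ : E d) : Prop where
  Q_posDef : Q.PosDef
  Q_own : ∀ i, G.Q i i i = Q
  ref_own : ∀ i, G.ref i i = H
  Q_cross : ∀ i j, j ≠ i → G.Q i i j = (1 / 2 : ℝ) • B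
  Q_diag : ∀ i j, j ≠ i → G.Q i j j = C i
  ref_other : ∀ i j, j ≠ i → G.ref i j = Δ₀
  Q_other : ∀ i j k, j ≠ i → k ≠ i → j ≠ k → G.Q i j k = D i

/-- `A` is symmetric, `R = r I` and `σᵀ σ / 2 = k I`. -/
structure H3 (G : LQGame d N) (r k : ℝ) : Prop where
  A_symm : G.A.IsSymm
  r_pos : 0 < r
  k_pos : 0 < k
  R_eq : G.R = r • (1 : Mat d)
  ν_eq : (1 / 2 : ℝ) • (G.σᵀ * G.σ) = k • (1 : Mat d)

/-- The displacement cost of player `i`. -/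
def cost (G : LQGame d N) (i : Fin N) (X : Fin N → E d) : ℝ :=
  ∑ j, ∑ k, bil (G.Q i j k) (X j - G.ref i j) (X k - G.ref i k)

/-- The profile in which player `i` is at `x` and the others are at `ξ`. -/
def profile (i : Fin N) (x : E d) (ξ : {j : Fin N // j ≠ i} → E d) (j : Fin N) : E d :=
  if h : j = i then x else ξ ⟨j, h⟩

/-- The displacement cost of player `i` at `x`, averaged over the laws (with densities `m j`) of
the other players. -/
def averagedCost (G : LQGame d N) (m : Fin N → E d → ℝ) (i : Fin N) (x : E d) : ℝ :=
  ∫ ξ : {j : Fin N // j ≠ i} → E d, G.cost i (profile i x ξ) * ∏ j : {j : Fin N // j ≠ i}, m j (ξ j)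

/-- `(vⁱ, mⁱ)` solves the system of `2N` Hamilton-Jacobi-Bellman and Kolmogorov-Fokker-Planck
equations of the discounted game. -/
def IsSolution (G : LQGame d N) (r k ℓ : ℝ) (v m : Fin N → E d → ℝ) : Prop :=
  ∀ i, SolvesHJBKFP G.A r k ℓ (G.averagedCost m i) (v i) (m i)

end LQGame

/-- The Quadratic-Gaussian form for `N` players: the coefficients are common to all the players,
except for the additive constants `cⁱ`. -/
def IsQGProfile {d N : ℕ} (v m : Fin N → E d → ℝ) : Prop :=
  ∃ (L S : Mat d) (μ ρ : E d) (c : Fin N → ℝ), L.IsSymm ∧ S.PosDef ∧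
    ∀ i, v i = quadratic L ρ (c i) ∧ m i = gaussianDensity μ S

/-! ### Modes of convergence -/

/-- Convergence in `C¹_loc` together with uniform convergence of the second derivatives. -/
def ConvergesValue {d : ℕ} (w : ℕ → E d → ℝ) (v : E d → ℝ) : Prop :=
  (∀ j ≤ 1, TendstoLocallyUniformly (fun N => iteratedFDeriv ℝ j (w N)) (iteratedFDeriv ℝ j v)
    atTop) ∧
  TendstoUniformly (fun N => iteratedFDeriv ℝ 2 (w N)) (iteratedFDeriv ℝ 2 v) atTop

/-- Convergence in `Cⁿ(ℝᵈ)` for every `n`: uniform convergence of all derivatives. -/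
def ConvergesDensity {d : ℕ} (p : ℕ → E d → ℝ) (m : E d → ℝ) : Prop :=
  ∀ n j : ℕ, j ≤ n →
    TendstoUniformly (fun N => iteratedFDeriv ℝ j (p N)) (iteratedFDeriv ℝ j m) atTop

end LQMFG

end

noncomputable section

namespace LQMFG

/-! ### The linear maps given by matrices -/

section App

variable {d : ℕ}

/-! Everything reduces to one player facing a cost that is a fixed quadratic function of `x`, with
quadratic part `Q` and linear coefficient `w`. Put P = A² - ℓA + (2/r)Q (`riccatiMatrix`). For small
ℓ it is positive definite, because A² is nonnegative and Q is coercive. Then S² + ℓS = P has a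
positive definite solution S, found in an eigenbasis of P. Let a solve rPa = 2QH - w. Matching
coefficients shows that the quadratic v₀ with Λ = r(S + A) and ρ = -rSa solves the first equation;
its drift ∇v₀/r - Ax is S(x - a), whose stationary law is N(a, kS⁻¹).

The core is `solvesHJBKFP_quadCost_iff`: this pair is the only classical solution, with no growth
condition on v. If v is another one, W = (v - v₀)/r satisfies -kΔW + |∇W|²/2 + ∇W·S(x - a) + ℓW = 0.
A logarithmic barrier on large balls gives W ≤ 0 (`nonpos_of_hjb`). Next, m is stationary for the
drift S(x - a) + ∇W; testing its equation with φ exp(W/(2k)), φ a cutoff, cancels every term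
quadratic in ∇W and leaves ∫ φ m exp(W/(2k)) (ℓ/(2k)) (-W) equal to an integral that involves only
derivatives of φ. The latter tends to 0, so W = 0 (`eq_zero_of_hjb_of_kfp`). Now m has a linear
drift, and a weighted energy estimate for log(m/Gaussian) shows that m is the Gaussian
(`exists_eq_const_mul_exp_of_kfp`).

For the mean field system, the cost generated by m is of this quadratic form and its linear part
sees only the mean μ of m, through w = B(μ - Δ₀). Consistency, that is a = μ, is the linear system
(rP + B)μ = 2QH + BΔ₀, and rP + B is twice the matrix of the statement. So all solutions,
Quadratic-Gaussian or not, correspond to the solutions μ of a square linear system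
(`isMFSolution_iff`). This gives (a), and also (b), since rP + B is positive definite when B is
positive semidefinite.

For the N-player game with common Gaussian laws, independence turns the averaged cost into the same
expression with (N-1)B, (N-1)Cⁱ and (N-1)(N-2)Dⁱ in place of B, C and D (`LQGame.averagedCost_eq`),
and hence into the same linear system with perturbed data. Its matrix is invertible for large N. The
mean converges because matrix inversion is continuous, and S because it is Lipschitz in P
(`sum_sq_sub_le`). Convergence of these parameters gives locally uniform convergence of all
derivatives; for Gaussians a decay bound uniform in the parameters makes it uniform on the whole
space. -/

lemma app_eq_toEuclideanCLM (M : Mat d) (x : E d) :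
    app M x = Matrix.toEuclideanCLM (n := Fin d) (𝕜 := ℝ) M x := rfl

lemma app_add_right (M : Mat d) (x y : E d) : app M (x + y) = app M x + app M y := by
  simp only [app_eq_toEuclideanCLM, map_add]

lemma app_sub_right (M : Mat d) (x y : E d) : app M (x - y) = app M x - app M y := by
  simp only [app_eq_toEuclideanCLM, map_sub]

lemma app_neg_right (M : Mat d) (x : E d) : app M (-x) = -app M x := by
  simp only [app_eq_toEuclideanCLM, map_neg]

lemma app_smul_right (M : Mat d) (t : ℝ) (x : E d) : app M (t • x) = t • app M x := by
  simp only [app_eq_toEuclideanCLM, map_smul]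

lemma app_add_left (M N : Mat d) (x : E d) : app (M + N) x = app M x + app N x := by
  simp only [app_eq_toEuclideanCLM, map_add, _root_.add_apply]

lemma app_sub_left (M N : Mat d) (x : E d) : app (M - N) x = app M x - app N x := by
  simp only [app_eq_toEuclideanCLM, map_sub, _root_.sub_apply]

lemma app_smul_left (t : ℝ) (M : Mat d) (x : E d) : app (t • M) x = t • app M x := by
  simp only [app_eq_toEuclideanCLM, map_smul, _root_.smul_apply]

lemma app_mul (M N : Mat d) (x : E d) : app (M * N) x = app M (app N x) := by
  simp only [app_eq_toEuclideanCLM, map_mul]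
  rfl

lemma app_one (x : E d) : app (1 : Mat d) x = x := by
  simp [app]

lemma app_apply (M : Mat d) (x : E d) (i : Fin d) : app M x i = ∑ j, M i j * x j := by
  simp [app, Matrix.mulVec, dotProduct]

lemma inner_app_comm (M : Mat d) (x y : E d) :
    inner ℝ x (app M y) = inner ℝ (app Mᵀ x) y := by
  simp only [PiLp.inner_apply, RCLike.inner_apply, conj_trivial, app_apply, Matrix.transpose_apply,
    Finset.sum_mul, Finset.mul_sum]
  rw [Finset.sum_comm]
  exact Finset.sum_congr rfl fun i _ => Finset.sum_congr rfl fun j _ => by ring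

lemma inner_app_of_isSymm {M : Mat d} (hM : M.IsSymm) (x y : E d) :
    inner ℝ (app M x) y = inner ℝ x (app M y) := by
  rw [inner_app_comm, hM.eq]

lemma bil_eq_sum (M : Mat d) (x y : E d) : bil M x y = ∑ i, ∑ j, M i j * (x i * y j) := by
  simp only [bil, PiLp.inner_apply, RCLike.inner_apply, conj_trivial, app_apply, Finset.sum_mul]
  exact Finset.sum_congr rfl fun i _ => Finset.sum_congr rfl fun j _ => by ring

lemma bil_pos {M : Mat d} (hM : M.PosDef) {x : E d} (hx : x ≠ 0) : 0 < bil M x x := by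
  have h := hM.dotProduct_mulVec_pos (x := x.ofLp) (by simpa using hx)
  have h2 : bil M x x = star x.ofLp ⬝ᵥ M *ᵥ x.ofLp := by
    simp only [bil, app, PiLp.inner_apply, RCLike.inner_apply, conj_trivial, dotProduct, star_trivial]
    exact Finset.sum_congr rfl fun i _ => by ring
  rwa [h2]

lemma bil_nonneg {M : Mat d} (hM : M.PosSemidef) (x : E d) : 0 ≤ bil M x x := by
  have h := hM.dotProduct_mulVec_nonneg x.ofLp
  have h2 : bil M x x = star x.ofLp ⬝ᵥ M *ᵥ x.ofLp := by
    simp only [bil, app, PiLp.inner_apply, RCLike.inner_apply, conj_trivial, dotProduct, star_trivial]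
    exact Finset.sum_congr rfl fun i _ => by ring
  rwa [h2]

lemma posDef_of_bil_pos {M : Mat d} (hM : M.IsSymm) (h : ∀ x : E d, x ≠ 0 → 0 < bil M x x) :
    M.PosDef := by
  refine Matrix.PosDef.of_dotProduct_mulVec_pos (by simpa [Matrix.IsHermitian] using hM.eq) ?_
  intro x hx
  have h1 := h (WithLp.toLp 2 x) (by simpa using hx)
  have h2 : bil M (WithLp.toLp 2 x) (WithLp.toLp 2 x) = star x ⬝ᵥ M *ᵥ x := by
    simp only [bil, app, PiLp.inner_apply, RCLike.inner_apply, conj_trivial, dotProduct, star_trivial]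
    exact Finset.sum_congr rfl fun i _ => by ring
  rwa [← h2]

lemma isSymm_of_posDef {M : Mat d} (hM : M.PosDef) : M.IsSymm := by
  have h : Mᵀ = M := by simpa [Matrix.IsHermitian] using hM.isHermitian
  exact h

lemma contDiff_app (M : Mat d) {n : WithTop ℕ∞} : ContDiff ℝ n (app M) :=
  (Matrix.toEuclideanCLM (n := Fin d) (𝕜 := ℝ) M).contDiff

lemma hasFDerivAt_app (M : Mat d) (x : E d) :
    HasFDerivAt (app M) (Matrix.toEuclideanCLM (n := Fin d) (𝕜 := ℝ) M) x :=
  (Matrix.toEuclideanCLM (n := Fin d) (𝕜 := ℝ) M).hasFDerivAt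

lemma continuous_app (M : Mat d) : Continuous (app M) := (contDiff_app M (n := 0)).continuous

end App

/-! ### Gradients, divergences and Laplacians -/

section Calculus

variable {d : ℕ}

lemma HasGradientAt.add' {f g : E d → ℝ} {a b x : E d} (hf : HasGradientAt f a x)
    (hg : HasGradientAt g b x) : HasGradientAt (fun y => f y + g y) (a + b) x := by
  rw [hasGradientAt_iff_hasFDerivAt] at *
  exact (hf.add hg).congr_fderiv (by simp)

lemma HasGradientAt.sub' {f g : E d → ℝ} {a b x : E d} (hf : HasGradientAt f a x)
    (hg : HasGradientAt g b x) : HasGradientAt (fun y => f y - g y) (a - b) x := by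
  rw [hasGradientAt_iff_hasFDerivAt] at *
  exact (hf.sub hg).congr_fderiv (by simp)

lemma HasGradientAt.mul' {f g : E d → ℝ} {a b x : E d} (hf : HasGradientAt f a x)
    (hg : HasGradientAt g b x) : HasGradientAt (fun y => f y * g y) (f x • b + g x • a) x := by
  rw [hasGradientAt_iff_hasFDerivAt] at *
  exact (hf.mul hg).congr_fderiv (by simp)

lemma HasGradientAt.comp_real {f : E d → ℝ} {a x : E d} {φ : ℝ → ℝ} {φ' : ℝ}
    (hφ : HasDerivAt φ φ' (f x)) (hf : HasGradientAt f a x) :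
    HasGradientAt (fun y => φ (f y)) (φ' • a) x := by
  rw [hasGradientAt_iff_hasFDerivAt] at *
  exact (hφ.comp_hasFDerivAt x hf).congr_fderiv (by simp)

lemma HasGradientAt.const_mul' {f : E d → ℝ} {a x : E d} (c : ℝ) (hf : HasGradientAt f a x) :
    HasGradientAt (fun y => c * f y) (c • a) x := by
  rw [hasGradientAt_iff_hasFDerivAt] at *
  simpa using hf.const_mul c

lemma hasGradientAt_inner_left (ρ x : E d) : HasGradientAt (fun y => inner ℝ ρ y) ρ x := by
  rw [hasGradientAt_iff_hasFDerivAt]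
  exact (innerSL ℝ ρ).hasFDerivAt

lemma hasGradientAt_bil {M : Mat d} (hM : M.IsSymm) (a x : E d) :
    HasGradientAt (fun y => bil M (y - a) (y - a)) ((2 : ℝ) • app M (x - a)) x := by
  rw [hasGradientAt_iff_hasFDerivAt]
  have h1 : HasFDerivAt (fun y : E d => y - a) (ContinuousLinearMap.id ℝ (E d)) x :=
    (hasFDerivAt_id x).sub_const a
  have h2 := h1.inner ℝ ((hasFDerivAt_app M (x - a)).comp x h1)
  refine h2.congr_fderiv ?_
  ext z
  simp only [ContinuousLinearMap.comp_id, ContinuousLinearMap.coe_comp, Function.comp_apply,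
    fderivInnerCLM_apply, ContinuousLinearMap.prod_apply, InnerProductSpace.toDual_apply_apply,
    ContinuousLinearMap.coe_id', id_eq, inner_smul_left, conj_trivial]
  rw [← app_eq_toEuclideanCLM, ← inner_app_of_isSymm hM, real_inner_comm (app M (x - a)) z]
  ring

lemma hasGradientAt_norm_sq (a x : E d) :
    HasGradientAt (fun y => ‖y - a‖ ^ 2) ((2 : ℝ) • (x - a)) x := by
  have h := hasGradientAt_bil (d := d) Matrix.isSymm_one a x
  simpa only [bil, app_one, real_inner_self_eq_norm_sq] using h

lemma contDiff_gradient {f : E d → ℝ} {n : ℕ} (hf : ContDiff ℝ (n + 1 : ℕ) f) :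
    ContDiff ℝ n (gradient f) := by
  have : gradient f = (InnerProductSpace.toDual ℝ (E d)).symm ∘ fderiv ℝ f := rfl
  rw [this]
  exact (InnerProductSpace.toDual ℝ (E d)).symm.contDiff.comp
    (hf.fderiv_right (by norm_cast))

lemma ContDiff.hasGradientAt' {f : E d → ℝ} {n : WithTop ℕ∞} (hf : ContDiff ℝ n f) (hn : n ≠ 0)
    (x : E d) : HasGradientAt f (gradient f x) x :=
  (hf.differentiable hn x).hasGradientAt

/-- A gradient field near `x` is enough; this local form is needed for the logarithmic barrier,
which is smooth only inside a ball. -/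
lemma laplacian_eq_divergence_of_eventually {f : E d → ℝ} {g : E d → E d} {x : E d}
    (hg : ∀ᶠ y in 𝓝 x, HasGradientAt f (g y) y) (hd : DifferentiableAt ℝ g x) :
    Laplacian.laplacian f x = divergence g x := by
  rw [InnerProductSpace.laplacian_eq_iteratedFDeriv_orthonormalBasis f
    (EuclideanSpace.basisFun (Fin d) ℝ), divergence]
  refine Finset.sum_congr rfl fun i _ => ?_
  rw [iteratedFDeriv_two_apply]
  have h1 : fderiv ℝ f =ᶠ[𝓝 x] fun y => innerSL ℝ (g y) := by
    filter_upwards [hg] with y hy using (hasGradientAt_iff_hasFDerivAt.1 hy).fderiv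
  rw [h1.fderiv_eq]
  have h2 : HasFDerivAt (fun y => innerSL ℝ (g y))
      ((innerSL ℝ).comp (fderiv ℝ g x)) x :=
    (innerSL ℝ).hasFDerivAt.comp x hd.hasFDerivAt
  rw [h2.fderiv]
  simp [EuclideanSpace.inner_single_right]

lemma laplacian_eq_divergence {f : E d → ℝ} {g : E d → E d} {x : E d}
    (hg : ∀ y, HasGradientAt f (g y) y) (hd : DifferentiableAt ℝ g x) :
    Laplacian.laplacian f x = divergence g x :=
  laplacian_eq_divergence_of_eventually (Eventually.of_forall hg) hd

lemma laplacian_eq_divergence_gradient {f : E d → ℝ} (hf : ContDiff ℝ 2 f) (x : E d) :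
    Laplacian.laplacian f x = divergence (gradient f) x :=
  laplacian_eq_divergence (fun y => ContDiff.hasGradientAt' hf (by simp) y)
    ((contDiff_gradient (n := 1) hf).differentiable (by simp) x)

lemma divergence_smul {f : E d → ℝ} {F : E d → E d} {a x : E d} (hf : HasGradientAt f a x)
    (hF : DifferentiableAt ℝ F x) :
    divergence (fun y => f y • F y) x = inner ℝ a (F x) + f x * divergence F x := by
  have h := (hasGradientAt_iff_hasFDerivAt.1 hf).smul hF.hasFDerivAt
  have h' : fderiv ℝ (fun y => f y • F y) x = _ := h.fderiv
  unfold divergence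
  rw [h']
  simp [Finset.sum_add_distrib, Finset.mul_sum, PiLp.inner_apply, mul_comm, add_comm]

lemma divergence_add {F G : E d → E d} {x : E d} (hF : DifferentiableAt ℝ F x)
    (hG : DifferentiableAt ℝ G x) :
    divergence (fun y => F y + G y) x = divergence F x + divergence G x := by
  unfold divergence
  rw [fderiv_fun_add hF hG]
  simp [Finset.sum_add_distrib]

lemma divergence_sub {F G : E d → E d} {x : E d} (hF : DifferentiableAt ℝ F x)
    (hG : DifferentiableAt ℝ G x) :
    divergence (fun y => F y - G y) x = divergence F x - divergence G x := by
  unfold divergence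
  rw [fderiv_fun_sub hF hG]
  simp [Finset.sum_sub_distrib]

lemma divergence_const_smul {F : E d → E d} {x : E d} (c : ℝ) (hF : DifferentiableAt ℝ F x) :
    divergence (fun y => c • F y) x = c * divergence F x := by
  unfold divergence
  rw [fderiv_fun_const_smul hF]
  simp [Finset.mul_sum]

lemma divergence_app_sub (M : Mat d) (a x : E d) :
    divergence (fun y => app M (y - a)) x = M.trace := by
  have h1 : HasFDerivAt (fun y : E d => y - a) (ContinuousLinearMap.id ℝ (E d)) x :=
    (hasFDerivAt_id x).sub_const a
  have h2 := (hasFDerivAt_app M (x - a)).comp x h1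
  have h3 : fderiv ℝ (fun y => app M (y - a)) x =
      (Matrix.toEuclideanCLM (n := Fin d) (𝕜 := ℝ) M).comp (ContinuousLinearMap.id ℝ (E d)) :=
    h2.fderiv
  unfold divergence
  rw [h3, Matrix.trace]
  refine Finset.sum_congr rfl fun i _ => ?_
  rw [ContinuousLinearMap.comp_id, ← app_eq_toEuclideanCLM, app_apply]
  simp

lemma divergence_sub_const (a x : E d) : divergence (fun y => y - a) x = d := by
  have h := divergence_app_sub (1 : Mat d) a x
  simpa [app_one] using h

lemma laplacian_comp_real {f : E d → ℝ} (hf : ContDiff ℝ 2 f) {φ φ' : ℝ → ℝ} {φ'' : ℝ} {x : E d}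
    (h1 : ∀ t, HasDerivAt φ (φ' t) t) (h2 : HasDerivAt φ' φ'' (f x)) :
    Laplacian.laplacian (fun y => φ (f y)) x =
      φ'' * ‖gradient f x‖ ^ 2 + φ' (f x) * Laplacian.laplacian f x := by
  have hg : DifferentiableAt ℝ (gradient f) x :=
    (contDiff_gradient (n := 1) hf).differentiable (by simp) x
  have hgr := fun y => ContDiff.hasGradientAt' hf (by simp) y
  have h3 : HasGradientAt (fun y => φ' (f y)) (φ'' • gradient f x) x :=
    HasGradientAt.comp_real h2 (hgr x)
  rw [laplacian_eq_divergence (fun y => HasGradientAt.comp_real (h1 _) (hgr y))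
    (h3.differentiableAt.smul hg), divergence_smul h3 hg, laplacian_eq_divergence_gradient hf,
    inner_smul_left, real_inner_self_eq_norm_sq, conj_trivial]

lemma laplacian_mul {f g : E d → ℝ} (hf : ContDiff ℝ 2 f) (hg : ContDiff ℝ 2 g) (x : E d) :
    Laplacian.laplacian (fun y => f y * g y) x = f x * Laplacian.laplacian g x
      + 2 * inner ℝ (gradient f x) (gradient g x) + g x * Laplacian.laplacian f x := by
  have hfg : DifferentiableAt ℝ (gradient f) x :=
    (contDiff_gradient (n := 1) hf).differentiable (by simp) x
  have hgg : DifferentiableAt ℝ (gradient g) x :=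
    (contDiff_gradient (n := 1) hg).differentiable (by simp) x
  have hf1 := fun y => ContDiff.hasGradientAt' hf (by simp) y
  have hg1 := fun y => ContDiff.hasGradientAt' hg (by simp) y
  rw [laplacian_eq_divergence (fun y => HasGradientAt.mul' (hf1 y) (hg1 y))
    (((hf1 x).differentiableAt.smul hgg).add ((hg1 x).differentiableAt.smul hfg)),
    divergence_add (F := fun y => f y • gradient g y) (G := fun y => g y • gradient f y)
      ((hf1 x).differentiableAt.smul hgg) ((hg1 x).differentiableAt.smul hfg),
    divergence_smul (hf1 x) hgg, divergence_smul (hg1 x) hfg,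
    laplacian_eq_divergence_gradient hf, laplacian_eq_divergence_gradient hg,
    real_inner_comm (gradient f x) (gradient g x)]
  ring

/-- The divergence theorem for compactly supported fields. -/
lemma integral_divergence_eq_zero {F : E d → E d} (hF : ContDiff ℝ 1 F)
    (hc : HasCompactSupport F) : ∫ x, divergence F x = 0 := by
  have hcf : HasCompactSupport (fderiv ℝ F) := hc.fderiv ℝ
  have hcont : ∀ i : Fin d, Continuous fun x => (fderiv ℝ F x (EuclideanSpace.single i 1)) i :=
    fun i => by
      have h1 : Continuous (fderiv ℝ F) := hF.continuous_fderiv (by simp)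
      have h2 : Continuous fun x => fderiv ℝ F x (EuclideanSpace.single i 1) :=
        h1.clm_apply continuous_const
      exact (EuclideanSpace.proj (𝕜 := ℝ) i).continuous.comp h2
  have hci : ∀ i : Fin d,
      HasCompactSupport fun x => (fderiv ℝ F x (EuclideanSpace.single i 1)) i :=
    fun i => hcf.comp_left (g := fun L : E d →L[ℝ] E d => (L (EuclideanSpace.single i 1)) i)
      (by simp)
  unfold divergence
  rw [integral_finsetSum _ fun i _ => (hcont i).integrable_of_hasCompactSupport (hci i)]
  refine Finset.sum_eq_zero fun i _ => ?_
  have hFi : ∀ x, HasFDerivAt (fun x => F x i)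
      ((EuclideanSpace.proj (𝕜 := ℝ) i).comp (fderiv ℝ F x)) x := fun x =>
    (EuclideanSpace.proj (𝕜 := ℝ) i).hasFDerivAt.comp x
      (hF.differentiable (by simp) x).hasFDerivAt
  have hFc : Continuous fun x => F x i :=
    (EuclideanSpace.proj (𝕜 := ℝ) i).continuous.comp hF.continuous
  have hFs : HasCompactSupport fun x => F x i :=
    hc.comp_left (g := fun y : E d => y i) (by simp)
  -- Integration by parts against the constant function 1.
  have key := integral_mul_fderiv_eq_neg_fderiv_mul_of_integrable (μ := volume)
    (f := fun _ : E d => (1 : ℝ)) (g := fun x => F x i) (v := EuclideanSpace.single i 1)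
    (by simp)
    (by
      simp only [one_mul]
      have : (fun x => fderiv ℝ (fun x => F x i) x (EuclideanSpace.single i 1)) =
          fun x => (fderiv ℝ F x (EuclideanSpace.single i 1)) i := by
        ext x; rw [(hFi x).fderiv]; rfl
      rw [this]
      exact (hcont i).integrable_of_hasCompactSupport (hci i))
    (by simpa using hFc.integrable_of_hasCompactSupport hFs)
    (fun x _ => differentiableAt_const _)
    (fun x _ => (hFi x).differentiableAt)
  simp only [one_mul, fderiv_fun_const, Pi.zero_apply, _root_.zero_apply, zero_mul, integral_zero,
    neg_zero] at key
  rw [← key]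
  refine integral_congr_ae (Eventually.of_forall fun x => ?_)
  simp only
  rw [(hFi x).fderiv]
  rfl

/-- If the second derivative were positive, the point would be a local minimum as well, so `f` would
be locally constant and its second derivative would vanish. -/
lemma deriv_deriv_nonpos_of_isLocalMax {f : ℝ → ℝ} {x : ℝ} (h : IsLocalMax f x)
    (hc : ContinuousAt f x) : deriv (deriv f) x ≤ 0 := by
  by_contra hpos
  push Not at hpos
  have hmin := isLocalMin_of_deriv_deriv_pos hpos h.deriv_eq_zero hc
  have heq : f =ᶠ[𝓝 x] fun _ => f x := by
    filter_upwards [h, hmin] with y h1 h2 using le_antisymm h1 h2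
  have h2 : deriv f =ᶠ[𝓝 x] fun _ => 0 := by
    have := heq.deriv
    simpa using this
  rw [h2.deriv_eq] at hpos
  simp at hpos

lemma laplacian_nonpos_of_isLocalMax {f : E d → ℝ} {x : E d} (h : IsLocalMax f x)
    (hf : ContDiffAt ℝ 2 f x) : Laplacian.laplacian f x ≤ 0 := by
  rw [InnerProductSpace.laplacian_eq_iteratedFDeriv_orthonormalBasis f
    (EuclideanSpace.basisFun (Fin d) ℝ)]
  refine Finset.sum_nonpos fun i _ => ?_
  rw [iteratedFDeriv_two_apply]
  simp only [Matrix.cons_val_zero, Matrix.cons_val_one]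
  set e := EuclideanSpace.basisFun (Fin d) ℝ i
  have hline : ∀ t : ℝ, HasDerivAt (fun s : ℝ => x + s • e) e t := fun t => by
    simpa using ((hasDerivAt_id t).smul_const e).const_add x
  have hlc : Continuous fun s : ℝ => x + s • e := by fun_prop
  have hl0 : Tendsto (fun s : ℝ => x + s • e) (𝓝 0) (𝓝 x) := by
    have := hlc.tendsto 0
    simpa using this
  have hdiff : ∀ᶠ y in 𝓝 x, DifferentiableAt ℝ f y := by
    filter_upwards [hf.eventually (by simp)] with y hy using hy.differentiableAt (by simp)
  have hd1 : deriv (fun s : ℝ => f (x + s • e)) =ᶠ[𝓝 0] fun s => fderiv ℝ f (x + s • e) e := by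
    filter_upwards [hl0.eventually hdiff] with s hs
    exact (hs.hasFDerivAt.comp_hasDerivAt s (hline s)).deriv
  have hfd : DifferentiableAt ℝ (fderiv ℝ f) x :=
    (hf.fderiv_right (m := 1) (by norm_num)).differentiableAt (by simp)
  have hd2 : HasDerivAt (fun s : ℝ => fderiv ℝ f (x + s • e) e) (fderiv ℝ (fderiv ℝ f) x e e) 0 := by
    have h1 : HasFDerivAt (fderiv ℝ f) (fderiv ℝ (fderiv ℝ f) x) (x + (0 : ℝ) • e) := by
      simpa using hfd.hasFDerivAt
    have h2 := h1.comp_hasDerivAt (0 : ℝ) (hline 0)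
    simpa using h2.clm_apply (hasDerivAt_const (0 : ℝ) e)
  have key := deriv_deriv_nonpos_of_isLocalMax (f := fun s : ℝ => f (x + s • e)) (x := 0)
    (by
      have : ∀ᶠ y in 𝓝 x, f y ≤ f x := h
      have h3 := hl0.eventually this
      simpa [IsLocalMax, IsMaxFilter] using h3)
    (by
      have h4 : ContinuousAt f (x + (0 : ℝ) • e) := by simpa using hf.continuousAt
      exact ContinuousAt.comp (f := fun s : ℝ => x + s • e) h4 hlc.continuousAt)
  rwa [hd1.deriv_eq, hd2.deriv] at key

end Calculus

/-! ### One-sided bound for the difference of two value functions -/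

section MaximumPrinciple

variable {d : ℕ}

/-- For `k > 0` the barrier tends to -∞ at the sphere of radius `R`, which keeps maxima away from
the boundary whatever the growth of the function it is added to. -/
lemma laplacian_log_barrier {a x : E d} {R k : ℝ} (hx : ‖x - a‖ < R) :
    HasGradientAt (fun y => 4 * k * Real.log (R ^ 2 - ‖y - a‖ ^ 2))
      ((-8 * k * (R ^ 2 - ‖x - a‖ ^ 2)⁻¹) • (x - a)) x ∧
    Laplacian.laplacian (fun y => 4 * k * Real.log (R ^ 2 - ‖y - a‖ ^ 2)) x =
      -16 * k * ‖x - a‖ ^ 2 * ((R ^ 2 - ‖x - a‖ ^ 2)⁻¹) ^ 2 - 8 * k * d * (R ^ 2 - ‖x - a‖ ^ 2)⁻¹ := by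
  have hpos : ∀ y : E d, ‖y - a‖ < R → 0 < R ^ 2 - ‖y - a‖ ^ 2 := fun y hy => by
    nlinarith [norm_nonneg (y - a)]
  have hD : ∀ y : E d, HasGradientAt (fun y => R ^ 2 - ‖y - a‖ ^ 2) ((-2 : ℝ) • (y - a)) y :=
    fun y => by
      have h := HasGradientAt.sub' (hasGradientAt_const y (R ^ 2)) (hasGradientAt_norm_sq a y)
      simpa using h
  have hgrad : ∀ y : E d, ‖y - a‖ < R →
      HasGradientAt (fun y => 4 * k * Real.log (R ^ 2 - ‖y - a‖ ^ 2))
      ((-8 * k * (R ^ 2 - ‖y - a‖ ^ 2)⁻¹) • (y - a)) y := fun y hy => by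
    have h := HasGradientAt.const_mul' (4 * k)
      (HasGradientAt.comp_real (Real.hasDerivAt_log (hpos y hy).ne') (hD y))
    convert h using 1
    simp only [smul_smul]
    congr 1
    ring
  refine ⟨hgrad x hx, ?_⟩
  have hev : ∀ᶠ y in 𝓝 x, ‖y - a‖ < R := by
    have : Continuous fun y : E d => ‖y - a‖ := by fun_prop
    exact this.continuousAt.eventually_lt_const hx
  have hinv : HasGradientAt (fun y => -8 * k * (R ^ 2 - ‖y - a‖ ^ 2)⁻¹)
      ((-8 * k) • ((-((R ^ 2 - ‖x - a‖ ^ 2) ^ 2)⁻¹) • ((-2 : ℝ) • (x - a)))) x :=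
    HasGradientAt.const_mul' _
      (HasGradientAt.comp_real (hasDerivAt_inv (hpos x hx).ne') (hD x))
  have hid : DifferentiableAt ℝ (fun y : E d => y - a) x := by fun_prop
  rw [laplacian_eq_divergence_of_eventually (hev.mono hgrad) (hinv.differentiableAt.smul hid),
    divergence_smul hinv hid, divergence_sub_const]
  simp only [inner_smul_left, real_inner_self_eq_norm_sq, conj_trivial]
  rw [inv_pow]
  ring

/-- Let z maximise W + 4k log D, where D = R² - |y - a|². There ∇W = 8k(z - a)/D, so |∇W|²/2
contributes 32k²|z - a|²/D², while kΔW is at most 16k²|z - a|²/D² + 8k²d/D. The coefficient 4k,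
being larger than 2k, lets the gradient term win with something to spare, and the drift term has a
favourable sign because `S` is positive semidefinite. -/
lemma le_of_hjb_on_ball {k ℓ : ℝ} (hk : 0 < k) (hℓ : 0 < ℓ) {S : Mat d} (hS : S.PosSemidef)
    {a : E d} {W : E d → ℝ} (hW : ContDiff ℝ 2 W)
    (h : ∀ x, -k * Laplacian.laplacian W x + 1 / 2 * ‖gradient W x‖ ^ 2
      + inner ℝ (gradient W x) (app S (x - a)) + ℓ * W x = 0)
    {R : ℝ} {x : E d} (hx : ‖x - a‖ < R) :
    W x ≤ 8 * k ^ 2 * d * (1 + d / 2) / ℓ * (R ^ 2)⁻¹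
      - 4 * k * Real.log (1 - ‖x - a‖ ^ 2 * (R ^ 2)⁻¹) := by
  have hR : 0 < R := (norm_nonneg _).trans_lt hx
  have hpos : ∀ y : E d, ‖y - a‖ < R → 0 < R ^ 2 - ‖y - a‖ ^ 2 := fun y hy => by
    nlinarith [norm_nonneg (y - a)]
  -- The exponential of (W + 4k log D)/(4k) is maximised instead: it is continuous up to the
  -- boundary and vanishes there.
  obtain ⟨z, hz, hmax⟩ := (isCompact_closedBall a R).exists_isMaxOn
    (f := fun y => Real.exp (W y / (4 * k)) * (R ^ 2 - ‖y - a‖ ^ 2))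
    ⟨a, Metric.mem_closedBall_self hR.le⟩
    (by
      have := hW.continuous
      fun_prop)
  have hzR : ‖z - a‖ < R := by
    have h1 := hmax (Metric.mem_closedBall_self hR.le : a ∈ Metric.closedBall a R)
    simp only [Set.mem_ofPred_eq, sub_self, norm_zero] at h1
    have h2 : 0 < Real.exp (W a / (4 * k)) * (R ^ 2 - 0 ^ 2) := by
      have : 0 < R ^ 2 - 0 ^ 2 := by nlinarith
      positivity
    have h3 : 0 < R ^ 2 - ‖z - a‖ ^ 2 :=
      pos_of_mul_pos_right (h2.trans_le h1) (Real.exp_pos _).le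
    nlinarith [norm_nonneg (z - a)]
  set F : E d → ℝ := fun y => W y + 4 * k * Real.log (R ^ 2 - ‖y - a‖ ^ 2) with hF
  have hFle : ∀ y : E d, ‖y - a‖ < R → F y ≤ F z := fun y hy => by
    have h1 := hmax (show y ∈ Metric.closedBall a R by
      rw [Metric.mem_closedBall, dist_eq_norm]; exact hy.le)
    simp only [Set.mem_ofPred_eq] at h1
    have h2 := Real.log_le_log (mul_pos (Real.exp_pos _) (hpos y hy)) h1
    rw [Real.log_mul (Real.exp_ne_zero _) (hpos y hy).ne', Real.log_exp,
      Real.log_mul (Real.exp_ne_zero _) (hpos z hzR).ne', Real.log_exp] at h2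
    have h3 := mul_le_mul_of_nonneg_left h2 (show 0 ≤ 4 * k by positivity)
    rw [mul_add, mul_add, mul_div_cancel₀ _ (show 4 * k ≠ 0 by positivity),
      mul_div_cancel₀ _ (show 4 * k ≠ 0 by positivity)] at h3
    exact h3
  have hloc : IsLocalMax F z := by
    have : Continuous fun y : E d => ‖y - a‖ := by fun_prop
    filter_upwards [this.continuousAt.eventually_lt_const hzR] with y hy using hFle y hy
  obtain ⟨hg, hlap⟩ := laplacian_log_barrier (k := k) hzR
  have hlog : ContDiffAt ℝ 2 (fun y => 4 * k * Real.log (R ^ 2 - ‖y - a‖ ^ 2)) z := by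
    refine contDiffAt_const.mul (ContDiffAt.log ?_ (hpos z hzR).ne')
    exact (contDiff_const.sub ((contDiff_id.sub contDiff_const).norm_sq ℝ)).contDiffAt
  have hl0 := laplacian_nonpos_of_isLocalMax hloc (hW.contDiffAt.add hlog)
  have hsum : Laplacian.laplacian F z = Laplacian.laplacian W z
      + Laplacian.laplacian (fun y => 4 * k * Real.log (R ^ 2 - ‖y - a‖ ^ 2)) z :=
    hW.contDiffAt.laplacian_add hlog
  have hgW : gradient W z = (8 * k * (R ^ 2 - ‖z - a‖ ^ 2)⁻¹) • (z - a) := by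
    have h1 := HasGradientAt.add' (ContDiff.hasGradientAt' hW (by simp) z) hg
    have h2 : fderiv ℝ F z = 0 := hloc.fderiv_eq_zero
    have h3 := (hasGradientAt_iff_hasFDerivAt.1 h1).fderiv
    rw [h2] at h3
    have h4 : gradient W z + (-8 * k * (R ^ 2 - ‖z - a‖ ^ 2)⁻¹) • (z - a) = 0 := by
      have := h3.symm
      simpa only [map_eq_zero_iff _ (InnerProductSpace.toDual ℝ (E d)).injective] using this
    rw [eq_neg_of_add_eq_zero_left h4, ← neg_smul]
    congr 1
    ring
  have hWz : W z ≤ 8 * k ^ 2 * d * (1 + d / 2) / ℓ * (R ^ 2)⁻¹ := by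
    have hz' := h z
    rw [hgW, norm_smul, inner_smul_left] at hz'
    rw [hsum, hlap] at hl0
    have hb : 0 ≤ inner ℝ (z - a) (app S (z - a)) := bil_nonneg hS _
    have hD := hpos z hzR
    set D := R ^ 2 - ‖z - a‖ ^ 2 with hDdef
    have hDi : 0 < D⁻¹ := inv_pos.2 hD
    have hDD : D * D⁻¹ = 1 := mul_inv_cancel₀ hD.ne'
    have hnorm : (‖8 * k * D⁻¹‖ * ‖z - a‖) ^ 2 = 64 * k ^ 2 * (D⁻¹) ^ 2 * ‖z - a‖ ^ 2 := by
      rw [mul_pow, Real.norm_eq_abs, sq_abs]; ring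
    rw [hnorm] at hz'
    simp only [conj_trivial] at hz'
    have hc : 0 ≤ 8 * k * D⁻¹ * inner ℝ (z - a) (app S (z - a)) := by positivity
    have hkl := mul_le_mul_of_nonneg_left hl0 hk.le
    have hmain : ℓ * W z ≤ 8 * k ^ 2 * d * D⁻¹ - 16 * k ^ 2 * ‖z - a‖ ^ 2 * (D⁻¹) ^ 2 := by
      nlinarith
    have hfin : 8 * k ^ 2 * d * D⁻¹ - 16 * k ^ 2 * ‖z - a‖ ^ 2 * (D⁻¹) ^ 2 ≤
        8 * k ^ 2 * d * (1 + d / 2) * (R ^ 2)⁻¹ := by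
      have hfac : 8 * k ^ 2 * d * D⁻¹ - 16 * k ^ 2 * ‖z - a‖ ^ 2 * (D⁻¹) ^ 2 =
          8 * k ^ 2 * (D⁻¹) ^ 2 * (d * D - 2 * ‖z - a‖ ^ 2) := by
        have : (D⁻¹) ^ 2 * D = D⁻¹ := by rw [sq, mul_assoc, inv_mul_cancel₀ hD.ne', mul_one]
        linear_combination (-8 * k ^ 2 * (d : ℝ)) * this
      -- Near the sphere the negative term dominates and the expression is nonpositive; otherwise R²
      -- ≤ D(1 + d/2), so D⁻¹ is of order R⁻².
      rcases le_total ((d : ℝ) * D) (2 * ‖z - a‖ ^ 2) with hle | hle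
      · rw [hfac]
        have h1 : 8 * k ^ 2 * (D⁻¹) ^ 2 * (d * D - 2 * ‖z - a‖ ^ 2) ≤ 0 :=
          mul_nonpos_of_nonneg_of_nonpos (by positivity) (by linarith)
        exact h1.trans (by positivity)
      · have h1 : R ^ 2 ≤ D * (1 + d / 2) := by nlinarith
        have h2 : D⁻¹ ≤ (1 + d / 2) * (R ^ 2)⁻¹ := by
          rw [inv_eq_one_div, div_le_iff₀ hD, mul_assoc, mul_comm (R ^ 2)⁻¹, ← mul_assoc,
            ← div_eq_mul_inv, one_le_div (by positivity)]
          linarith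
        have h3 : 0 ≤ 16 * k ^ 2 * ‖z - a‖ ^ 2 * (D⁻¹) ^ 2 := by positivity
        have h4 := mul_le_mul_of_nonneg_left h2 (show 0 ≤ 8 * k ^ 2 * (d : ℝ) by positivity)
        linarith
    have := hmain.trans hfin
    rw [div_mul_eq_mul_div, le_div_iff₀ hℓ]
    linarith
  have h5 := hFle x hx
  simp only [hF] at h5
  have h6 : Real.log (R ^ 2 - ‖z - a‖ ^ 2) ≤ Real.log (R ^ 2) :=
    Real.log_le_log (hpos z hzR) (by nlinarith [sq_nonneg ‖z - a‖])
  have h7 : Real.log (1 - ‖x - a‖ ^ 2 * (R ^ 2)⁻¹) =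
      Real.log (R ^ 2 - ‖x - a‖ ^ 2) - Real.log (R ^ 2) := by
    rw [← Real.log_div (hpos x hx).ne' (by positivity)]
    congr 1
    field_simp
  rw [h7]
  have h8 := mul_le_mul_of_nonneg_left h6 (show 0 ≤ 4 * k by positivity)
  linarith

/-- Both terms of the bound on the ball vanish as R → ∞ with `x` fixed. -/
lemma nonpos_of_hjb {k ℓ : ℝ} (hk : 0 < k) (hℓ : 0 < ℓ) {S : Mat d} (hS : S.PosSemidef)
    {a : E d} {W : E d → ℝ} (hW : ContDiff ℝ 2 W)
    (h : ∀ x, -k * Laplacian.laplacian W x + 1 / 2 * ‖gradient W x‖ ^ 2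
      + inner ℝ (gradient W x) (app S (x - a)) + ℓ * W x = 0) (x : E d) : W x ≤ 0 := by
  have hinv : Tendsto (fun R : ℝ => (R ^ 2)⁻¹) atTop (𝓝 0) :=
    tendsto_inv_atTop_zero.comp (tendsto_pow_atTop (by norm_num))
  have hlim : Tendsto (fun R : ℝ => 8 * k ^ 2 * d * (1 + d / 2) / ℓ * (R ^ 2)⁻¹
      - 4 * k * Real.log (1 - ‖x - a‖ ^ 2 * (R ^ 2)⁻¹)) atTop
      (𝓝 (8 * k ^ 2 * d * (1 + d / 2) / ℓ * 0 - 4 * k * Real.log (1 - ‖x - a‖ ^ 2 * 0))) := by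
    refine (hinv.const_mul _).sub (Tendsto.const_mul _ (Tendsto.log ?_ (by simp)))
    exact tendsto_const_nhds.sub (hinv.const_mul _)
  simp only [mul_zero, sub_zero, Real.log_one] at hlim
  refine ge_of_tendsto hlim ?_
  filter_upwards [eventually_gt_atTop ‖x - a‖] with R hR
  exact le_of_hjb_on_ball hk hℓ hS hW h hR

end MaximumPrinciple

/-! ### Cutoff functions -/

section Cutoff

variable {d : ℕ}

/-- Cutoff functions at distance of order `n` from the point `a`. -/
def cutoff (a : E d) (n : ℕ) (x : E d) : ℝ :=
  Real.smoothTransition (2 - ((n + 1 : ℝ) ^ 2)⁻¹ * ‖x - a‖ ^ 2)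

lemma contDiff_cutoff (a : E d) (n : ℕ) : ContDiff ℝ 2 (cutoff a n) :=
  Real.smoothTransition.contDiff.comp
    (contDiff_const.sub (contDiff_const.mul ((contDiff_id.sub contDiff_const).norm_sq ℝ)))

lemma cutoff_nonneg (a : E d) (n : ℕ) (x : E d) : 0 ≤ cutoff a n x :=
  Real.smoothTransition.nonneg _

lemma cutoff_mono (a : E d) (x : E d) : Monotone fun n => cutoff a n x := fun n m h => by
  refine Real.smoothTransition.monotone ?_
  have : (n : ℝ) ≤ m := by exact_mod_cast h
  gcongr

lemma cutoff_eq_zero {a : E d} {n : ℕ} {x : E d} (h : 2 * (n + 1 : ℝ) ^ 2 ≤ ‖x - a‖ ^ 2) :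
    cutoff a n x = 0 := by
  refine Real.smoothTransition.zero_of_nonpos ?_
  have hn : (0 : ℝ) < (n + 1 : ℝ) ^ 2 := by positivity
  have := mul_le_mul_of_nonneg_left h (inv_nonneg.2 hn.le)
  have h2 : ((n + 1 : ℝ) ^ 2)⁻¹ * (2 * (n + 1 : ℝ) ^ 2) = 2 := by field_simp
  linarith

lemma cutoff_eq_one {a : E d} {n : ℕ} {x : E d} (h : ‖x - a‖ ^ 2 ≤ (n + 1 : ℝ) ^ 2) :
    cutoff a n x = 1 := by
  refine Real.smoothTransition.one_of_one_le ?_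
  have hn : (0 : ℝ) < (n + 1 : ℝ) ^ 2 := by positivity
  have := mul_le_mul_of_nonneg_left h (inv_nonneg.2 hn.le)
  rw [inv_mul_cancel₀ hn.ne'] at this
  linarith

lemma hasCompactSupport_cutoff (a : E d) (n : ℕ) : HasCompactSupport (cutoff a n) := by
  refine HasCompactSupport.intro (isCompact_closedBall a (2 * (n + 1))) fun x hx => ?_
  rw [Metric.mem_closedBall, dist_eq_norm, not_le] at hx
  refine cutoff_eq_zero ?_
  have : (0 : ℝ) < n + 1 := by positivity
  nlinarith

lemma cutoff_eventuallyEq_one (a x : E d) : ∀ᶠ n in atTop, cutoff a n =ᶠ[𝓝 x] fun _ => 1 := by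
  obtain ⟨n₀, hn₀⟩ := exists_nat_gt ‖x - a‖
  filter_upwards [eventually_ge_atTop n₀] with n hn
  have hc : Continuous fun y : E d => ‖y - a‖ := by fun_prop
  have hlt : ‖x - a‖ < n + 1 := by
    have : (n₀ : ℝ) ≤ n := by exact_mod_cast hn
    linarith
  filter_upwards [hc.continuousAt.eventually_lt_const hlt] with y hy
  refine cutoff_eq_one ?_
  nlinarith [norm_nonneg (y - a)]

lemma gradient_cutoff_eventually_eq_zero (a x : E d) :
    ∀ᶠ n in atTop, gradient (cutoff a n) x = 0 := by
  filter_upwards [cutoff_eventuallyEq_one a x] with n hn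
  rw [hn.gradient_eq, gradient_fun_const]

lemma laplacian_cutoff_eventually_eq_zero (a x : E d) :
    ∀ᶠ n in atTop, Laplacian.laplacian (cutoff a n) x = 0 := by
  filter_upwards [cutoff_eventuallyEq_one a x] with n hn
  rw [(InnerProductSpace.laplacian_congr_nhds hn).eq_of_nhds]
  exact congrFun InnerProductSpace.laplacian_const x

lemma exists_bound_deriv_smoothTransition :
    ∃ C : ℝ, 0 ≤ C ∧ ∀ t, |deriv Real.smoothTransition t| ≤ C ∧
      |deriv (deriv Real.smoothTransition) t| ≤ C := by
  have hs : ContDiff ℝ 2 Real.smoothTransition := Real.smoothTransition.contDiff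
  have hs1 : ContDiff ℝ 1 (deriv Real.smoothTransition) :=
    (contDiff_succ_iff_deriv (n := 1).1 hs).2.2
  have h0 : ∀ t < (0 : ℝ), deriv Real.smoothTransition t = 0 := fun t ht => by
    have : Real.smoothTransition =ᶠ[𝓝 t] fun _ => 0 := by
      filter_upwards [Iio_mem_nhds ht] with y hy
        using Real.smoothTransition.zero_of_nonpos (le_of_lt hy)
    rw [this.deriv_eq]; simp
  have h1 : ∀ t > (1 : ℝ), deriv Real.smoothTransition t = 0 := fun t ht => by
    have : Real.smoothTransition =ᶠ[𝓝 t] fun _ => 1 := by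
      filter_upwards [Ioi_mem_nhds ht] with y hy
        using Real.smoothTransition.one_of_one_le (le_of_lt hy)
    rw [this.deriv_eq]; simp
  have hc : HasCompactSupport (deriv Real.smoothTransition) := by
    refine HasCompactSupport.intro (isCompact_Icc (a := (0 : ℝ)) (b := 1)) fun t ht => ?_
    rw [Set.mem_Icc, not_and_or, not_le, not_le] at ht
    exact ht.elim (h0 t) (h1 t)
  obtain ⟨C₁, hC₁⟩ := hc.exists_bound_of_continuous hs1.continuous
  obtain ⟨C₂, hC₂⟩ := hc.deriv.exists_bound_of_continuous (hs1.continuous_deriv le_rfl)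
  refine ⟨max C₁ C₂, ((norm_nonneg _).trans (hC₁ 0)).trans (le_max_left _ _), fun t => ⟨?_, ?_⟩⟩
  · exact (hC₁ t).trans (le_max_left _ _)
  · exact (hC₂ t).trans (le_max_right _ _)

lemma exists_bound_bil (M : Mat d) : ∃ C : ℝ, 0 ≤ C ∧ ∀ x y : E d, |bil M x y| ≤ C * (‖x‖ * ‖y‖) := by
  refine ⟨‖Matrix.toEuclideanCLM (n := Fin d) (𝕜 := ℝ) M‖, norm_nonneg _, fun x y => ?_⟩
  calc |bil M x y| ≤ ‖x‖ * ‖app M y‖ := abs_real_inner_le_norm _ _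
    _ ≤ ‖x‖ * (‖Matrix.toEuclideanCLM (n := Fin d) (𝕜 := ℝ) M‖ * ‖y‖) := by
      gcongr
      exact (Matrix.toEuclideanCLM (n := Fin d) (𝕜 := ℝ) M).le_opNorm y
    _ = _ := by ring

lemma cutoff_derivatives (a : E d) (n : ℕ) (x : E d) :
    gradient (cutoff a n) x = (deriv Real.smoothTransition (2 - ((n + 1 : ℝ) ^ 2)⁻¹ * ‖x - a‖ ^ 2)
      * (-2 * ((n + 1 : ℝ) ^ 2)⁻¹)) • (x - a) ∧
    Laplacian.laplacian (cutoff a n) x =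
      deriv (deriv Real.smoothTransition) (2 - ((n + 1 : ℝ) ^ 2)⁻¹ * ‖x - a‖ ^ 2)
        * (4 * (((n + 1 : ℝ) ^ 2)⁻¹) ^ 2 * ‖x - a‖ ^ 2)
      - deriv Real.smoothTransition (2 - ((n + 1 : ℝ) ^ 2)⁻¹ * ‖x - a‖ ^ 2)
        * (2 * ((n + 1 : ℝ) ^ 2)⁻¹ * d) := by
  set c := ((n + 1 : ℝ) ^ 2)⁻¹ with hc
  have hs : ContDiff ℝ 2 Real.smoothTransition := Real.smoothTransition.contDiff
  have hs1 : ContDiff ℝ 1 (deriv Real.smoothTransition) :=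
    (contDiff_succ_iff_deriv (n := 1).1 hs).2.2
  have hd : ∀ t, HasDerivAt Real.smoothTransition (deriv Real.smoothTransition t) t := fun t =>
    (hs.differentiable (by simp) t).hasDerivAt
  have hd2 : ∀ t, HasDerivAt (deriv Real.smoothTransition)
      (deriv (deriv Real.smoothTransition) t) t := fun t =>
    (hs1.differentiable (by simp) t).hasDerivAt
  have hq : ∀ y : E d, HasGradientAt (fun y => 2 - c * ‖y - a‖ ^ 2) ((-2 * c) • (y - a)) y :=
    fun y => by
      have h := HasGradientAt.sub' (hasGradientAt_const y (2 : ℝ))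
        (HasGradientAt.const_mul' c (hasGradientAt_norm_sq a y))
      convert h using 1
      rw [zero_sub, smul_smul, ← neg_smul]
      congr 1
      ring
  have hq2 : ContDiff ℝ 2 (fun y : E d => 2 - c * ‖y - a‖ ^ 2) :=
    contDiff_const.sub (contDiff_const.mul ((contDiff_id.sub contDiff_const).norm_sq ℝ))
  constructor
  · have := (HasGradientAt.comp_real (hd _) (hq x)).gradient
    rw [smul_smul] at this
    exact this
  · have h1 := laplacian_comp_real hq2 (x := x) hd (hd2 _)
    have hid : DifferentiableAt ℝ (fun y : E d => y - a) x := by fun_prop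
    have hlq := laplacian_eq_divergence (x := x) hq (hid.fun_const_smul (-2 * c))
    rw [divergence_const_smul _ hid, divergence_sub_const] at hlq
    rw [hlq, (hq x).gradient, norm_smul, mul_pow, Real.norm_eq_abs, sq_abs] at h1
    refine h1.trans ?_
    ring

/-- The gradient of the cutoff is of size |x - a|/(n+1)² and is supported where |x - a|² ≤ 2(n+1)²,
so it compensates the linear growth of the drift exactly. A bound independent of `n` lets dominated
convergence run with no more than an integrable weight. -/
lemma exists_bound_cutoff (a : E d) (S : Mat d) (k : ℝ) : ∃ C : ℝ, 0 ≤ C ∧ ∀ n x,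
    ‖gradient (cutoff a n) x‖ ≤ C ∧
    |k * Laplacian.laplacian (cutoff a n) x
      - inner ℝ (app S (x - a)) (gradient (cutoff a n) x)| ≤ C := by
  obtain ⟨C₁, hC₁, hb⟩ := exists_bound_deriv_smoothTransition
  obtain ⟨C₂, hC₂, hS⟩ := exists_bound_bil S
  refine ⟨max (C₁ * 4) (|k| * (C₁ * 8 + C₁ * (2 * d)) + C₁ * (2 * (C₂ * 2))), by positivity,
    fun n x => ?_⟩
  obtain ⟨hg, hl⟩ := cutoff_derivatives a n x
  have hsupp : 2 * (n + 1 : ℝ) ^ 2 < ‖x - a‖ ^ 2 →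
      gradient (cutoff a n) x = 0 ∧ Laplacian.laplacian (cutoff a n) x = 0 := fun h => by
    have hev : cutoff a n =ᶠ[𝓝 x] fun _ => 0 := by
      have hc : Continuous fun y : E d => ‖y - a‖ ^ 2 := by fun_prop
      filter_upwards [hc.continuousAt.eventually_const_lt h] with y hy
        using cutoff_eq_zero hy.le
    refine ⟨by rw [hev.gradient_eq, gradient_fun_const], ?_⟩
    rw [(InnerProductSpace.laplacian_congr_nhds hev).eq_of_nhds]
    exact congrFun InnerProductSpace.laplacian_const x
  rcases lt_or_ge (2 * (n + 1 : ℝ) ^ 2) (‖x - a‖ ^ 2) with h | h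
  · obtain ⟨h1, h2⟩ := hsupp h
    rw [h1, h2]
    simp only [norm_zero, mul_zero, inner_zero_right, sub_zero, abs_zero]
    constructor <;> positivity
  set c := ((n + 1 : ℝ) ^ 2)⁻¹ with hc
  have hn1 : (1 : ℝ) ≤ (n + 1 : ℝ) ^ 2 := by
    have : (0 : ℝ) ≤ n := by positivity
    nlinarith
  have hc0 : 0 ≤ c := by positivity
  have hc1 : c ≤ 1 := inv_le_one_of_one_le₀ hn1
  have hcx : c * ‖x - a‖ ^ 2 ≤ 2 := by
    have := mul_le_mul_of_nonneg_left h hc0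
    have h2 : c * (2 * (n + 1 : ℝ) ^ 2) = 2 := by rw [hc]; field_simp
    linarith
  have hcx' : c * ‖x - a‖ ≤ 2 := by
    have : (c * ‖x - a‖) ^ 2 ≤ 2 := by nlinarith [norm_nonneg (x - a), sq_nonneg ‖x - a‖]
    nlinarith [norm_nonneg (x - a)]
  obtain ⟨hb1, hb2⟩ := hb (2 - c * ‖x - a‖ ^ 2)
  set θ₁ := deriv Real.smoothTransition (2 - c * ‖x - a‖ ^ 2)
  set θ₂ := deriv (deriv Real.smoothTransition) (2 - c * ‖x - a‖ ^ 2)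
  constructor
  · refine le_trans ?_ (le_max_left _ _)
    rw [hg, norm_smul, Real.norm_eq_abs, abs_mul, abs_mul, abs_of_nonneg hc0, mul_assoc]
    refine mul_le_mul hb1 ?_ (by positivity) hC₁
    have : |(-2 : ℝ)| = 2 := by norm_num
    rw [this]
    linarith
  · refine le_trans ?_ (le_max_right _ _)
    rw [hl, hg, inner_smul_right]
    refine (abs_sub _ _).trans (add_le_add ?_ ?_)
    · rw [abs_mul]
      refine mul_le_mul_of_nonneg_left ((abs_sub _ _).trans (add_le_add ?_ ?_)) (abs_nonneg k)
      · rw [abs_mul]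
        refine mul_le_mul hb2 ?_ (by positivity) hC₁
        rw [abs_of_nonneg (by positivity)]
        nlinarith [mul_nonneg hc0 (sq_nonneg ‖x - a‖)]
      · rw [abs_mul]
        refine mul_le_mul hb1 ?_ (by positivity) hC₁
        rw [abs_of_nonneg (by positivity)]
        have : c * (d : ℝ) ≤ 1 * d := by gcongr
        linarith
    · rw [abs_mul, abs_mul, mul_assoc]
      refine mul_le_mul hb1 ?_ (by positivity) hC₁
      have h2 : |(-2 * c)| = 2 * c := by
        rw [abs_mul, abs_of_nonneg hc0]; norm_num
      rw [h2, mul_assoc]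
      refine mul_le_mul_of_nonneg_left ?_ (by norm_num)
      have h3 : |inner ℝ (app S (x - a)) (x - a)| ≤ C₂ * (‖x - a‖ * ‖x - a‖) := by
        have := hS (x - a) (x - a)
        rwa [bil, real_inner_comm] at this
      calc c * |inner ℝ (app S (x - a)) (x - a)| ≤ c * (C₂ * (‖x - a‖ * ‖x - a‖)) := by gcongr
        _ = C₂ * (c * ‖x - a‖ ^ 2) := by ring
        _ ≤ C₂ * 2 := by gcongr

/-- The cutoffs increase with `n`, hence so do the integrals; if `g x` were nonzero, one of them
would be positive and would bound the limit from below. -/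
lemma eq_zero_of_tendsto_integral_cutoff {a : E d} {g : E d → ℝ} (hg : Continuous g)
    (h0 : ∀ x, 0 ≤ g x) {p : ℕ} (hp : p ≠ 0)
    (h : Tendsto (fun n => ∫ x, cutoff a n x ^ p * g x) atTop (𝓝 0)) (x : E d) : g x = 0 := by
  by_contra hx
  have hcont : ∀ n, Continuous fun x => cutoff a n x ^ p * g x := fun n =>
    ((contDiff_cutoff a n).continuous.pow p).mul hg
  have hsupp : ∀ n, HasCompactSupport fun x => cutoff a n x ^ p * g x := fun n => by
    have h1 : HasCompactSupport fun x => cutoff a n x ^ p :=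
      (hasCompactSupport_cutoff a n).comp_left (g := fun t : ℝ => t ^ p) (by simp [hp])
    exact h1.mul_right
  obtain ⟨n₀, hn₀⟩ := (cutoff_eventuallyEq_one a x).exists
  have hpos : 0 < ∫ x, cutoff a n₀ x ^ p * g x := by
    refine (hcont n₀).integral_pos_of_hasCompactSupport_nonneg_nonzero (hsupp n₀)
      (fun y => mul_nonneg (pow_nonneg (cutoff_nonneg _ _ _) _) (h0 y)) (x := x) ?_
    rw [hn₀.eq_of_nhds]
    simpa using hx
  have hle : ∀ᶠ n in atTop, ∫ x, cutoff a n₀ x ^ p * g x ≤ ∫ x, cutoff a n x ^ p * g x := by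
    filter_upwards [eventually_ge_atTop n₀] with n hn
    refine integral_mono ((hcont n₀).integrable_of_hasCompactSupport (hsupp n₀))
      ((hcont n).integrable_of_hasCompactSupport (hsupp n)) fun y => ?_
    exact mul_le_mul_of_nonneg_right
      (pow_le_pow_left₀ (cutoff_nonneg _ _ _) (cutoff_mono a y hn) p) (h0 y)
  exact absurd (ge_of_tendsto h hle) (not_le.2 hpos)

end Cutoff

/-! ### Rigidity of stationary solutions -/

section Rigidity

variable {d : ℕ}

lemma hasCompactSupport_gradient {f : E d → ℝ} (hf : HasCompactSupport f) :
    HasCompactSupport (gradient f) :=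
  (hf.fderiv ℝ).comp_left (g := (InnerProductSpace.toDual ℝ (E d)).symm) (by simp)

lemma continuous_laplacian {f : E d → ℝ} (hf : ContDiff ℝ 2 f) :
    Continuous (Laplacian.laplacian f : E d → ℝ) := by
  have h : (Laplacian.laplacian f : E d → ℝ) = divergence (gradient f) :=
    funext fun x => laplacian_eq_divergence_gradient hf x
  rw [h]
  have h1 : Continuous (fderiv ℝ (gradient f)) :=
    (contDiff_gradient (n := 1) hf).continuous_fderiv (by simp)
  refine continuous_finsetSum _ fun i _ => ?_
  exact (EuclideanSpace.proj (𝕜 := ℝ) i).continuous.comp (h1.clm_apply continuous_const)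

/-- Conservative form of the stationary equation, ready to be tested by the divergence theorem. -/
lemma divergence_flux_eq_zero {k : ℝ} {m : E d → ℝ} {b : E d → E d} (hm : ContDiff ℝ 2 m)
    (hb : ContDiff ℝ 1 b)
    (kfp : ∀ x, -k * Laplacian.laplacian m x - divergence (fun y => m y • b y) x = 0) (x : E d) :
    divergence (fun y => k • gradient m y + m y • b y) x = 0 := by
  have hgm : ContDiff ℝ 1 (gradient m) := contDiff_gradient (n := 1) hm
  have hgd := hgm.differentiable (by simp) x
  have hmb : DifferentiableAt ℝ (fun y => m y • b y) x :=
    (hm.differentiable (by simp) x).smul (hb.differentiable (by simp) x)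
  rw [divergence_add (hgd.fun_const_smul k) hmb, divergence_const_smul k hgd,
    ← laplacian_eq_divergence_gradient hm]
  linarith [kfp x]

/-- A stationary density annihilates the generator on compactly supported functions. -/
lemma integral_mul_generator_eq_zero {k : ℝ} {m ψ : E d → ℝ} {b : E d → E d}
    (hm : ContDiff ℝ 2 m) (hb : ContDiff ℝ 1 b)
    (kfp : ∀ x, -k * Laplacian.laplacian m x - divergence (fun y => m y • b y) x = 0)
    (hψ : ContDiff ℝ 2 ψ) (hc : HasCompactSupport ψ) :
    ∫ x, m x * (k * Laplacian.laplacian ψ x - inner ℝ (b x) (gradient ψ x)) = 0 := by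
  have hgm : ContDiff ℝ 1 (gradient m) := contDiff_gradient (n := 1) hm
  have hgψ : ContDiff ℝ 1 (gradient ψ) := contDiff_gradient (n := 1) hψ
  have hm1 : ContDiff ℝ 1 m := hm.of_le (by norm_num)
  have hψ1 : ContDiff ℝ 1 ψ := hψ.of_le (by norm_num)
  have hV : ContDiff ℝ 1 (fun y => k • gradient m y + m y • b y) :=
    (hgm.const_smul k).add (hm1.smul hb)
  have hkψ : ContDiff ℝ 1 (fun y => k • gradient ψ y) := hgψ.const_smul k
  have h1 : ContDiff ℝ 1 (fun y => ψ y • (k • gradient m y + m y • b y)) := hψ1.smul hV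
  have h2 : ContDiff ℝ 1 (fun y => m y • (k • gradient ψ y)) := hm1.smul hkψ
  have hsupp : HasCompactSupport
      (fun y => ψ y • (k • gradient m y + m y • b y) - m y • (k • gradient ψ y)) := by
    have h3 : HasCompactSupport (fun y => m y • (k • gradient ψ y)) := by
      refine (hasCompactSupport_gradient hc).mono fun y hy => ?_
      rw [Function.mem_support] at *
      contrapose! hy
      rw [hy, smul_zero, smul_zero]
    have h4 : HasCompactSupport (fun y => ψ y • (k • gradient m y + m y • b y)) := hc.smul_right
    exact h4.sub h3
  -- Green's identity: the divergence of ψ times the flux, minus that of k m ∇ψ, is the opposite of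
  -- the integrand in the goal.
  have key := integral_divergence_eq_zero (h1.sub h2) hsupp
  rw [← neg_eq_zero, ← integral_neg]
  refine Eq.trans (integral_congr_ae (Eventually.of_forall fun x => ?_)) key
  refine Eq.trans ?_ (divergence_sub (h1.differentiable (by simp) x) (h2.differentiable (by simp) x)).symm
  simp only
  rw [divergence_smul (ContDiff.hasGradientAt' hψ (by simp) x) (hV.differentiable (by simp) x),
    divergence_smul (ContDiff.hasGradientAt' hm (by simp) x) (hkψ.differentiable (by simp) x),
    divergence_const_smul k (hgψ.differentiable (by simp) x),
    ← laplacian_eq_divergence_gradient hψ, divergence_flux_eq_zero hm hb kfp, inner_add_right,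
    inner_smul_right, inner_smul_right, inner_smul_right,
    real_inner_comm (gradient ψ x) (gradient m x), real_inner_comm (gradient ψ x) (b x)]
  ring

lemma hasDerivAt_exp_const_mul (c t : ℝ) :
    HasDerivAt (fun t : ℝ => Real.exp (c * t)) (c * Real.exp (c * t)) t := by
  have := ((hasDerivAt_id t).const_mul c).exp
  simpa [mul_comm] using this

/-- The exponential change of variables removes the quadratic term of the equation for `W`. -/
lemma generator_mul_exp {k ℓ : ℝ} (hk : 0 < k) {b : E d → E d} {W φ : E d → ℝ}
    (hW : ContDiff ℝ 2 W) (hφ : ContDiff ℝ 2 φ) {x : E d}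
    (h : -k * Laplacian.laplacian W x + 1 / 2 * ‖gradient W x‖ ^ 2
      + inner ℝ (gradient W x) (b x) + ℓ * W x = 0) :
    k * Laplacian.laplacian (fun y => φ y * Real.exp (1 / (2 * k) * W y)) x
      - inner ℝ (b x + gradient W x)
        (gradient (fun y => φ y * Real.exp (1 / (2 * k) * W y)) x) =
    Real.exp (1 / (2 * k) * W x) * (k * Laplacian.laplacian φ x - inner ℝ (b x) (gradient φ x))
      - φ x * (Real.exp (1 / (2 * k) * W x) * (ℓ / (2 * k)) * (-W x)) := by
  have hu2 : ContDiff ℝ 2 (fun y => Real.exp (1 / (2 * k) * W y)) := (contDiff_const.mul hW).exp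
  have hgu : HasGradientAt (fun y => Real.exp (1 / (2 * k) * W y))
      ((1 / (2 * k) * Real.exp (1 / (2 * k) * W x)) • gradient W x) x :=
    HasGradientAt.comp_real (φ := fun t => Real.exp (1 / (2 * k) * t))
      (hasDerivAt_exp_const_mul _ _) (ContDiff.hasGradientAt' hW (by simp) x)
  have hlu := laplacian_comp_real (x := x) hW (hasDerivAt_exp_const_mul (1 / (2 * k)))
    ((hasDerivAt_exp_const_mul (1 / (2 * k)) (W x)).const_mul _)
  rw [laplacian_mul hφ hu2, (HasGradientAt.mul' (ContDiff.hasGradientAt' hφ (by simp) x)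
    hgu).gradient, hgu.gradient, hlu]
  simp only [inner_add_left, inner_add_right, inner_smul_right, real_inner_self_eq_norm_sq]
  rw [real_inner_comm (b x) (gradient W x)] at h
  rw [real_inner_comm (gradient W x) (gradient φ x)]
  have hW' : k * Laplacian.laplacian W x = 1 / 2 * ‖gradient W x‖ ^ 2
      + inner ℝ (b x) (gradient W x) + ℓ * W x := by linarith
  -- This relation dictates the exponent: with κk = 1/2 the cross terms ∇W·∇φ cancel, and so do the
  -- terms in |∇W|².
  have hk2 : 1 / (2 * k) * k = 1 / 2 := by field_simp
  have hkk : ℓ / (2 * k) = 1 / (2 * k) * ℓ := by ring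
  rw [hkk]
  generalize Real.exp (1 / (2 * k) * W x) = u at *
  generalize inner ℝ (gradient W x) (gradient φ x) = I₁ at *
  generalize inner ℝ (b x) (gradient W x) = I₂ at *
  generalize inner ℝ (b x) (gradient φ x) = I₃ at *
  generalize Laplacian.laplacian W x = L at *
  generalize ‖gradient W x‖ ^ 2 = n2 at *
  generalize 1 / (2 * k) = κ at *
  linear_combination (φ x * u * κ) * hW' + (φ x * u * κ * n2 + 2 * u * I₁) * hk2

/-- The stationary equation of `m`, with drift `b + ∇W`, is tested with φ exp(W/(2k)). The right
side sees only derivatives of φ, while for φ ≥ 0, m > 0 and W ≤ 0 the left integrand is nonnegative.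
-/
lemma integral_cutoff_identity {k ℓ : ℝ} (hk : 0 < k) {b : E d → E d} {W m φ : E d → ℝ}
    (hb : ContDiff ℝ 1 b) (hW : ContDiff ℝ 2 W) (hm : ContDiff ℝ 2 m)
    (h : ∀ x, -k * Laplacian.laplacian W x + 1 / 2 * ‖gradient W x‖ ^ 2
      + inner ℝ (gradient W x) (b x) + ℓ * W x = 0)
    (kfp : ∀ x, -k * Laplacian.laplacian m x
      - divergence (fun y => m y • (b y + gradient W y)) x = 0)
    (hφ : ContDiff ℝ 2 φ) (hc : HasCompactSupport φ) :
    ∫ x, φ x * (m x * Real.exp (1 / (2 * k) * W x) * (ℓ / (2 * k)) * (-W x)) =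
      ∫ x, m x * Real.exp (1 / (2 * k) * W x) *
        (k * Laplacian.laplacian φ x - inner ℝ (b x) (gradient φ x)) := by
  have hu2 : ContDiff ℝ 2 (fun y => Real.exp (1 / (2 * k) * W y)) := (contDiff_const.mul hW).exp
  have hgW : ContDiff ℝ 1 (gradient W) := contDiff_gradient (n := 1) hW
  have hsupp : HasCompactSupport (fun y => φ y * Real.exp (1 / (2 * k) * W y)) := hc.mul_right
  have key := integral_mul_generator_eq_zero hm (hb.add hgW) kfp (hφ.mul hu2) hsupp
  have hmu : Continuous fun x => m x * Real.exp (1 / (2 * k) * W x) :=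
    hm.continuous.mul hu2.continuous
  have hc1 : Continuous fun x =>
      φ x * (m x * Real.exp (1 / (2 * k) * W x) * (ℓ / (2 * k)) * (-W x)) :=
    hφ.continuous.mul ((hmu.mul continuous_const).mul hW.continuous.neg)
  have hs1 : HasCompactSupport fun x =>
      φ x * (m x * Real.exp (1 / (2 * k) * W x) * (ℓ / (2 * k)) * (-W x)) := hc.mul_right
  have hlap : HasCompactSupport (Laplacian.laplacian φ : E d → ℝ) := by
    have : (Laplacian.laplacian φ : E d → ℝ) = fun y => divergence (gradient φ) y :=
      funext fun x => laplacian_eq_divergence_gradient hφ x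
    rw [this]
    exact ((hasCompactSupport_gradient hc).fderiv ℝ).comp_left
      (g := fun L : E d →L[ℝ] E d => ∑ i, (L (EuclideanSpace.single i 1)) i) (by simp)
  have hc2 : Continuous fun x => m x * Real.exp (1 / (2 * k) * W x) *
      (k * Laplacian.laplacian φ x - inner ℝ (b x) (gradient φ x)) :=
    hmu.mul ((continuous_const.mul (continuous_laplacian hφ)).sub
      (hb.continuous.inner (contDiff_gradient (n := 1) hφ).continuous))
  have hs2 : HasCompactSupport fun x => m x * Real.exp (1 / (2 * k) * W x) *
      (k * Laplacian.laplacian φ x - inner ℝ (b x) (gradient φ x)) := by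
    have h1 : HasCompactSupport fun y => k * Laplacian.laplacian φ y := hlap.mul_left
    have h2 : HasCompactSupport fun y => inner ℝ (b y) (gradient φ y) := by
      refine (hasCompactSupport_gradient hc).mono fun y hy => ?_
      rw [Function.mem_support] at *
      contrapose! hy
      rw [hy, inner_zero_right]
    exact (HasCompactSupport.sub h1 h2).mul_left
  have hpt : ∀ x, m x * (k * Laplacian.laplacian (fun y => φ y * Real.exp (1 / (2 * k) * W y)) x
      - inner ℝ (b x + gradient W x)
        (gradient (fun y => φ y * Real.exp (1 / (2 * k) * W y)) x)) =
      m x * Real.exp (1 / (2 * k) * W x) *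
        (k * Laplacian.laplacian φ x - inner ℝ (b x) (gradient φ x))
      - φ x * (m x * Real.exp (1 / (2 * k) * W x) * (ℓ / (2 * k)) * (-W x)) := fun x => by
    rw [generator_mul_exp hk hW hφ (h x)]
    ring
  have key2 := (integral_congr_ae (μ := volume) (Eventually.of_forall hpt)).symm.trans key
  rw [integral_sub (hc2.integrable_of_hasCompactSupport hs2)
    (hc1.integrable_of_hasCompactSupport hs1)] at key2
  linarith

/-- The difference `W` of two value functions vanishes as soon as there is a stationary density
for the drift of one of them. -/
lemma eq_zero_of_hjb_of_kfp {k ℓ : ℝ} (hk : 0 < k) (hℓ : 0 < ℓ) {S : Mat d} (hS : S.PosSemidef)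
    {a : E d} {W m : E d → ℝ} (hW : ContDiff ℝ 2 W) (hm : ContDiff ℝ 2 m)
    (h : ∀ x, -k * Laplacian.laplacian W x + 1 / 2 * ‖gradient W x‖ ^ 2
      + inner ℝ (gradient W x) (app S (x - a)) + ℓ * W x = 0)
    (kfp : ∀ x, -k * Laplacian.laplacian m x
      - divergence (fun y => m y • (app S (y - a) + gradient W y)) x = 0)
    (hmi : Integrable m) (hm0 : ∀ x, 0 < m x) (x : E d) : W x = 0 := by
  -- This sign is used twice: it bounds the exponential weight by 1, so that `m` dominates, and it
  -- makes the limiting integrand nonnegative.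
  have hW0 := nonpos_of_hjb hk hℓ hS hW h
  have hbS : ContDiff ℝ 1 (fun y : E d => app S (y - a)) :=
    (contDiff_app S).comp (contDiff_id.sub contDiff_const)
  have huc : Continuous fun y => Real.exp (1 / (2 * k) * W y) :=
    (continuous_const.mul hW.continuous).rexp
  have hu1 : ∀ y, Real.exp (1 / (2 * k) * W y) ≤ 1 := fun y => by
    rw [Real.exp_le_one_iff]
    exact mul_nonpos_of_nonneg_of_nonpos (by positivity) (hW0 y)
  obtain ⟨C, hC0, hC⟩ := exists_bound_cutoff a S k
  have hlim : Tendsto (fun n => ∫ y, cutoff a n y ^ 1 *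
      (m y * Real.exp (1 / (2 * k) * W y) * (ℓ / (2 * k)) * (-W y))) atTop (𝓝 0) := by
    simp only [pow_one]
    have hid := fun n => integral_cutoff_identity hk hbS hW hm h kfp (contDiff_cutoff a n)
      (hasCompactSupport_cutoff a n)
    rw [funext hid, show (0 : ℝ) = ∫ _ : E d, (0 : ℝ) by simp]
    refine tendsto_integral_of_dominated_convergence (fun y => C * m y) (fun n => ?_)
      (hmi.const_mul C) (fun n => Eventually.of_forall fun y => ?_)
      (Eventually.of_forall fun y => ?_)
    · have h1 := continuous_laplacian (contDiff_cutoff a n)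
      have h2 := (contDiff_gradient (n := 1) (contDiff_cutoff a n)).continuous
      exact ((hm.continuous.mul huc).mul
        ((continuous_const.mul h1).sub (hbS.continuous.inner h2))).aestronglyMeasurable
    · rw [Real.norm_eq_abs, abs_mul, abs_mul, abs_of_pos (hm0 y), abs_of_pos (Real.exp_pos _)]
      have h1 := (hC n y).2
      have h2 := mul_le_mul_of_nonneg_left (hu1 y) (hm0 y).le
      refine (mul_le_mul h2 h1 (abs_nonneg _) (by linarith [hm0 y])).trans (le_of_eq ?_)
      ring
    · refine tendsto_const_nhds.congr' ?_
      filter_upwards [gradient_cutoff_eventually_eq_zero a y,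
        laplacian_cutoff_eventually_eq_zero a y] with n h1 h2
      simp only [h1, h2, mul_zero, inner_zero_right, sub_zero]
  have hgc : Continuous fun y => m y * Real.exp (1 / (2 * k) * W y) * (ℓ / (2 * k)) * (-W y) :=
    ((hm.continuous.mul huc).mul continuous_const).mul hW.continuous.neg
  have hg0 := eq_zero_of_tendsto_integral_cutoff hgc
    (fun y => mul_nonneg (mul_nonneg (mul_pos (hm0 y) (Real.exp_pos _)).le (by positivity))
      (neg_nonneg.2 (hW0 y))) one_ne_zero hlim x
  have hne : m x * Real.exp (1 / (2 * k) * W x) * (ℓ / (2 * k)) ≠ 0 := by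
    have := hm0 x
    positivity
  simpa using (mul_eq_zero.1 hg0).resolve_left hne

/-- Positive stationary densities of a stable linear drift are Gaussian, up to a factor. -/
lemma exists_eq_const_mul_exp_of_kfp {k : ℝ} (hk : 0 < k) {S : Mat d} (hS : S.IsSymm) {a : E d}
    {m : E d → ℝ} (hm : ContDiff ℝ 2 m) (hm0 : ∀ x, 0 < m x)
    (kfp : ∀ x, -k * Laplacian.laplacian m x
      - divergence (fun y => m y • app S (y - a)) x = 0)
    (hint : Integrable fun x => Real.exp (-(bil (k⁻¹ • S) (x - a) (x - a) / 2))) :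
    ∃ c : ℝ, ∀ x, m x = c * Real.exp (-(bil (k⁻¹ • S) (x - a) (x - a) / 2)) := by
  have hbS : ContDiff ℝ 1 (fun y : E d => app S (y - a)) :=
    (contDiff_app S).comp (contDiff_id.sub contDiff_const)
  have hkS : (k⁻¹ • S).IsSymm := hS.smul _
  have hm1 : ContDiff ℝ 1 m := hm.of_le (by norm_num)
  have hgm : ContDiff ℝ 1 (gradient m) := contDiff_gradient (n := 1) hm
  set e : E d → ℝ := fun x => Real.exp (-(bil (k⁻¹ • S) (x - a) (x - a) / 2)) with he
  -- `G` is the logarithm of the ratio of `m` to the unnormalised Gaussian `e`; the flux k∇m + m S(x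
  -- - a) equals k m ∇G, and the claim is that `G` is constant.
  set G : E d → ℝ := fun x => Real.log (m x) + 1 / 2 * bil (k⁻¹ • S) (x - a) (x - a) with hG
  have hbil : ContDiff ℝ 2 (fun x : E d => bil (k⁻¹ • S) (x - a) (x - a)) :=
    (contDiff_id.sub contDiff_const).inner ℝ
      ((contDiff_app _).comp (contDiff_id.sub contDiff_const))
  have hG2 : ContDiff ℝ 2 G := (hm.log fun x => (hm0 x).ne').add (contDiff_const.mul hbil)
  have heG : ∀ x, e x = Real.exp (-G x) * m x := fun x => by
    simp only [he, hG]
    rw [neg_add, Real.exp_add, Real.exp_neg (Real.log (m x)), Real.exp_log (hm0 x), mul_assoc,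
      mul_comm _ (m x), ← mul_assoc, inv_mul_cancel₀ (hm0 x).ne', one_mul]
    congr 1
    ring
  have hgG : ∀ x, k • gradient m x + m x • app S (x - a) = (k * m x) • gradient G x := fun x => by
    have h1 := HasGradientAt.add' (HasGradientAt.comp_real (Real.hasDerivAt_log (hm0 x).ne')
      (ContDiff.hasGradientAt' hm (by simp) x))
      (HasGradientAt.const_mul' (1 / 2) (hasGradientAt_bil hkS a x))
    rw [h1.gradient, app_smul_left, smul_add, smul_smul, smul_smul, smul_smul, smul_smul]
    congr 2
    · rw [mul_assoc, mul_inv_cancel₀ (hm0 x).ne', mul_one]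
    · field_simp
  have hgGc : Continuous (gradient G) := (contDiff_gradient (n := 1) hG2).continuous
  have hec : Continuous e := by
    have := hbil.continuous
    exact ((this.div_const 2).neg).rexp
  -- The flux is tested with φ² exp(-G). Since m exp(-G) = `e`, the identity carries the integrable
  -- weight `e`, and `m` disappears from it.
  have hid : ∀ n, ∫ x, k * e x * (2 * cutoff a n x * inner ℝ (gradient (cutoff a n) x) (gradient G x)
      - cutoff a n x ^ 2 * ‖gradient G x‖ ^ 2) = 0 := fun n => by
    have hφ := contDiff_cutoff a n
    have hV : ContDiff ℝ 1 (fun y => k • gradient m y + m y • app S (y - a)) :=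
      (hgm.const_smul k).add (hm1.smul hbS)
    have hψ : ContDiff ℝ 2 (fun y => cutoff a n y * cutoff a n y * Real.exp (-G y)) :=
      (hφ.mul hφ).mul hG2.neg.exp
    have hψ1 : ContDiff ℝ 1 (fun y => cutoff a n y * cutoff a n y * Real.exp (-G y)) :=
      hψ.of_le (by norm_num)
    have hsupp : HasCompactSupport (fun y => (cutoff a n y * cutoff a n y * Real.exp (-G y)) •
        (k • gradient m y + m y • app S (y - a))) := by
      have h1 : HasCompactSupport fun y => cutoff a n y * cutoff a n y :=
        (hasCompactSupport_cutoff a n).mul_right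
      have h2 : HasCompactSupport fun y => cutoff a n y * cutoff a n y * Real.exp (-G y) :=
        h1.mul_right
      exact h2.smul_right
    have key := integral_divergence_eq_zero (hψ1.smul hV) hsupp
    refine Eq.trans (integral_congr_ae (Eventually.of_forall fun x => ?_)) key
    have hφg := ContDiff.hasGradientAt' hφ (by simp) x
    have hGg : HasGradientAt (fun y => Real.exp (-G y)) ((-Real.exp (-G x)) • gradient G x) x := by
      have h1 : HasDerivAt (fun t : ℝ => Real.exp (-t)) (-Real.exp (-G x)) (G x) := by
        simpa using (hasDerivAt_id (G x)).neg.exp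
      exact HasGradientAt.comp_real (φ := fun t => Real.exp (-t)) h1 (ContDiff.hasGradientAt' hG2 (by simp) x)
    refine Eq.trans ?_ (divergence_smul (HasGradientAt.mul' (HasGradientAt.mul' hφg hφg) hGg)
      (hV.differentiable (by simp) x)).symm
    simp only
    rw [divergence_flux_eq_zero hm hbS kfp, hgG, heG]
    simp only [inner_add_left, inner_smul_left, inner_smul_right, conj_trivial,
      real_inner_self_eq_norm_sq]
    ring
  obtain ⟨C, hC0, hC⟩ := exists_bound_cutoff a S k
  have hgcut : ∀ n, Continuous (gradient (cutoff a n)) := fun n =>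
    (contDiff_gradient (n := 1) (contDiff_cutoff a n)).continuous
  -- A Caccioppoli estimate: half of φ²|∇G|² absorbs the cross term by Young's inequality, whence
  -- the factor 4.
  have hle : ∀ n, ∫ x, cutoff a n x ^ 2 * (e x * ‖gradient G x‖ ^ 2) ≤
      4 * ∫ x, e x * ‖gradient (cutoff a n) x‖ ^ 2 := fun n => by
    have hφ := (contDiff_cutoff a n).continuous
    have hc1 : Continuous fun x => cutoff a n x ^ 2 * (e x * ‖gradient G x‖ ^ 2) := by fun_prop
    have hs1 : HasCompactSupport fun x => cutoff a n x ^ 2 * (e x * ‖gradient G x‖ ^ 2) := by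
      have h1 : HasCompactSupport fun x => cutoff a n x ^ 2 :=
        (hasCompactSupport_cutoff a n).comp_left (g := fun t : ℝ => t ^ 2) (by simp)
      exact h1.mul_right
    have hc2 : Continuous fun x => k * e x * (2 * cutoff a n x *
        inner ℝ (gradient (cutoff a n) x) (gradient G x)
        - cutoff a n x ^ 2 * ‖gradient G x‖ ^ 2) := by
      have := (hgcut n).inner (𝕜 := ℝ) hgGc
      fun_prop
    have hs2 : HasCompactSupport fun x => k * e x * (2 * cutoff a n x *
        inner ℝ (gradient (cutoff a n) x) (gradient G x)
        - cutoff a n x ^ 2 * ‖gradient G x‖ ^ 2) := by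
      refine (hasCompactSupport_cutoff a n).mono fun x hx => ?_
      rw [Function.mem_support] at *
      contrapose! hx
      rw [hx]
      ring
    have hc3 : Continuous fun x => e x * ‖gradient (cutoff a n) x‖ ^ 2 := by
      have := hgcut n
      fun_prop
    have hs3 : HasCompactSupport fun x => e x * ‖gradient (cutoff a n) x‖ ^ 2 := by
      refine (hasCompactSupport_gradient (hasCompactSupport_cutoff a n)).mono fun x hx => ?_
      rw [Function.mem_support] at *
      contrapose! hx
      rw [hx]
      simp
    have hi2 := hc2.integrable_of_hasCompactSupport hs2 (μ := volume)
    have hi3 := hc3.integrable_of_hasCompactSupport hs3 (μ := volume)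
    have h1 : ∫ x, cutoff a n x ^ 2 * (e x * ‖gradient G x‖ ^ 2) ≤
        ∫ x, (4 * (e x * ‖gradient (cutoff a n) x‖ ^ 2) - 2 / k * (k * e x * (2 * cutoff a n x *
        inner ℝ (gradient (cutoff a n) x) (gradient G x)
        - cutoff a n x ^ 2 * ‖gradient G x‖ ^ 2))) := by
      refine integral_mono (hc1.integrable_of_hasCompactSupport hs1)
        ((hi3.const_mul 4).sub (hi2.const_mul (2 / k))) fun x => ?_
      have he0 : 0 < e x := Real.exp_pos _
      have h2 : 2 / k * (k * e x * (2 * cutoff a n x *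
        inner ℝ (gradient (cutoff a n) x) (gradient G x)
        - cutoff a n x ^ 2 * ‖gradient G x‖ ^ 2)) = e x * (2 * (2 * cutoff a n x *
        inner ℝ (gradient (cutoff a n) x) (gradient G x)
        - cutoff a n x ^ 2 * ‖gradient G x‖ ^ 2)) := by
        field_simp
      simp only
      rw [h2]
      have h3 : inner ℝ (gradient (cutoff a n) x) (gradient G x) ≤
          ‖gradient (cutoff a n) x‖ * ‖gradient G x‖ := real_inner_le_norm _ _
      have h4 := mul_le_mul_of_nonneg_left h3 (cutoff_nonneg a n x)
      have h5 : cutoff a n x ^ 2 * ‖gradient G x‖ ^ 2 ≤ 4 * ‖gradient (cutoff a n) x‖ ^ 2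
          - 2 * (2 * cutoff a n x * inner ℝ (gradient (cutoff a n) x) (gradient G x)
          - cutoff a n x ^ 2 * ‖gradient G x‖ ^ 2) := by
        nlinarith [sq_nonneg (cutoff a n x * ‖gradient G x‖ - 2 * ‖gradient (cutoff a n) x‖)]
      have h6 := mul_le_mul_of_nonneg_left h5 he0.le
      linarith
    rw [integral_sub (hi3.const_mul 4) (hi2.const_mul (2 / k)), integral_const_mul,
      integral_const_mul, hid n, mul_zero, sub_zero] at h1
    exact h1
  have hlim0 : Tendsto (fun n => 4 * ∫ x, e x * ‖gradient (cutoff a n) x‖ ^ 2) atTop (𝓝 0) := by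
    have h0 : (0 : ℝ) = 4 * ∫ _ : E d, (0 : ℝ) := by simp
    rw [h0]
    refine Tendsto.const_mul 4 (tendsto_integral_of_dominated_convergence (fun y => C ^ 2 * e y)
      (fun n => ?_) (hint.const_mul _) (fun n => Eventually.of_forall fun y => ?_)
      (Eventually.of_forall fun y => ?_))
    · have := hgcut n
      exact (hec.mul (this.norm.pow 2)).aestronglyMeasurable
    · have he0 : 0 < e y := Real.exp_pos _
      rw [Real.norm_eq_abs, abs_of_nonneg (by positivity), mul_comm]
      gcongr
      exact (hC n y).1
    · refine tendsto_const_nhds.congr' ?_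
      filter_upwards [gradient_cutoff_eventually_eq_zero a y] with n h1
      simp [h1]
  have hlim : Tendsto (fun n => ∫ x, cutoff a n x ^ 2 * (e x * ‖gradient G x‖ ^ 2)) atTop
      (𝓝 0) :=
    squeeze_zero (fun n => integral_nonneg fun x => mul_nonneg (sq_nonneg _)
      (mul_nonneg (Real.exp_pos _).le (sq_nonneg _))) hle hlim0
  have hG0 : ∀ x, gradient G x = 0 := fun x => by
    have h1 := eq_zero_of_tendsto_integral_cutoff (hec.mul (hgGc.norm.pow 2))
      (fun y => mul_nonneg (Real.exp_pos _).le (sq_nonneg _)) two_ne_zero hlim x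
    have h2 := (mul_eq_zero.1 h1).resolve_left (Real.exp_ne_zero _)
    simpa using h2
  have hGconst : ∀ x, G x = G a := fun x =>
    is_const_of_fderiv_eq_zero (hG2.differentiable (by simp)) (fun y => by
      rw [← toDual_gradient, hG0 y, map_zero]) x a
  refine ⟨Real.exp (G a), fun x => ?_⟩
  have h1 := heG x
  rw [hGconst x] at h1
  change m x = Real.exp (G a) * e x
  rw [h1, ← mul_assoc, ← Real.exp_add]
  simp

end Rigidity

/-! ### A quadratic matrix equation -/

section MatrixEquation

variable {d : ℕ}

/-- The equation `S² + ℓ S = P` has a positive definite solution if `P` is positive definite. -/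
lemma exists_posDef_solution {P : Mat d} (hP : P.PosDef) (ℓ : ℝ) :
    ∃ S : Mat d, S.PosDef ∧ S * S + ℓ • S = P := by
  have hH := hP.isHermitian
  set U : Mat d := hH.eigenvectorUnitary.1 with hU
  have hUU : star U * U = 1 := by
    rw [hU]; exact Unitary.coe_star_mul_self hH.eigenvectorUnitary
  -- The positive root of t² + ℓt = λᵢ; in an eigenbasis of `P` the matrix equation splits into
  -- these scalar ones.
  set s : Fin d → ℝ := fun i => (-ℓ + Real.sqrt (ℓ ^ 2 + 4 * hH.eigenvalues i)) / 2 with hs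
  have hpos : ∀ i, 0 < s i := fun i => by
    have h1 := hP.eigenvalues_pos i
    have h2 : ℓ < Real.sqrt (ℓ ^ 2 + 4 * hH.eigenvalues i) := Real.lt_sqrt_of_sq_lt (by linarith)
    simp only [hs]
    linarith
  have hsq : ∀ i, s i * s i + ℓ * s i = hH.eigenvalues i := fun i => by
    have h1 := hP.eigenvalues_pos i
    have h2 := Real.sq_sqrt (show 0 ≤ ℓ ^ 2 + 4 * hH.eigenvalues i by positivity)
    simp only [hs]
    linear_combination (1 / 4 : ℝ) * h2
  refine ⟨U * diagonal s * star U, ?_, ?_⟩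
  · have hd : (diagonal s).PosDef := Matrix.PosDef.diagonal hpos
    have hu : IsUnit U := by
      rw [hU]
      exact Unitary.isUnit_coe
    exact (hu.posDef_star_right_conjugate_iff).2 hd
  · have h1 : U * diagonal s * star U * (U * diagonal s * star U) =
        U * (diagonal s * diagonal s) * star U := by
      calc _ = U * diagonal s * (star U * U) * diagonal s * star U := by noncomm_ring
        _ = _ := by rw [hUU]; noncomm_ring
    have h2 : ℓ • (U * diagonal s * star U) = U * (ℓ • diagonal s) * star U := by
      rw [Matrix.mul_smul, Matrix.smul_mul]
    have h3 : diagonal s * diagonal s + ℓ • diagonal s = diagonal hH.eigenvalues := by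
      rw [diagonal_mul_diagonal, ← diagonal_smul, diagonal_add]
      congr 1
      funext i
      exact hsq i
    rw [h1, h2, ← Matrix.add_mul, ← Matrix.mul_add, h3]
    conv_rhs => rw [hH.spectral_theorem]
    rfl

lemma trace_mul_self_nonneg {Z : Mat d} (hZ : Z.IsSymm) {S : Mat d} (hS : S.PosSemidef) :
    0 ≤ (Z * S * Z).trace := by
  have h := (hS.mul_mul_conjTranspose_same Z).trace_nonneg
  rwa [conjTranspose_eq_transpose_of_trivial, hZ.eq] at h

lemma sum_sq_eq_trace {Z : Mat d} (hZ : Z.IsSymm) : ∑ i, ∑ j, Z i j ^ 2 = (Z * Z).trace := by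
  simp only [Matrix.trace, Matrix.diag, Matrix.mul_apply, sq]
  refine Finset.sum_congr rfl fun i _ => Finset.sum_congr rfl fun j _ => ?_
  rw [hZ.apply i j]

/-- Lipschitz dependence of the solution of `S² + ℓ S = P` on `P`, in the Frobenius norm. -/
lemma sum_sq_sub_le {S S' P P' : Mat d} {ℓ : ℝ} (hℓ : 0 < ℓ) (hS : S.PosDef) (hS' : S'.PosDef)
    (h : S * S + ℓ • S = P) (h' : S' * S' + ℓ • S' = P') :
    ∑ i, ∑ j, (S' i j - S i j) ^ 2 ≤ (∑ i, ∑ j, (P' i j - P i j) ^ 2) / ℓ ^ 2 := by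
  set Z : Mat d := S' - S with hZ
  have hZs : Z.IsSymm := (isSymm_of_posDef hS').sub (isSymm_of_posDef hS)
  -- Paired with `Z` under the trace, the first two terms become tr(ZS'Z) and tr(ZSZ), both
  -- nonnegative. Hence ℓ|Z|² ≤ ⟨Z, P' - P⟩ in the Frobenius product, and Young's inequality
  -- concludes.
  have hM : P' - P = S' * Z + Z * S + ℓ • Z := by
    rw [← h, ← h', hZ]
    simp only [smul_sub]
    noncomm_ring
  have h1 : (Z * (P' - P)).trace = (Z * S' * Z).trace + (Z * S * Z).trace + ℓ * (Z * Z).trace := by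
    rw [hM, Matrix.mul_add, Matrix.mul_add, Matrix.trace_add, Matrix.trace_add, Matrix.mul_smul,
      Matrix.trace_smul, ← Matrix.mul_assoc, ← Matrix.mul_assoc, Matrix.mul_assoc Z S Z,
      Matrix.trace_mul_comm Z (S * Z), Matrix.mul_assoc S Z Z, Matrix.trace_mul_comm S (Z * Z),
      smul_eq_mul]
  have h2 := trace_mul_self_nonneg hZs hS'.posSemidef
  have h3 := trace_mul_self_nonneg hZs hS.posSemidef
  have h4 : (Z * (P' - P)).trace = ∑ i, ∑ j, Z i j * (P' i j - P i j) := by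
    simp only [Matrix.trace, Matrix.diag, Matrix.mul_apply, Matrix.sub_apply]
    rw [Finset.sum_comm]
    refine Finset.sum_congr rfl fun i _ => Finset.sum_congr rfl fun j _ => ?_
    rw [hZs.apply i j]
  have h5 : ∑ i, ∑ j, Z i j * (P' i j - P i j) ≤
      ℓ / 2 * ∑ i, ∑ j, Z i j ^ 2 + 1 / (2 * ℓ) * ∑ i, ∑ j, (P' i j - P i j) ^ 2 := by
    simp only [Finset.mul_sum, ← Finset.sum_add_distrib]
    refine Finset.sum_le_sum fun i _ => Finset.sum_le_sum fun j _ => ?_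
    have h6 : ℓ / 2 * Z i j ^ 2 + 1 / (2 * ℓ) * (P' i j - P i j) ^ 2 - Z i j * (P' i j - P i j) =
        1 / (2 * ℓ) * (ℓ * Z i j - (P' i j - P i j)) ^ 2 := by
      field_simp
      ring
    have h7 : 0 ≤ 1 / (2 * ℓ) * (ℓ * Z i j - (P' i j - P i j)) ^ 2 := by positivity
    linarith
  have h8 : ∑ i, ∑ j, (S' i j - S i j) ^ 2 = (Z * Z).trace := sum_sq_eq_trace hZs
  rw [sum_sq_eq_trace hZs] at h5
  rw [h8, le_div_iff₀ (by positivity)]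
  have h9 : ℓ / 2 * (Z * Z).trace ≤ 1 / (2 * ℓ) * ∑ i, ∑ j, (P' i j - P i j) ^ 2 := by
    linarith
  have h10 := mul_le_mul_of_nonneg_left h9 (show 0 ≤ 2 * ℓ by positivity)
  have h11 : 2 * ℓ * (1 / (2 * ℓ) * ∑ i, ∑ j, (P' i j - P i j) ^ 2) =
      ∑ i, ∑ j, (P' i j - P i j) ^ 2 := by field_simp
  rw [h11] at h10
  linarith

lemma exists_coercive {S : Mat d} (hS : S.PosDef) :
    ∃ ε : ℝ, 0 < ε ∧ ∀ x : E d, ε * ‖x‖ ^ 2 ≤ bil S x x := by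
  have hcont : Continuous fun x : E d => bil S x x := continuous_id.inner (continuous_app S)
  -- The unit sphere is empty when `d = 0`; any positive constant serves there. Otherwise the
  -- constant is the minimum over the sphere.
  rcases (Metric.sphere (0 : E d) 1).eq_empty_or_nonempty with hemp | hne
  · refine ⟨1, one_pos, fun x => ?_⟩
    have hx : x = 0 := by
      by_contra hx
      have : ‖x‖⁻¹ • x ∈ Metric.sphere (0 : E d) 1 := by
        simp [norm_smul, norm_ne_zero_iff.2 hx]
      rw [hemp] at this
      exact this
    simp [hx, bil]
  · obtain ⟨z, hz, hmin⟩ := (isCompact_sphere (0 : E d) 1).exists_isMinOn hne hcont.continuousOn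
    have hz1 : ‖z‖ = 1 := by simpa using hz
    refine ⟨bil S z z, bil_pos hS (by rw [← norm_ne_zero_iff, hz1]; norm_num), fun x => ?_⟩
    rcases eq_or_ne x 0 with rfl | hx
    · simp [bil]
    have hxn : ‖x‖ ≠ 0 := norm_ne_zero_iff.2 hx
    have h1 : bil S z z ≤ bil S (‖x‖⁻¹ • x) (‖x‖⁻¹ • x) :=
      hmin (by simp [norm_smul, hxn] : ‖x‖⁻¹ • x ∈ Metric.sphere (0 : E d) 1)
    have h2 : bil S (‖x‖⁻¹ • x) (‖x‖⁻¹ • x) = (‖x‖ ^ 2)⁻¹ * bil S x x := by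
      simp only [bil, app_smul_right, inner_smul_left, inner_smul_right, conj_trivial]
      ring
    rw [h2, inv_mul_eq_div, le_div_iff₀ (by positivity)] at h1
    exact h1

end MatrixEquation

/-! ### Gaussian densities -/

section Gaussian

variable {d : ℕ}

lemma contDiff_bil_sub (S : Mat d) (μ : E d) {n : WithTop ℕ∞} :
    ContDiff ℝ n fun x : E d => bil S (x - μ) (x - μ) :=
  (contDiff_id.sub contDiff_const).inner ℝ
    ((contDiff_app _).comp (contDiff_id.sub contDiff_const))

lemma contDiff_gaussianDensity (μ : E d) (S : Mat d) {n : WithTop ℕ∞} :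
    ContDiff ℝ n (gaussianDensity μ S) :=
  contDiff_const.mul (((contDiff_bil_sub S μ).div_const 2).neg.exp)

lemma continuous_gaussianDensity (μ : E d) (S : Mat d) : Continuous (gaussianDensity μ S) :=
  (contDiff_gaussianDensity μ S (n := 0)).continuous

lemma gaussianDensity_pos (μ : E d) {S : Mat d} (hS : S.PosDef) (x : E d) :
    0 < gaussianDensity μ S x := by
  have := hS.det_pos
  unfold gaussianDensity
  positivity

lemma integrable_exp_neg_mul_norm_sq {b : ℝ} (hb : 0 < b) :
    Integrable fun x : E d => Real.exp (-b * ‖x‖ ^ 2) := by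
  refine Integrable.of_integral_ne_zero ?_
  rw [GaussianFourier.integral_rexp_neg_mul_sq_norm hb]
  positivity

lemma integrable_norm_sq_mul_exp {b : ℝ} (hb : 0 < b) :
    Integrable fun x : E d => ‖x‖ ^ 2 * Real.exp (-b * ‖x‖ ^ 2) := by
  refine ((integrable_exp_neg_mul_norm_sq (d := d) (half_pos hb)).const_mul (2 / b)).mono'
    (by fun_prop) (Eventually.of_forall fun x => ?_)
  rw [Real.norm_eq_abs, abs_of_nonneg (by positivity)]
  have h1 : b / 2 * ‖x‖ ^ 2 ≤ Real.exp (b / 2 * ‖x‖ ^ 2) := by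
    linarith [Real.add_one_le_exp (b / 2 * ‖x‖ ^ 2)]
  have h2 : Real.exp (-b * ‖x‖ ^ 2) =
      Real.exp (-(b / 2) * ‖x‖ ^ 2) * Real.exp (-(b / 2 * ‖x‖ ^ 2)) := by
    rw [← Real.exp_add]; congr 1; ring
  have h3 : Real.exp (b / 2 * ‖x‖ ^ 2) * Real.exp (-(b / 2 * ‖x‖ ^ 2)) = 1 := by
    rw [← Real.exp_add]; simp
  have h4 := mul_le_mul_of_nonneg_right h1 (Real.exp_pos (-(b / 2 * ‖x‖ ^ 2))).le
  rw [h3] at h4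
  have h5 : ‖x‖ ^ 2 * Real.exp (-(b / 2 * ‖x‖ ^ 2)) ≤ 2 / b := by
    rw [le_div_iff₀ hb]
    linarith
  rw [h2]
  calc ‖x‖ ^ 2 * (Real.exp (-(b / 2) * ‖x‖ ^ 2) * Real.exp (-(b / 2 * ‖x‖ ^ 2)))
      = (‖x‖ ^ 2 * Real.exp (-(b / 2 * ‖x‖ ^ 2))) * Real.exp (-(b / 2) * ‖x‖ ^ 2) := by ring
    _ ≤ _ := by gcongr

/-- The substitution y = Tx, with T the positive definite square root of `S`, reduces this to the
standard Gaussian integral. -/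
lemma integral_exp_neg_bil {S : Mat d} (hS : S.PosDef) (μ : E d) :
    ∫ x : E d, Real.exp (-(bil S (x - μ) (x - μ) / 2)) =
      Real.sqrt ((2 * Real.pi) ^ d / S.det) := by
  -- At ℓ = 0 the quadratic matrix equation is that of the square root.
  obtain ⟨T, hT, hTS⟩ := exists_posDef_solution hS 0
  rw [zero_smul, add_zero] at hTS
  have hdet := hT.det_pos
  rw [integral_sub_right_eq_self (fun x : E d => Real.exp (-(bil S x x / 2))) μ]
  have h1 : ∀ x : E d, Real.exp (-(bil S x x / 2)) =
      (fun y : E d => Real.exp (-(1 / 2) * ‖y‖ ^ 2)) (Matrix.toEuclideanLin T x) := fun x => by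
    have h2 : bil S x x = ‖app T x‖ ^ 2 := by
      rw [← hTS, bil, app_mul, ← inner_app_of_isSymm (isSymm_of_posDef hT),
        real_inner_self_eq_norm_sq]
    have h3 : Matrix.toEuclideanLin T x = app T x := rfl
    simp only [h2, h3]
    congr 1
    ring
  have hLdet : LinearMap.det (Matrix.toEuclideanLin T) = T.det := by
    rw [Matrix.toEuclideanLin_eq_toLin_orthonormal, LinearMap.det_toLin]
  have hmap := Measure.map_linearMap_addHaar_eq_smul_addHaar (μ := (volume : Measure (E d)))
    (f := Matrix.toEuclideanLin T) (by rw [hLdet]; exact hdet.ne')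
  simp only [h1]
  have hcm : AEMeasurable (Matrix.toEuclideanLin T : E d → E d) volume :=
    (LinearMap.continuous_of_finiteDimensional _).aemeasurable
  refine (integral_map (f := fun y : E d => Real.exp (-(1 / 2) * ‖y‖ ^ 2)) hcm
    (by fun_prop)).symm.trans ?_
  rw [hmap, integral_smul_measure,
    GaussianFourier.integral_rexp_neg_mul_sq_norm (by norm_num), hLdet, ← hTS, Matrix.det_mul,
    ENNReal.toReal_ofReal (by positivity), abs_of_pos (inv_pos.2 hdet), smul_eq_mul,
    finrank_euclideanSpace, Fintype.card_fin, Real.sqrt_div (by positivity),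
    Real.sqrt_mul_self hdet.le, div_div_eq_mul_div, mul_comm Real.pi 2, div_one,
    Real.sqrt_eq_rpow, ← Real.rpow_natCast, ← Real.rpow_mul (by positivity)]
  rw [div_eq_mul_inv _ T.det, mul_comm]
  congr 2
  ring

lemma integrable_exp_neg_bil {S : Mat d} (hS : S.PosDef) (μ : E d) :
    Integrable fun x : E d => Real.exp (-(bil S (x - μ) (x - μ) / 2)) := by
  refine Integrable.of_integral_ne_zero ?_
  rw [integral_exp_neg_bil hS]
  have := hS.det_pos
  positivity

lemma integral_gaussianDensity {S : Mat d} (hS : S.PosDef) (μ : E d) :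
    ∫ x, gaussianDensity μ S x = 1 := by
  have := hS.det_pos
  unfold gaussianDensity
  rw [integral_const_mul, integral_exp_neg_bil hS, ← Real.sqrt_mul (by positivity)]
  rw [Real.sqrt_eq_one]
  field_simp

lemma integrable_gaussianDensity {S : Mat d} (hS : S.PosDef) (μ : E d) :
    Integrable (gaussianDensity μ S) :=
  (integrable_exp_neg_bil hS μ).const_mul _

/-- Gaussian densities with coercive precision matrix decay uniformly. -/
lemma exp_neg_bil_le {S : Mat d} {ε : ℝ} (hε : 0 < ε) (hS : ∀ x : E d, ε * ‖x‖ ^ 2 ≤ bil S x x)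
    {μ : E d} {K : ℝ} (hμ : ‖μ‖ ≤ K) (x : E d) :
    Real.exp (-(bil S (x - μ) (x - μ) / 2)) ≤
      Real.exp (ε / 2 * K ^ 2) * Real.exp (-(ε / 4) * ‖x‖ ^ 2) := by
  rw [← Real.exp_add, Real.exp_le_exp]
  have h1 := hS (x - μ)
  have h2 : ‖x‖ ≤ ‖x - μ‖ + ‖μ‖ := by
    have := norm_add_le (x - μ) μ
    simpa using this
  have h3 : ‖x‖ ^ 2 ≤ 2 * ‖x - μ‖ ^ 2 + 2 * K ^ 2 := by
    have h4 : ‖x‖ ≤ ‖x - μ‖ + K := h2.trans (by linarith)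
    have h5 : ‖x‖ ^ 2 ≤ (‖x - μ‖ + K) ^ 2 := by gcongr
    nlinarith [sq_nonneg (‖x - μ‖ - K)]
  nlinarith

lemma integrable_norm_sq_mul_gaussianDensity {S : Mat d} (hS : S.PosDef) (μ : E d) :
    Integrable fun x => ‖x‖ ^ 2 * gaussianDensity μ S x := by
  obtain ⟨ε, hε, hc⟩ := exists_coercive hS
  refine ((integrable_norm_sq_mul_exp (d := d) (b := ε / 4) (by positivity)).const_mul
    (Real.sqrt (S.det / (2 * Real.pi) ^ d) * Real.exp (ε / 2 * ‖μ‖ ^ 2))).mono' ?_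
    (Eventually.of_forall fun x => ?_)
  · exact ((continuous_norm.pow 2).mul (continuous_gaussianDensity μ S)).aestronglyMeasurable
  · have h1 := (gaussianDensity_pos μ hS x).le
    rw [Real.norm_eq_abs, abs_of_nonneg (by positivity)]
    have h2 := exp_neg_bil_le hε hc (le_refl ‖μ‖) x
    unfold gaussianDensity
    calc ‖x‖ ^ 2 * (Real.sqrt (S.det / (2 * Real.pi) ^ d) *
          Real.exp (-(bil S (x - μ) (x - μ) / 2)))
        ≤ ‖x‖ ^ 2 * (Real.sqrt (S.det / (2 * Real.pi) ^ d) *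
          (Real.exp (ε / 2 * ‖μ‖ ^ 2) * Real.exp (-(ε / 4) * ‖x‖ ^ 2))) := by gcongr
      _ = _ := by ring

/-! ### Moments of densities -/

lemma integrable_norm_mul {m : E d → ℝ} (hm : Integrable m) (h0 : ∀ x, 0 < m x)
    (h2 : Integrable fun x => ‖x‖ ^ 2 * m x) : Integrable fun x => ‖x‖ * m x := by
  refine (hm.add h2).mono' (continuous_norm.aestronglyMeasurable.mul hm.aestronglyMeasurable)
    (Eventually.of_forall fun x => ?_)
  have h := (h0 x).le
  rw [Real.norm_eq_abs, abs_of_nonneg (by positivity), Pi.add_apply]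
  have h3 : ‖x‖ ≤ 1 + ‖x‖ ^ 2 := by nlinarith [sq_nonneg (‖x‖ - 1)]
  nlinarith

lemma integrable_smul_id {m : E d → ℝ} (hm : Integrable m) (h0 : ∀ x, 0 < m x)
    (h2 : Integrable fun x => ‖x‖ ^ 2 * m x) : Integrable fun x => m x • x := by
  refine (integrable_norm_mul hm h0 h2).mono'
    (hm.aestronglyMeasurable.smul continuous_id.aestronglyMeasurable)
    (Eventually.of_forall fun x => ?_)
  rw [norm_smul, Real.norm_eq_abs, abs_of_pos (h0 x), mul_comm]

lemma integrable_smul_sub {m : E d → ℝ} (hm : Integrable m) (h0 : ∀ x, 0 < m x)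
    (h2 : Integrable fun x => ‖x‖ ^ 2 * m x) (z : E d) : Integrable fun x => m x • (x - z) := by
  have h := (integrable_smul_id hm h0 h2).sub (hm.smul_const z)
  refine h.congr (Eventually.of_forall fun x => ?_)
  simp [smul_sub]

lemma integral_smul_sub {m : E d → ℝ} (hm : Integrable m) (h1 : ∫ x, m x = 1)
    (h0 : ∀ x, 0 < m x) (h2 : Integrable fun x => ‖x‖ ^ 2 * m x) (z : E d) :
    ∫ x, m x • (x - z) = (∫ x, m x • x) - z := by
  simp only [smul_sub]
  rw [integral_sub (integrable_smul_id hm h0 h2) (hm.smul_const z), integral_smul_const, h1,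
    one_smul]

lemma integral_inner_mul {m : E d → ℝ} (hm : Integrable m) (h1 : ∫ x, m x = 1)
    (h0 : ∀ x, 0 < m x) (h2 : Integrable fun x => ‖x‖ ^ 2 * m x) (w z : E d) :
    ∫ x, inner ℝ w (x - z) * m x = inner ℝ w ((∫ x, m x • x) - z) := by
  rw [← integral_smul_sub hm h1 h0 h2, ← integral_inner (integrable_smul_sub hm h0 h2 z)]
  refine integral_congr_ae (Eventually.of_forall fun x => ?_)
  simp only [inner_smul_right]
  ring

/-- After translation by the mean the integrand is odd. -/
lemma integral_smul_gaussianDensity {S : Mat d} (hS : S.PosDef) (μ : E d) :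
    ∫ x, gaussianDensity μ S x • x = μ := by
  have hm := integrable_gaussianDensity hS μ
  have h := integral_smul_sub hm (integral_gaussianDensity hS μ) (gaussianDensity_pos μ hS)
    (integrable_norm_sq_mul_gaussianDensity hS μ) μ
  rw [← sub_eq_zero, ← h]
  have h1 : ∀ x : E d, gaussianDensity μ S x • (x - μ) =
      (fun y : E d => gaussianDensity 0 S y • y) (x - μ) := fun x => by
    simp [gaussianDensity]
  simp only [h1]
  rw [integral_sub_right_eq_self (fun y : E d => gaussianDensity 0 S y • y) μ]
  have h2 : ∫ y : E d, gaussianDensity 0 S y • y = -∫ y : E d, gaussianDensity 0 S y • y := by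
    rw [← integral_neg, ← integral_neg_eq_self (fun y : E d => gaussianDensity 0 S y • y)]
    refine integral_congr_ae (Eventually.of_forall fun y => ?_)
    simp [gaussianDensity, bil, app_neg_right]
  have h3 := add_eq_zero_iff_eq_neg.2 h2
  rw [← two_smul ℝ] at h3
  simpa using h3

lemma gaussianDensity_injective_mean {S S' : Mat d} (hS : S.PosDef) (hS' : S'.PosDef)
    {μ μ' : E d} (h : gaussianDensity μ S = gaussianDensity μ' S') : μ = μ' := by
  rw [← integral_smul_gaussianDensity hS μ, h, integral_smul_gaussianDensity hS']

lemma integrable_coord_mul {m : E d → ℝ} (hm : Integrable m) (h0 : ∀ x, 0 < m x)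
    (h2 : Integrable fun x => ‖x‖ ^ 2 * m x) (z : E d) (i : Fin d) :
    Integrable fun x => (x - z) i * m x := by
  have h := (EuclideanSpace.proj (𝕜 := ℝ) i).integrable_comp (integrable_smul_sub hm h0 h2 z)
  refine h.congr (Eventually.of_forall fun x => ?_)
  simp [mul_comm]

lemma integrable_coord_mul_coord_mul {m : E d → ℝ} (hm : Integrable m) (h0 : ∀ x, 0 < m x)
    (h2 : Integrable fun x => ‖x‖ ^ 2 * m x) (z : E d) (i j : Fin d) :
    Integrable fun x => (x - z) i * (x - z) j * m x := by
  refine ((h2.const_mul 2).add (hm.const_mul (2 * ‖z‖ ^ 2))).mono'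
    ((Continuous.aestronglyMeasurable (by fun_prop)).mul hm.aestronglyMeasurable)
    (Eventually.of_forall fun x => ?_)
  have hi := PiLp.norm_apply_le (x - z) i
  have hj := PiLp.norm_apply_le (x - z) j
  have h3 : ‖x - z‖ ^ 2 ≤ 2 * ‖x‖ ^ 2 + 2 * ‖z‖ ^ 2 := by
    have h4 : ‖x - z‖ ^ 2 ≤ (‖x‖ + ‖z‖) ^ 2 := by gcongr; exact norm_sub_le x z
    nlinarith [sq_nonneg (‖x‖ - ‖z‖)]
  have h5 : ‖(x - z) i‖ * ‖(x - z) j‖ ≤ 2 * ‖x‖ ^ 2 + 2 * ‖z‖ ^ 2 :=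
    (mul_le_mul hi hj (norm_nonneg _) (norm_nonneg _)).trans (by rw [← sq]; exact h3)
  rw [norm_mul, norm_mul, Real.norm_eq_abs (m x), abs_of_pos (h0 x), Pi.add_apply]
  have h6 := mul_le_mul_of_nonneg_right h5 (h0 x).le
  linarith

/-- The matrix of second moments, centred at `z`, of a density. -/
def secondMoment (m : E d → ℝ) (z : E d) (i j : Fin d) : ℝ := ∫ x, (x - z) i * (x - z) j * m x

lemma integral_bil_mul {m : E d → ℝ} (hm : Integrable m) (h0 : ∀ x, 0 < m x)
    (h2 : Integrable fun x => ‖x‖ ^ 2 * m x) (C : Mat d) (z : E d) :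
    ∫ x, bil C (x - z) (x - z) * m x = ∑ i, ∑ j, C i j * secondMoment m z i j := by
  have hint := integrable_coord_mul_coord_mul hm h0 h2 z
  have h : ∀ x, bil C (x - z) (x - z) * m x =
      ∑ i, ∑ j, C i j * ((x - z) i * (x - z) j * m x) := fun x => by
    rw [bil_eq_sum]
    simp only [Finset.sum_mul]
    exact Finset.sum_congr rfl fun i _ => Finset.sum_congr rfl fun j _ => by ring
  simp only [h]
  refine (integral_finsetSum (f := fun i x => ∑ j, C i j * ((x - z) i * (x - z) j * m x)) _
    fun i _ => integrable_finsetSum _ fun j _ => (hint i j).const_mul _).trans ?_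
  refine Finset.sum_congr rfl fun i _ => ?_
  refine (integral_finsetSum (f := fun j x => C i j * ((x - z) i * (x - z) j * m x)) _
    fun j _ => (hint i j).const_mul _).trans ?_
  exact Finset.sum_congr rfl fun j _ => integral_const_mul _ _

/-- The mean field cost is a quadratic function, whose linear part depends on the mean only. -/
lemma meanFieldCost_eq {Q B C D : Mat d} (hB : B.IsSymm) {H Δ₀ : E d} {m : E d → ℝ}
    (hm : Integrable m) (h1 : ∫ x, m x = 1) (h0 : ∀ x, 0 < m x)
    (h2 : Integrable fun x => ‖x‖ ^ 2 * m x) :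
    meanFieldCost Q B C D H Δ₀ m = fun x => bil Q (x - H) (x - H)
      + inner ℝ (app B ((∫ ξ, m ξ • ξ) - Δ₀)) (x - H)
      + (∑ i, ∑ j, C i j * secondMoment m Δ₀ i j
        + bil D ((∫ ξ, m ξ • ξ) - Δ₀) ((∫ ξ, m ξ • ξ) - Δ₀)) := by
  funext x
  unfold meanFieldCost
  rw [integral_smul_sub hm h1 h0 h2, integral_bil_mul hm h0 h2]
  have h : ∀ ξ, (bil ((1 / 2 : ℝ) • B) (x - H) (ξ - Δ₀) + bil ((1 / 2 : ℝ) • B) (ξ - Δ₀) (x - H))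
      * m ξ = inner ℝ (app B (x - H)) (ξ - Δ₀) * m ξ := fun ξ => by
    simp only [bil, app_smul_left, inner_smul_right]
    rw [← inner_app_of_isSymm hB (x - H) (ξ - Δ₀),
      real_inner_comm (app B (x - H)) (ξ - Δ₀)]
    ring
  simp only [h]
  rw [integral_inner_mul hm h1 h0 h2, inner_app_of_isSymm hB, real_inner_comm (x - H)]
  ring

end Gaussian

/-! ### The equations with a quadratic cost -/

section QuadraticCost

variable {d : ℕ}

/-- The quadratic cost `(x - H)ᵀ Q (x - H) + w (x - H) + κ`. -/
def quadCost (Q : Mat d) (w H : E d) (κ : ℝ) (x : E d) : ℝ :=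
  bil Q (x - H) (x - H) + inner ℝ w (x - H) + κ

/-- The matrix `A² - ℓ A + (2 / r) Q`. -/
def riccatiMatrix (A : Mat d) (r ℓ : ℝ) (Q : Mat d) : Mat d :=
  A * A - ℓ • A + (2 / r) • Q

/-- The additive constant of the quadratic value function. -/
def valueConst (A : Mat d) (r k ℓ : ℝ) (Q S : Mat d) (a w H : E d) (κ : ℝ) : ℝ :=
  (κ + bil Q H H - inner ℝ w H + k * r * (S + A).trace - r / 2 * ‖app S a‖ ^ 2) / ℓ

lemma contDiff_quadratic (L : Mat d) (ρ : E d) (c : ℝ) {n : WithTop ℕ∞} :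
    ContDiff ℝ n (quadratic L ρ c) := by
  have h := contDiff_bil_sub L (0 : E d) (n := n)
  simp only [sub_zero] at h
  exact ((h.div_const 2).add (contDiff_const.inner ℝ contDiff_id)).add contDiff_const

lemma hasGradientAt_quadratic {L : Mat d} (hL : L.IsSymm) (ρ : E d) (c : ℝ) (x : E d) :
    HasGradientAt (quadratic L ρ c) (app L x + ρ) x := by
  have h1 := HasGradientAt.const_mul' (1 / 2) (hasGradientAt_bil hL 0 x)
  have h2 := HasGradientAt.add' (HasGradientAt.add' h1 (hasGradientAt_inner_left ρ x))
    (hasGradientAt_const x c)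
  have h3 : (fun y => 1 / 2 * bil L (y - 0) (y - 0) + inner ℝ ρ y + c) = quadratic L ρ c := by
    funext y
    simp only [quadratic, sub_zero]
    ring
  rw [h3] at h2
  convert h2 using 1
  rw [smul_smul, sub_zero, add_zero]
  norm_num

lemma laplacian_quadratic {L : Mat d} (hL : L.IsSymm) (ρ : E d) (c : ℝ) (x : E d) :
    Laplacian.laplacian (quadratic L ρ c) x = L.trace := by
  have hd : DifferentiableAt ℝ (app L) x := (contDiff_app L (n := 1)).differentiable (by simp) x
  rw [laplacian_eq_divergence (hasGradientAt_quadratic hL ρ c) (hd.add_const ρ)]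
  have h1 : (fun y => app L y + ρ) = fun y => app L (y - 0) + (fun _ => ρ) y := by simp
  rw [h1, divergence_add (by simpa using hd) (differentiableAt_const ρ), divergence_app_sub]
  simp [divergence]

lemma hasGradientAt_gaussianDensity {S : Mat d} (hS : S.IsSymm) (μ x : E d) :
    HasGradientAt (gaussianDensity μ S) (-(gaussianDensity μ S x • app S (x - μ))) x := by
  have h1 : HasDerivAt (fun t : ℝ => Real.exp (-(t / 2)))
      (-(1 / 2) * Real.exp (-(bil S (x - μ) (x - μ) / 2))) (bil S (x - μ) (x - μ)) := by
    have h := hasDerivAt_exp_const_mul (-(1 / 2)) (bil S (x - μ) (x - μ))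
    have h' : ∀ t : ℝ, -(1 / 2) * t = -(t / 2) := fun t => by ring
    simpa only [h'] using h
  have h2 := HasGradientAt.const_mul' (Real.sqrt (S.det / (2 * Real.pi) ^ d))
    (HasGradientAt.comp_real (φ := fun t => Real.exp (-(t / 2)))
      (f := fun y => bil S (y - μ) (y - μ)) h1 (hasGradientAt_bil hS μ x))
  change HasGradientAt (gaussianDensity μ S) _ x at h2
  convert h2 using 1
  rw [smul_smul, smul_smul, ← neg_smul]
  congr 1
  simp only [gaussianDensity]
  ring

/-- Here k∇m = -m S(x - a), so the flux itself vanishes, not only its divergence. -/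
lemma kfp_gaussianDensity {k : ℝ} (hk : 0 < k) {S : Mat d} (hS : S.IsSymm) (a x : E d) :
    -k * Laplacian.laplacian (gaussianDensity a (k⁻¹ • S)) x
      - divergence (fun y => gaussianDensity a (k⁻¹ • S) y • app S (y - a)) x = 0 := by
  have hb : DifferentiableAt ℝ (fun y : E d => app S (y - a)) x :=
    ((contDiff_app S (n := 1)).comp (contDiff_id.sub contDiff_const)).differentiable (by simp) x
  have hm : DifferentiableAt ℝ (gaussianDensity a (k⁻¹ • S)) x :=
    (contDiff_gaussianDensity a _ (n := 1)).differentiable (by simp) x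
  have hmb : DifferentiableAt ℝ (fun y => gaussianDensity a (k⁻¹ • S) y • app S (y - a)) x :=
    hm.smul hb
  have h1 : (fun y => -(gaussianDensity a (k⁻¹ • S) y • app (k⁻¹ • S) (y - a))) =
      fun y => (-k⁻¹) • (gaussianDensity a (k⁻¹ • S) y • app S (y - a)) := by
    funext y
    rw [app_smul_left, smul_comm, neg_smul]
  have h2 : Laplacian.laplacian (gaussianDensity a (k⁻¹ • S)) x =
      divergence (fun y => (-k⁻¹) • (gaussianDensity a (k⁻¹ • S) y • app S (y - a))) x := by
    rw [← h1]
    refine laplacian_eq_divergence (hasGradientAt_gaussianDensity (hS.smul _) a) ?_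
    rw [h1]
    exact hmb.fun_const_smul _
  rw [h2, divergence_const_smul _ hmb]
  field_simp
  ring

variable {A Q S : Mat d} {r k ℓ κ : ℝ} {a w H : E d}

/-- The coefficients r(S + A) and -rSa are chosen to absorb `A` and leave a linear drift centred at
`a`. -/
lemma drift_quadratic (hr : 0 < r) (hA : A.IsSymm) (hS : S.IsSymm) (c : ℝ) (x : E d) :
    (1 / r) • gradient (quadratic (r • (S + A)) (-(r • app S a)) c) x - app A x =
      app S (x - a) := by
  rw [(hasGradientAt_quadratic ((hS.add hA).smul r) _ c x).gradient, app_smul_left, app_add_left,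
    app_sub_right, smul_add, smul_neg, smul_smul, smul_smul, one_div, inv_mul_cancel₀ hr.ne',
    one_smul, one_smul]
  abel

/-- Since ∇v = r(S(x - a) + Ax), completing the square turns the two gradient terms into (r/2)(|S(x
- a)|² - |Ax|²). The quadratic coefficients then match by `hP`, the linear ones by `ha`, and the
constant ones by the choice of `valueConst`. -/
lemma hjb_quadratic (hr : 0 < r) (hℓ : 0 < ℓ) (hA : A.IsSymm) (hS : S.IsSymm)
    (hP : S * S + ℓ • S = riccatiMatrix A r ℓ Q) (hQ : Q.IsSymm)
    (ha : r • app (riccatiMatrix A r ℓ Q) a = (2 : ℝ) • app Q H - w) (x : E d) :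
    -k * Laplacian.laplacian (quadratic (r • (S + A)) (-(r • app S a))
        (valueConst A r k ℓ Q S a w H κ)) x
      + 1 / (2 * r) * ‖gradient (quadratic (r • (S + A)) (-(r • app S a))
        (valueConst A r k ℓ Q S a w H κ)) x‖ ^ 2
      - inner ℝ (gradient (quadratic (r • (S + A)) (-(r • app S a))
        (valueConst A r k ℓ Q S a w H κ)) x) (app A x)
      + ℓ * quadratic (r • (S + A)) (-(r • app S a)) (valueConst A r k ℓ Q S a w H κ) x
      = quadCost Q w H κ x := by
  have hsym := (hS.add hA).smul r
  have hgrad : gradient (quadratic (r • (S + A)) (-(r • app S a))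
      (valueConst A r k ℓ Q S a w H κ)) x = r • (app S x - app S a + app A x) := by
    rw [(hasGradientAt_quadratic hsym _ _ x).gradient, app_smul_left, app_add_left,
      ← smul_neg, ← smul_add]
    congr 1
    abel
  have hc : ℓ * valueConst A r k ℓ Q S a w H κ =
      κ + bil Q H H - inner ℝ w H + k * r * (S + A).trace - r / 2 * ‖app S a‖ ^ 2 := by
    rw [valueConst, mul_div_cancel₀ _ hℓ.ne']
  have hPx : ∀ y z : E d, inner ℝ (app S y) (app S z) + ℓ * inner ℝ (app S y) z =
      inner ℝ (app A y) (app A z) - ℓ * inner ℝ y (app A z) + 2 / r * inner ℝ y (app Q z) :=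
    fun y z => by
      have h := congrArg (fun M => inner ℝ y (app M z)) hP
      simp only [riccatiMatrix, app_add_left, app_sub_left, app_smul_left, app_mul, inner_add_right,
        inner_sub_right, inner_smul_right] at h
      rw [inner_app_of_isSymm hS, inner_app_of_isSymm hS, inner_app_of_isSymm hA]
      linarith
  have hax : r * (inner ℝ (app S a) (app S x) + ℓ * inner ℝ (app S a) x) =
      2 * inner ℝ (app Q H) x - inner ℝ w x := by
    have h := congrArg (fun y => inner ℝ y x) ha
    rw [← hP] at h
    simp only [app_add_left, app_smul_left, app_mul, inner_add_left,
      inner_sub_left, inner_smul_left, conj_trivial] at h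
    rw [inner_app_of_isSymm hS (app S a) x] at h
    exact h
  have hxx := hPx x x
  have hrxx : r * (inner ℝ (app S x) (app S x) + ℓ * inner ℝ (app S x) x) =
      r * inner ℝ (app A x) (app A x) - r * ℓ * inner ℝ x (app A x)
        + 2 * inner ℝ x (app Q x) := by
    rw [hxx]
    field_simp
  rw [laplacian_quadratic hsym, hgrad, norm_smul, mul_pow, Real.norm_eq_abs, sq_abs]
  simp only [quadratic, quadCost, mul_add, hc, Matrix.trace_smul, smul_eq_mul]
  simp only [bil, app_smul_left, app_add_left, app_sub_right, inner_add_left, inner_sub_left,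
    inner_add_right, inner_sub_right, inner_smul_left, inner_smul_right, inner_neg_left,
    conj_trivial, ← real_inner_self_eq_norm_sq]
  rw [real_inner_comm (app S x) x] at *
  rw [real_inner_comm (app S a) (app S x), real_inner_comm (app S a) (app A x),
    real_inner_comm (app S x) (app A x), ← inner_app_of_isSymm hQ H x,
    real_inner_comm (app Q H) x]
  have h2r : 1 / (2 * r) * r ^ 2 = r / 2 := by field_simp
  rw [← mul_assoc (1 / (2 * r)) (r ^ 2), h2r]
  linear_combination (1 / 2) * hrxx - hax

/-- With a quadratic cost, the unique solution of the pair of equations is Quadratic-Gaussian. -/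
theorem solvesHJBKFP_quadCost_iff (hr : 0 < r) (hk : 0 < k) (hℓ : 0 < ℓ) (hA : A.IsSymm)
    (hQ : Q.IsSymm) (hS : S.PosDef) (hP : S * S + ℓ • S = riccatiMatrix A r ℓ Q)
    (ha : r • app (riccatiMatrix A r ℓ Q) a = (2 : ℝ) • app Q H - w) {v m : E d → ℝ} :
    SolvesHJBKFP A r k ℓ (quadCost Q w H κ) v m ↔
      v = quadratic (r • (S + A)) (-(r • app S a)) (valueConst A r k ℓ Q S a w H κ) ∧
      m = gaussianDensity a (k⁻¹ • S) := by
  have hSs := isSymm_of_posDef hS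
  have hkS : (k⁻¹ • S).PosDef := hS.smul (inv_pos.2 hk)
  have hj := hjb_quadratic (k := k) (κ := κ) hr hℓ hA hSs hP hQ ha
  have hdr : ∀ x, (1 / r) • gradient (quadratic (r • (S + A)) (-(r • app S a))
      (valueConst A r k ℓ Q S a w H κ)) x - app A x = app S (x - a) :=
    drift_quadratic hr hA hSs _
  have hv0 := contDiff_quadratic (r • (S + A)) (-(r • app S a))
      (valueConst A r k ℓ Q S a w H κ) (n := 2)
  set v₀ := quadratic (r • (S + A)) (-(r • app S a)) (valueConst A r k ℓ Q S a w H κ) with hv₀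
  constructor
  · intro h
    have hv := h.contDiff_v
    -- Dividing by `r` makes the drift of `v` equal to S(x - a) + ∇W and normalises the coefficient
    -- of |∇W|² to 1/2.
    have hW2 : ContDiff ℝ 2 (fun x => r⁻¹ * (v x - v₀ x)) := contDiff_const.mul (hv.sub hv0)
    have hgv := fun y => ContDiff.hasGradientAt' hv (by simp) y
    have hgv0 := fun y => ContDiff.hasGradientAt' hv0 (by simp) y
    have hgW : ∀ y, gradient (fun x => r⁻¹ * (v x - v₀ x)) y =
        r⁻¹ • (gradient v y - gradient v₀ y) := fun y =>
      (HasGradientAt.const_mul' r⁻¹ (HasGradientAt.sub' (hgv y) (hgv0 y))).gradient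
    have hlW : ∀ y, Laplacian.laplacian (fun x => r⁻¹ * (v x - v₀ x)) y =
        r⁻¹ * (Laplacian.laplacian v y - Laplacian.laplacian v₀ y) := fun y => by
      have hd1 := (contDiff_gradient (n := 1) hv).differentiable (by simp) y
      have hd2 := (contDiff_gradient (n := 1) hv0).differentiable (by simp) y
      have hd : DifferentiableAt ℝ (fun z => gradient v z - gradient v₀ z) y := hd1.sub hd2
      rw [laplacian_eq_divergence
        (fun z => HasGradientAt.const_mul' r⁻¹ (HasGradientAt.sub' (hgv z) (hgv0 z)))
        (hd.fun_const_smul r⁻¹), divergence_const_smul _ hd, divergence_sub hd1 hd2,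
        laplacian_eq_divergence_gradient hv, laplacian_eq_divergence_gradient hv0]
    have hdrift : ∀ y, (1 / r) • gradient v y - app A y =
        app S (y - a) + gradient (fun x => r⁻¹ * (v x - v₀ x)) y := fun y => by
      rw [← hdr y, hgW, smul_sub, one_div]
      abel
    have hW0 := eq_zero_of_hjb_of_kfp hk hℓ hS.posSemidef (a := a) hW2 h.contDiff_m
      (fun x => by
        have h1 := h.hjb x
        have h2 := hj x
        have h3 : gradient v x = gradient v₀ x
            + r • gradient (fun x => r⁻¹ * (v x - v₀ x)) x := by
          rw [hgW, smul_smul, mul_inv_cancel₀ hr.ne', one_smul]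
          abel
        have h4 : gradient v₀ x = r • (app S (x - a) + app A x) := by
          rw [← hdr x, sub_add_cancel, smul_smul, mul_one_div_cancel hr.ne', one_smul]
        rw [hlW]
        rw [h3, h4] at h1
        rw [h4] at h2
        rw [← h2] at h1
        generalize gradient (fun x => r⁻¹ * (v x - v₀ x)) x = g at *
        simp only [← smul_add, norm_smul, mul_pow, Real.norm_eq_abs, sq_abs, inner_smul_left,
          conj_trivial] at h1
        simp only [← real_inner_self_eq_norm_sq, inner_add_left, inner_add_right] at *
        rw [real_inner_comm g (app S (x - a)), real_inner_comm (app A x) (app S (x - a)),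
          real_inner_comm g (app A x)] at h1
        have h2r : 1 / (2 * r) * r ^ 2 = r / 2 := by field_simp
        simp only [← mul_assoc, h2r] at h1
        have h5 : r * (-k * (r⁻¹ * (Laplacian.laplacian v x - Laplacian.laplacian v₀ x))
            + 1 / 2 * inner ℝ g g + inner ℝ g (app S (x - a))
            + ℓ * (r⁻¹ * (v x - v₀ x))) = 0 := by
          have hri : r * r⁻¹ = 1 := mul_inv_cancel₀ hr.ne'
          linear_combination h1 + (-k * (Laplacian.laplacian v x - Laplacian.laplacian v₀ x)
            + ℓ * (v x - v₀ x)) * hri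
        exact (mul_eq_zero.1 h5).resolve_left hr.ne')
      (fun x => by
        have h1 := h.kfp x
        simp only [hdrift] at h1
        exact h1)
      h.integrable_m h.pos_m
    have hvv : v = v₀ := by
      funext x
      have h1 := (mul_eq_zero.1 (hW0 x)).resolve_left (inv_ne_zero hr.ne')
      linarith
    refine ⟨hvv, ?_⟩
    obtain ⟨c, hc⟩ := exists_eq_const_mul_exp_of_kfp hk hSs (a := a) h.contDiff_m h.pos_m
      (fun x => by
        have h1 := h.kfp x
        rw [hvv] at h1
        simp only [hdr] at h1
        exact h1)
      (integrable_exp_neg_bil hkS a)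
    have h1 := h.integral_m
    have h2 := integral_gaussianDensity hkS a
    simp only [hc] at h1
    unfold gaussianDensity at h2
    rw [integral_const_mul] at h1 h2
    have hI : (∫ x, Real.exp (-(bil (k⁻¹ • S) (x - a) (x - a) / 2))) ≠ 0 := by
      intro h0
      rw [h0] at h1
      simp at h1
    -- Both densities have mass 1, which fixes the multiplicative constant.
    have hcc := mul_right_cancel₀ hI (h1.trans h2.symm)
    funext x
    rw [hc x, hcc]
    rfl
  · rintro ⟨rfl, rfl⟩
    exact {
      contDiff_v := hv0
      contDiff_m := contDiff_gaussianDensity a _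
      hjb := hj
      kfp := fun x => by
        simp only [hdr]
        exact kfp_gaussianDensity hk hSs a x
      integrable_m := integrable_gaussianDensity hkS a
      integral_m := integral_gaussianDensity hkS a
      pos_m := gaussianDensity_pos a hkS
      second_moment := integrable_norm_sq_mul_gaussianDensity hkS a }

end QuadraticCost

/-! ### The mean field system -/

section MeanField

variable {d : ℕ}

lemma isSymm_riccatiMatrix {A Q : Mat d} (hA : A.IsSymm) (hQ : Q.IsSymm) (r ℓ : ℝ) :
    (riccatiMatrix A r ℓ Q).IsSymm := by
  unfold Matrix.IsSymm riccatiMatrix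
  rw [transpose_add, transpose_sub, transpose_mul, transpose_smul, transpose_smul, hA.eq, hQ.eq]

lemma bil_riccatiMatrix {A : Mat d} (hA : A.IsSymm) (Q : Mat d) (r ℓ : ℝ) (x : E d) :
    bil (riccatiMatrix A r ℓ Q) x x = ‖app A x‖ ^ 2 - ℓ * bil A x x + 2 / r * bil Q x x := by
  simp only [bil, riccatiMatrix, app_add_left, app_sub_left, app_smul_left, app_mul,
    inner_add_right, inner_sub_right, inner_smul_right]
  rw [← inner_app_of_isSymm hA x (app A x), real_inner_self_eq_norm_sq]

/-- As `A` is symmetric, A² contributes |Ax|² ≥ 0; only -ℓA can be negative, and (2/r)Q dominates it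
when ℓ is small. -/
lemma exists_riccatiMatrix_posDef {A Q : Mat d} (hA : A.IsSymm) (hQ : Q.PosDef) {r : ℝ}
    (hr : 0 < r) :
    ∃ ℓh : ℝ, 0 < ℓh ∧ ∀ ℓ, 0 < ℓ → ℓ < ℓh → (riccatiMatrix A r ℓ Q).PosDef := by
  obtain ⟨ε, hε, hc⟩ := exists_coercive hQ
  obtain ⟨C, hC, hb⟩ := exists_bound_bil A
  -- `ε` is the coercivity constant of `Q` and `C` bounds the form of `A`; the 1 keeps the
  -- denominator positive when `C = 0`.
  refine ⟨2 / r * ε / (C + 1), by positivity, fun ℓ hℓ hlt => ?_⟩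
  refine posDef_of_bil_pos (isSymm_riccatiMatrix hA (isSymm_of_posDef hQ) r ℓ) fun x hx => ?_
  rw [bil_riccatiMatrix hA]
  rw [lt_div_iff₀ (by positivity)] at hlt
  have hx2 : 0 < ‖x‖ ^ 2 := by positivity
  have h1 : bil A x x ≤ C * ‖x‖ ^ 2 := by
    have := (le_abs_self _).trans (hb x x)
    rwa [← sq] at this
  have h2 : ℓ * bil A x x ≤ ℓ * (C * ‖x‖ ^ 2) := by gcongr
  have h3 : 2 / r * (ε * ‖x‖ ^ 2) ≤ 2 / r * bil Q x x := by
    have := hc x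
    gcongr
  have h4 : ℓ * (C + 1) * ‖x‖ ^ 2 < 2 / r * ε * ‖x‖ ^ 2 := by gcongr
  nlinarith [sq_nonneg ‖app A x‖, mul_pos hℓ hx2]

/-! ### Square linear systems and the matrix of the mean. -/

lemma exists_app_eq {M : Mat d} (hM : IsUnit M) (y : E d) : ∃ x, app M x = y := by
  refine ⟨app M⁻¹ y, ?_⟩
  rw [← app_mul, Matrix.mul_nonsing_inv _ ((Matrix.isUnit_iff_isUnit_det M).1 hM), app_one]

lemma app_injective {M : Mat d} (hM : IsUnit M) : Function.Injective (app M) := by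
  intro x y h
  have h2 := congrArg (app M⁻¹) h
  rwa [← app_mul, ← app_mul, Matrix.nonsing_inv_mul _ ((Matrix.isUnit_iff_isUnit_det M).1 hM),
    app_one, app_one] at h2

lemma exists_app_eq_zero {M : Mat d} (hM : ¬IsUnit M) : ∃ z : E d, z ≠ 0 ∧ app M z = 0 := by
  rw [Matrix.isUnit_iff_isUnit_det, isUnit_iff_ne_zero, not_not] at hM
  obtain ⟨z, hz, hz0⟩ := Matrix.exists_mulVec_eq_zero_iff.2 hM
  refine ⟨WithLp.toLp 2 z, by simpa using hz, ?_⟩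
  simp [app, hz0]

lemma two_smul_limitMatrix (A : Mat d) {r : ℝ} (hr : 0 < r) (ℓ : ℝ) (Q B : Mat d) :
    (2 : ℝ) • limitMatrix A r ℓ Q B = r • riccatiMatrix A r ℓ Q + B := by
  ext i j
  simp only [limitMatrix, riccatiMatrix, Matrix.add_apply, Matrix.sub_apply, Matrix.smul_apply,
    smul_eq_mul]
  field_simp
  ring

lemma isUnit_limitMatrix_iff (A : Mat d) {r : ℝ} (hr : 0 < r) (ℓ : ℝ) (Q B : Mat d) :
    IsUnit (limitMatrix A r ℓ Q B) ↔ IsUnit (r • riccatiMatrix A r ℓ Q + B) := by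
  rw [← two_smul_limitMatrix A hr, Matrix.isUnit_iff_isUnit_det, Matrix.isUnit_iff_isUnit_det,
    Matrix.det_smul, isUnit_iff_ne_zero, isUnit_iff_ne_zero]
  simp

/-- The data `(v, m)` attached to the mean `μ`: the value function of a player with quadratic cost
`Q`, coupling vector `w` and constant `κ`. -/
def qgValue (A : Mat d) (r k ℓ : ℝ) (Q S : Mat d) (w H : E d) (κ : ℝ) (μ : E d) : E d → ℝ :=
  quadratic (r • (S + A)) (-(r • app S μ)) (valueConst A r k ℓ Q S μ w H κ)

lemma isQG_qgValue {A Q S : Mat d} (hA : A.IsSymm) (hS : S.PosDef) {r k : ℝ} (hk : 0 < k)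
    (ℓ : ℝ) (w H : E d) (κ : ℝ) (μ : E d) :
    IsQG (qgValue A r k ℓ Q S w H κ μ) (gaussianDensity μ (k⁻¹ • S)) :=
  ⟨_, _, _, _, _, ((isSymm_of_posDef hS).add hA).smul r, hS.smul (inv_pos.2 hk), rfl, rfl⟩

/-- The constant part of the mean field cost of a Gaussian density. -/
def mfConst (C D : Mat d) (Δ₀ : E d) (S : Mat d) (μ : E d) : ℝ :=
  ∑ i, ∑ j, C i j * secondMoment (gaussianDensity μ S) Δ₀ i j + bil D (μ - Δ₀) (μ - Δ₀)

/-- The solutions of the mean field system are parametrised by the solutions `μ` of a linear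
system. -/
theorem isMFSolution_iff {A Q B C D S : Mat d} {r k ℓ : ℝ} (hr : 0 < r) (hk : 0 < k) (hℓ : 0 < ℓ)
    (hA : A.IsSymm) (hQ : Q.IsSymm) (hB : B.IsSymm) (hPd : (riccatiMatrix A r ℓ Q).PosDef)
    (hS : S.PosDef) (hP : S * S + ℓ • S = riccatiMatrix A r ℓ Q) {H Δ₀ : E d} {v m : E d → ℝ} :
    IsMFSolution A r k ℓ Q B C D H Δ₀ v m ↔
      ∃ μ, app (r • riccatiMatrix A r ℓ Q + B) μ = (2 : ℝ) • app Q H + app B Δ₀ ∧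
        v = qgValue A r k ℓ Q S (app B (μ - Δ₀)) H (mfConst C D Δ₀ (k⁻¹ • S) μ) μ ∧
        m = gaussianDensity μ (k⁻¹ • S) := by
  have hkS : (k⁻¹ • S).PosDef := hS.smul (inv_pos.2 hk)
  have hlin : ∀ μ : E d, app (r • riccatiMatrix A r ℓ Q + B) μ = (2 : ℝ) • app Q H + app B Δ₀ ↔
      -- The right-hand form is the equation of the centre `a` for the coupling vector B(μ - Δ₀),
      -- with a = μ imposed.
      r • app (riccatiMatrix A r ℓ Q) μ = (2 : ℝ) • app Q H - app B (μ - Δ₀) := fun μ => by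
    rw [app_add_left, app_smul_left, app_sub_right]
    constructor
    · intro h
      rw [eq_sub_of_add_eq h]
      abel
    · intro h
      rw [h]
      abel
  constructor
  · intro h
    have hcost := meanFieldCost_eq (Q := Q) (C := C) (D := D) (H := H) (Δ₀ := Δ₀) hB
      h.integrable_m h.integral_m h.pos_m h.second_moment
    set μ := ∫ ξ, m ξ • ξ with hμ
    -- With the mean of `m` frozen, the one-player theorem forces `m` to be the Gaussian centred at
    -- `a`; comparing means gives μ = a.
    obtain ⟨a, ha⟩ := exists_app_eq hPd.isUnit (r⁻¹ • ((2 : ℝ) • app Q H - app B (μ - Δ₀)))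
    have ha' : r • app (riccatiMatrix A r ℓ Q) a = (2 : ℝ) • app Q H - app B (μ - Δ₀) := by
      rw [ha, smul_smul, mul_inv_cancel₀ hr.ne', one_smul]
    have h' : SolvesHJBKFP A r k ℓ (quadCost Q (app B (μ - Δ₀)) H
        (∑ i, ∑ j, C i j * secondMoment m Δ₀ i j + bil D (μ - Δ₀) (μ - Δ₀))) v m := by
      have h2 : SolvesHJBKFP A r k ℓ (meanFieldCost Q B C D H Δ₀ m) v m := h
      rw [hcost] at h2
      exact h2
    obtain ⟨hv, hm⟩ := (solvesHJBKFP_quadCost_iff hr hk hℓ hA hQ hS hP ha').1 h'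
    have hμa : μ = a := by rw [hμ, hm, integral_smul_gaussianDensity hkS]
    rw [← hμa] at ha' hv hm
    refine ⟨μ, (hlin μ).2 ha', ?_, hm⟩
    rw [hv, qgValue, mfConst, ← hm]
  · rintro ⟨μ, hμ, rfl, rfl⟩
    have hcost := meanFieldCost_eq (Q := Q) (C := C) (D := D) (H := H) (Δ₀ := Δ₀) hB
      (integrable_gaussianDensity hkS μ) (integral_gaussianDensity hkS μ)
      (gaussianDensity_pos μ hkS) (integrable_norm_sq_mul_gaussianDensity hkS μ)
    rw [integral_smul_gaussianDensity hkS] at hcost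
    unfold IsMFSolution
    rw [hcost]
    exact (solvesHJBKFP_quadCost_iff hr hk hℓ hA hQ hS hP ((hlin μ).1 hμ)).2 ⟨rfl, rfl⟩

/-- Solutions correspond to the means solving a square affine system. If its matrix is singular,
adding a kernel vector to one mean produces a second solution, with a different Gaussian. -/
theorem existsUnique_qg_iff {A Q B C D : Mat d} {r k ℓ : ℝ} (hr : 0 < r) (hk : 0 < k)
    (hℓ : 0 < ℓ) (hA : A.IsSymm) (hQ : Q.IsSymm) (hB : B.IsSymm)
    (hPd : (riccatiMatrix A r ℓ Q).PosDef) {H Δ₀ : E d} :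
    (∃! p : (E d → ℝ) × (E d → ℝ),
      IsMFSolution A r k ℓ Q B C D H Δ₀ p.1 p.2 ∧ IsQG p.1 p.2) ↔
      IsUnit (limitMatrix A r ℓ Q B) := by
  obtain ⟨S, hS, hP⟩ := exists_posDef_solution hPd ℓ
  have hkS : (k⁻¹ • S).PosDef := hS.smul (inv_pos.2 hk)
  have hiff := fun v m => isMFSolution_iff (C := C) (D := D) (H := H) (Δ₀ := Δ₀) (v := v) (m := m)
    hr hk hℓ hA hQ hB hPd hS hP
  rw [isUnit_limitMatrix_iff A hr]
  constructor
  · rintro ⟨p, ⟨hp, _⟩, huniq⟩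
    by_contra hM
    obtain ⟨z, hz, hz0⟩ := exists_app_eq_zero hM
    obtain ⟨μ, hμ, hv, hm⟩ := (hiff _ _).1 hp
    have hμz : app (r • riccatiMatrix A r ℓ Q + B) (μ + z) =
        (2 : ℝ) • app Q H + app B Δ₀ := by rw [app_add_right, hz0, add_zero, hμ]
    have h2 := huniq (_, _) ⟨(hiff _ _).2 ⟨μ + z, hμz, rfl, rfl⟩,
      isQG_qgValue hA hS hk ℓ _ H _ (μ + z)⟩
    have h3 : gaussianDensity (μ + z) (k⁻¹ • S) = p.2 := congrArg Prod.snd h2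
    rw [hm] at h3
    have h4 := gaussianDensity_injective_mean hkS hkS h3
    exact hz (by simpa using h4)
  · intro hM
    obtain ⟨μ, hμ⟩ := exists_app_eq hM ((2 : ℝ) • app Q H + app B Δ₀)
    refine ⟨(_, _), ⟨(hiff _ _).2 ⟨μ, hμ, rfl, rfl⟩, isQG_qgValue hA hS hk ℓ _ H _ μ⟩, ?_⟩
    rintro ⟨v, m⟩ ⟨h, _⟩
    obtain ⟨μ', hμ', hv, hm⟩ := (hiff _ _).1 h
    have : μ' = μ := app_injective hM (hμ'.trans hμ.symm)
    subst this
    exact Prod.ext hv hm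

/-- The matrix rP + B of the linear system is a positive definite matrix plus a positive
semidefinite one, hence invertible. The discount term pins down the additive constant of the value
function. -/
theorem exists_qg_unique_of_posSemidef {A Q B C D : Mat d} {r k ℓ : ℝ} (hr : 0 < r) (hk : 0 < k)
    (hℓ : 0 < ℓ) (hA : A.IsSymm) (hQ : Q.IsSymm) (hB : B.IsSymm)
    (hPd : (riccatiMatrix A r ℓ Q).PosDef) (hBp : B.PosSemidef) {H Δ₀ : E d} :
    ∃ v m : E d → ℝ, IsMFSolution A r k ℓ Q B C D H Δ₀ v m ∧ IsQG v m ∧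
      ∀ v' m' : E d → ℝ, IsMFSolution A r k ℓ Q B C D H Δ₀ v' m' → v' = v ∧ m' = m := by
  obtain ⟨S, hS, hP⟩ := exists_posDef_solution hPd ℓ
  have hiff := fun v m => isMFSolution_iff (C := C) (D := D) (H := H) (Δ₀ := Δ₀) (v := v) (m := m)
    hr hk hℓ hA hQ hB hPd hS hP
  have hM : IsUnit (r • riccatiMatrix A r ℓ Q + B) :=
    ((hPd.smul hr).add_posSemidef hBp).isUnit
  obtain ⟨μ, hμ⟩ := exists_app_eq hM ((2 : ℝ) • app Q H + app B Δ₀)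
  refine ⟨_, _, (hiff _ _).2 ⟨μ, hμ, rfl, rfl⟩, isQG_qgValue hA hS hk ℓ _ H _ μ, ?_⟩
  intro v' m' h
  obtain ⟨μ', hμ', hv, hm⟩ := (hiff _ _).1 h
  have : μ' = μ := app_injective hM (hμ'.trans hμ.symm)
  subst this
  exact ⟨hv, hm⟩

end MeanField

/-! ### Averages over independent players -/

section Product

variable {d : ℕ} {ι : Type*} [Fintype ι]

lemma integrable_prod_density {p : E d → ℝ} (hp : Integrable p) :
    Integrable fun ξ : ι → E d => ∏ l, p (ξ l) :=
  Integrable.fintype_prod (f := fun _ : ι => p) fun _ => hp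

lemma integral_prod_density {p : E d → ℝ} (h1 : ∫ x, p x = 1) :
    ∫ ξ : ι → E d, ∏ l, p (ξ l) = 1 := by
  rw [integral_fintype_prod_volume_eq_pow, h1, one_pow]

variable [DecidableEq ι]

/-- Written as a product of one-variable functions, the integrand is integrated factor by factor. -/
lemma mul_mul_prod_density_eq (p f g : E d → ℝ) (j k : ι) (ξ : ι → E d) :
    f (ξ j) * g (ξ k) * ∏ l, p (ξ l) =
      ∏ l, (if l = j then f (ξ l) else 1) * (if l = k then g (ξ l) else 1) * p (ξ l) := by
  rw [Finset.prod_mul_distrib, Finset.prod_mul_distrib]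
  simp only [Finset.prod_ite_eq', Finset.mem_univ, if_true]

lemma integrable_mul_mul_prod_density {p f g : E d → ℝ} (hp : Integrable p)
    (hf : Integrable fun x => f x * p x) (hg : Integrable fun x => g x * p x) {j k : ι}
    (hjk : j ≠ k) : Integrable fun ξ : ι → E d => f (ξ j) * g (ξ k) * ∏ l, p (ξ l) := by
  simp only [mul_mul_prod_density_eq]
  refine Integrable.fintype_prod (μ := fun _ : ι => (volume : Measure (E d)))
    (f := fun l x => (if l = j then f x else 1) * (if l = k then g x else 1) * p x) fun l => ?_
  rcases eq_or_ne l j with rfl | hj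
  · simpa [hjk] using hf
  · rcases eq_or_ne l k with rfl | hk
    · simpa [hj] using hg
    · simpa [hj, hk] using hp

lemma integral_mul_mul_prod_density {p : E d → ℝ} (h1 : ∫ x, p x = 1) (f g : E d → ℝ) {j k : ι}
    (hjk : j ≠ k) : ∫ ξ : ι → E d, f (ξ j) * g (ξ k) * ∏ l, p (ξ l) =
      (∫ x, f x * p x) * ∫ x, g x * p x := by
  simp only [mul_mul_prod_density_eq]
  refine (integral_fintype_prod_volume_eq_prod (ι := ι) (E := fun _ => E d)
    (fun l x => (if l = j then f x else 1) * (if l = k then g x else 1) * p x)).trans ?_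
  have h : ∀ l, ∫ x, (if l = j then f x else 1) * (if l = k then g x else 1) * p x =
      (if l = j then ∫ x, f x * p x else 1) * (if l = k then ∫ x, g x * p x else 1) := fun l => by
    rcases eq_or_ne l j with rfl | hj
    · simp [hjk]
    · rcases eq_or_ne l k with rfl | hk
      · simp [hj]
      · simp [hj, hk, h1]
  simp only [h]
  rw [Finset.prod_mul_distrib]
  simp only [Finset.prod_ite_eq', Finset.mem_univ, if_true]

lemma mul_prod_density_eq (p f : E d → ℝ) (j : ι) (ξ : ι → E d) :
    f (ξ j) * ∏ l, p (ξ l) =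
      ∏ l, (if l = j then f (ξ l) else 1) * p (ξ l) := by
  rw [Finset.prod_mul_distrib]
  simp only [Finset.prod_ite_eq', Finset.mem_univ, if_true]

lemma integrable_mul_prod_density {p f : E d → ℝ} (hp : Integrable p)
    (hf : Integrable fun x => f x * p x) (j : ι) :
    Integrable fun ξ : ι → E d => f (ξ j) * ∏ l, p (ξ l) := by
  simp only [mul_prod_density_eq]
  refine Integrable.fintype_prod (μ := fun _ : ι => (volume : Measure (E d)))
    (f := fun l x => (if l = j then f x else 1) * p x) fun l => ?_
  rcases eq_or_ne l j with rfl | hj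
  · simpa using hf
  · simpa [hj] using hp

lemma integral_mul_prod_density {p : E d → ℝ} (h1 : ∫ x, p x = 1) (f : E d → ℝ) (j : ι) :
    ∫ ξ : ι → E d, f (ξ j) * ∏ l, p (ξ l) = ∫ x, f x * p x := by
  simp only [mul_prod_density_eq]
  refine (integral_fintype_prod_volume_eq_prod (ι := ι) (E := fun _ => E d)
    (fun l x => (if l = j then f x else 1) * p x)).trans ?_
  have h : ∀ l, ∫ x, (if l = j then f x else 1) * p x =
      (if l = j then ∫ x, f x * p x else 1) := fun l => by
    rcases eq_or_ne l j with rfl | hj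
    · simp
    · simp [hj, h1]
  simp only [h]
  simp [Finset.prod_ite_eq']

lemma coord_integral {p : E d → ℝ} (hp : Integrable p) (h1 : ∫ x, p x = 1) (h0 : ∀ x, 0 < p x)
    (h2 : Integrable fun x => ‖x‖ ^ 2 * p x) (z : E d) (a : Fin d) :
    ∫ x, (x - z) a * p x = ((∫ x, p x • x) - z) a := by
  have h := integral_inner_mul hp h1 h0 h2 (EuclideanSpace.single a 1) z
  simpa [EuclideanSpace.inner_single_left] using h

/-- Distinct players are independent, so the average of a bilinear expression is its value at the
means. -/
lemma bil_mul_prod_density {p : E d → ℝ} (hp : Integrable p) (h1 : ∫ x, p x = 1)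
    (h0 : ∀ x, 0 < p x) (h2 : Integrable fun x => ‖x‖ ^ 2 * p x) (D : Mat d) (z : E d) {j k : ι}
    (hjk : j ≠ k) :
    Integrable (fun ξ : ι → E d => bil D (ξ j - z) (ξ k - z) * ∏ l, p (ξ l)) ∧
    ∫ ξ : ι → E d, bil D (ξ j - z) (ξ k - z) * ∏ l, p (ξ l) =
      bil D ((∫ x, p x • x) - z) ((∫ x, p x • x) - z) := by
  have hc := integrable_coord_mul hp h0 h2 z
  have hint : ∀ a b : Fin d, Integrable fun ξ : ι → E d =>
      D a b * ((ξ j - z) a * (ξ k - z) b * ∏ l, p (ξ l)) := fun a b =>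
    (integrable_mul_mul_prod_density hp (hc a) (hc b) hjk).const_mul _
  have h : ∀ ξ : ι → E d, bil D (ξ j - z) (ξ k - z) * ∏ l, p (ξ l) =
      ∑ a, ∑ b, D a b * ((ξ j - z) a * (ξ k - z) b * ∏ l, p (ξ l)) := fun ξ => by
    rw [bil_eq_sum]
    simp only [Finset.sum_mul]
    exact Finset.sum_congr rfl fun a _ => Finset.sum_congr rfl fun b _ => by ring
  rw [funext h]
  refine ⟨integrable_finsetSum _ fun a _ => integrable_finsetSum _ fun b _ => hint a b, ?_⟩
  refine (integral_finsetSum (f := fun a (ξ : ι → E d) =>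
    ∑ b, D a b * ((ξ j - z) a * (ξ k - z) b * ∏ l, p (ξ l))) _
    fun a _ => integrable_finsetSum _ fun b _ => hint a b).trans ?_
  rw [bil_eq_sum]
  refine Finset.sum_congr rfl fun a _ => ?_
  refine (integral_finsetSum (f := fun b (ξ : ι → E d) =>
    D a b * ((ξ j - z) a * (ξ k - z) b * ∏ l, p (ξ l))) _ fun b _ => hint a b).trans ?_
  refine Finset.sum_congr rfl fun b _ => ?_
  rw [integral_const_mul, integral_mul_mul_prod_density h1 (fun x => (x - z) a)
    (fun x => (x - z) b) hjk, coord_integral hp h1 h0 h2, coord_integral hp h1 h0 h2]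

end Product

/-! ### Games with many players -/

section Game

variable {d N : ℕ}

/-- The blocks (i, j) and (j, i) are B/2 and Bᵀ/2, so their contributions coincide and add up,
without `B` having to be symmetric. -/
lemma LQGame.cost_profile {G : LQGame d N} {Q B : Mat d} {C D : Fin N → Mat d} {H Δ₀ : E d}
    (h1 : G.H1) (h2 : G.H2 Q B C D H Δ₀) (i : Fin N) (x : E d)
    (ξ : {j : Fin N // j ≠ i} → E d) :
    G.cost i (LQGame.profile i x ξ) = bil Q (x - H) (x - H)
      + ∑ j, inner ℝ (app Bᵀ (x - H)) (ξ j - Δ₀)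
      + ∑ j, ∑ k, bil (if j = k then C i else D i) (ξ j - Δ₀) (ξ k - Δ₀) := by
  have hi : LQGame.profile i x ξ i = x := by simp [LQGame.profile]
  have hj : ∀ j : {j : Fin N // j ≠ i}, LQGame.profile i x ξ j = ξ j := fun j => by
    simp [LQGame.profile, j.2]
  have hcross : ∀ j : {j : Fin N // j ≠ i}, G.Q i j i = (1 / 2 : ℝ) • Bᵀ := fun j => by
    rw [← h1.Q_symm i i j, h2.Q_cross i j j.2, transpose_smul]
  have hoth : ∀ j k : {j : Fin N // j ≠ i}, G.Q i j k = if j = k then C i else D i := fun j k => by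
    split_ifs with h
    · rw [← h, h2.Q_diag i j j.2]
    · exact h2.Q_other i j k j.2 k.2 fun hh => h (Subtype.ext hh)
  unfold LQGame.cost
  rw [Fintype.sum_eq_add_sum_subtype_ne _ i, Fintype.sum_eq_add_sum_subtype_ne _ i]
  simp only [Fintype.sum_eq_add_sum_subtype_ne
    (fun k => bil (G.Q i _ k) (_ - _) (LQGame.profile i x ξ k - G.ref i k)) i]
  simp only [hi, hj, h2.Q_own, h2.ref_own, hcross, hoth, fun j : {j : Fin N // j ≠ i} =>
    h2.Q_cross i j j.2, fun j : {j : Fin N // j ≠ i} => h2.ref_other i j j.2]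
  rw [Finset.sum_add_distrib, ← add_assoc, add_assoc (bil Q (x - H) (x - H)),
    ← Finset.sum_add_distrib]
  congr 2
  refine Finset.sum_congr rfl fun j _ => ?_
  simp only [bil, app_smul_left, inner_smul_right]
  rw [inner_app_comm B, real_inner_comm (ξ j - Δ₀) (app Bᵀ (x - H))]
  ring

/-- There are N - 1 opponents and (N - 1)(N - 2) ordered pairs of distinct opponents, all with the
same law; hence the shape of a mean field cost with rescaled matrices. -/
lemma LQGame.averagedCost_eq {G : LQGame d N} {Q B : Mat d} {C D : Fin N → Mat d} {H Δ₀ : E d}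
    (h1 : G.H1) (h2 : G.H2 Q B C D H Δ₀) {m : Fin N → E d → ℝ} {S : Mat d} (hS : S.PosDef)
    {μ : E d} (hm : ∀ j, m j = gaussianDensity μ S) (i : Fin N) :
    G.averagedCost m i = quadCost Q (app (((N : ℝ) - 1) • B) (μ - Δ₀)) H
      (mfConst (((N : ℝ) - 1) • C i) ((((N : ℝ) - 1) * ((N : ℝ) - 2)) • D i) Δ₀ S μ) := by
  funext x
  set p := gaussianDensity μ S with hp
  have hpi := integrable_gaussianDensity hS μ
  have hp1 := integral_gaussianDensity hS μ
  have hp0 := gaussianDensity_pos μ hS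
  have hp2 := integrable_norm_sq_mul_gaussianDensity hS μ
  have hpm : ∫ ξ, p ξ • ξ = μ := integral_smul_gaussianDensity hS μ
  rw [← hp] at hpi hp1 hp0 hp2
  have hN : (Fintype.card {j : Fin N // j ≠ i} : ℝ) = (N : ℝ) - 1 := by
    have h3 : Fintype.card {j : Fin N // j ≠ i} = N - 1 := by
      simp [Fintype.card_subtype_compl]
    have h4 : 1 ≤ N := i.pos
    rw [h3, Nat.cast_sub h4, Nat.cast_one]
  have hlin : ∀ j : {j : Fin N // j ≠ i}, Integrable (fun ξ : {j : Fin N // j ≠ i} → E d =>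
        inner ℝ (app Bᵀ (x - H)) (ξ j - Δ₀) * ∏ l, p (ξ l)) ∧
      ∫ ξ : {j : Fin N // j ≠ i} → E d, inner ℝ (app Bᵀ (x - H)) (ξ j - Δ₀) * ∏ l, p (ξ l) =
        inner ℝ (app B (μ - Δ₀)) (x - H) := fun j => by
    constructor
    · refine integrable_mul_prod_density (f := fun y => inner ℝ (app Bᵀ (x - H)) (y - Δ₀)) hpi ?_ j
      have h := (integrable_smul_sub hpi hp0 hp2 Δ₀).const_inner (𝕜 := ℝ) (app Bᵀ (x - H))
      refine h.congr (Eventually.of_forall fun y => ?_)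
      simp only [inner_smul_right]
      ring
    · rw [integral_mul_prod_density hp1 (fun y => inner ℝ (app Bᵀ (x - H)) (y - Δ₀)),
        integral_inner_mul hpi hp1 hp0 hp2, hpm, ← inner_app_comm, real_inner_comm]
  have hquad : ∀ j k : {j : Fin N // j ≠ i}, Integrable (fun ξ : {j : Fin N // j ≠ i} → E d =>
        bil (if j = k then C i else D i) (ξ j - Δ₀) (ξ k - Δ₀) * ∏ l, p (ξ l)) ∧
      ∫ ξ : {j : Fin N // j ≠ i} → E d,
        bil (if j = k then C i else D i) (ξ j - Δ₀) (ξ k - Δ₀) * ∏ l, p (ξ l) =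
        if j = k then ∑ a, ∑ b, C i a b * secondMoment p Δ₀ a b
          else bil (D i) (μ - Δ₀) (μ - Δ₀) := fun j k => by
    rcases eq_or_ne j k with rfl | hjk
    · simp only [if_true]
      constructor
      · refine integrable_mul_prod_density (f := fun y => bil (C i) (y - Δ₀) (y - Δ₀)) hpi ?_ j
        have h : ∀ y, bil (C i) (y - Δ₀) (y - Δ₀) * p y =
            ∑ a, ∑ b, C i a b * ((y - Δ₀) a * (y - Δ₀) b * p y) := fun y => by
          rw [bil_eq_sum]
          simp only [Finset.sum_mul]
          exact Finset.sum_congr rfl fun a _ => Finset.sum_congr rfl fun b _ => by ring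
        rw [funext h]
        exact integrable_finsetSum _ fun a _ => integrable_finsetSum _ fun b _ =>
          (integrable_coord_mul_coord_mul hpi hp0 hp2 Δ₀ a b).const_mul _
      · rw [integral_mul_prod_density hp1 (fun y => bil (C i) (y - Δ₀) (y - Δ₀)),
          integral_bil_mul hpi hp0 hp2]
    · have h := bil_mul_prod_density hpi hp1 hp0 hp2 (D i) Δ₀ hjk
      rw [hpm] at h
      simpa only [hjk, if_false] using h
  unfold LQGame.averagedCost
  have hcost : ∀ ξ : {j : Fin N // j ≠ i} → E d,
      G.cost i (LQGame.profile i x ξ) * ∏ j : {j : Fin N // j ≠ i}, m j (ξ j) =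
      bil Q (x - H) (x - H) * ∏ l, p (ξ l)
      + ∑ j, inner ℝ (app Bᵀ (x - H)) (ξ j - Δ₀) * ∏ l, p (ξ l)
      + ∑ j, ∑ k, bil (if j = k then C i else D i) (ξ j - Δ₀) (ξ k - Δ₀) * ∏ l, p (ξ l) :=
    fun ξ => by
      rw [LQGame.cost_profile h1 h2]
      simp only [hm, add_mul, Finset.sum_mul]
  rw [funext hcost]
  have hi1 : Integrable fun ξ : {j : Fin N // j ≠ i} → E d =>
      bil Q (x - H) (x - H) * ∏ l, p (ξ l) := (integrable_prod_density hpi).const_mul _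
  have hi2 : Integrable fun ξ : {j : Fin N // j ≠ i} → E d =>
      ∑ j, inner ℝ (app Bᵀ (x - H)) (ξ j - Δ₀) * ∏ l, p (ξ l) :=
    integrable_finsetSum _ fun j _ => (hlin j).1
  have hi3 : Integrable fun ξ : {j : Fin N // j ≠ i} → E d =>
      ∑ j, ∑ k, bil (if j = k then C i else D i) (ξ j - Δ₀) (ξ k - Δ₀) * ∏ l, p (ξ l) :=
    integrable_finsetSum _ fun j _ => integrable_finsetSum _ fun k _ => (hquad j k).1
  have hI3 : ∫ ξ : {j : Fin N // j ≠ i} → E d,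
      ∑ j, ∑ k, bil (if j = k then C i else D i) (ξ j - Δ₀) (ξ k - Δ₀) * ∏ l, p (ξ l) =
      ∑ j : {j : Fin N // j ≠ i}, ∑ k : {j : Fin N // j ≠ i},
        if j = k then ∑ a, ∑ b, C i a b * secondMoment p Δ₀ a b
          else bil (D i) (μ - Δ₀) (μ - Δ₀) := by
    rw [integral_finsetSum _ fun j _ => integrable_finsetSum _ fun k _ => (hquad j k).1]
    refine Finset.sum_congr rfl fun j _ => ?_
    rw [integral_finsetSum _ fun k _ => (hquad j k).1]
    exact Finset.sum_congr rfl fun k _ => (hquad j k).2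
  have hcount : ∀ c e : ℝ, (∑ j : {j : Fin N // j ≠ i}, ∑ k : {j : Fin N // j ≠ i},
      if j = k then c else e) = ((N : ℝ) - 1) * c + ((N : ℝ) - 1) * ((N : ℝ) - 2) * e :=
    fun c e => by
      have h3 : ∀ j : {j : Fin N // j ≠ i}, (∑ k : {j : Fin N // j ≠ i},
          if j = k then c else e) = c + ((N : ℝ) - 2) * e := fun j => by
        have h4 : ∀ k : {j : Fin N // j ≠ i}, (if j = k then c else e) =
            (if j = k then c - e else 0) + e := fun k => by split_ifs <;> ring
        simp only [h4, Finset.sum_add_distrib, Finset.sum_ite_eq, Finset.mem_univ, if_true,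
          Finset.sum_const, Finset.card_univ, nsmul_eq_mul, hN]
        ring
      simp only [h3, Finset.sum_const, Finset.card_univ, nsmul_eq_mul, hN]
      ring
  refine (integral_add (hi1.add hi2) hi3).trans ?_
  simp only [Pi.add_apply]
  rw [integral_add hi1 hi2, integral_const_mul,
    integral_prod_density hp1, mul_one, hI3, hcount,
    integral_finsetSum _ fun j _ => (hlin j).1]
  simp only [(hlin _).2, Finset.sum_const, Finset.card_univ, nsmul_eq_mul, hN]
  simp only [quadCost, mfConst, app_smul_left, inner_smul_left, conj_trivial, Matrix.smul_apply,
    smul_eq_mul, bil, inner_smul_right, mul_assoc, Finset.mul_sum]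
  rfl

/-- Quadratic-Gaussian solutions of the game are parametrised by the solutions `μ` of a linear
system. -/
theorem LQGame.isSolution_and_isQGProfile_iff {G : LQGame d N} {A Q B : Mat d}
    {C D : Fin N → Mat d} {H Δ₀ : E d} (hN : 1 ≤ N) (hGA : G.A = A)
    (h1 : G.H1) (h2 : G.H2 Q B C D H Δ₀) {S : Mat d} {r k ℓ : ℝ} (hr : 0 < r) (hk : 0 < k)
    (hℓ : 0 < ℓ) (hA : A.IsSymm) (hPd : (riccatiMatrix A r ℓ Q).PosDef)
    (hS : S.PosDef) (hP : S * S + ℓ • S = riccatiMatrix A r ℓ Q) {v m : Fin N → E d → ℝ} :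
    (G.IsSolution r k ℓ v m ∧ IsQGProfile v m) ↔
      ∃ μ, app (r • riccatiMatrix A r ℓ Q + ((N : ℝ) - 1) • B) μ =
          (2 : ℝ) • app Q H + app (((N : ℝ) - 1) • B) Δ₀ ∧
        ∀ i, v i = qgValue A r k ℓ Q S (app (((N : ℝ) - 1) • B) (μ - Δ₀)) H
          (mfConst (((N : ℝ) - 1) • C i) ((((N : ℝ) - 1) * ((N : ℝ) - 2)) • D i) Δ₀
            (k⁻¹ • S) μ) μ ∧
          m i = gaussianDensity μ (k⁻¹ • S) := by
  have hkS : (k⁻¹ • S).PosDef := hS.smul (inv_pos.2 hk)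
  have hQ := isSymm_of_posDef h2.Q_posDef
  set B' := ((N : ℝ) - 1) • B with hB'
  have hlin : ∀ μ : E d, app (r • riccatiMatrix A r ℓ Q + B') μ = (2 : ℝ) • app Q H + app B' Δ₀ ↔
      r • app (riccatiMatrix A r ℓ Q) μ = (2 : ℝ) • app Q H - app B' (μ - Δ₀) := fun μ => by
    rw [app_add_left, app_smul_left, app_sub_right]
    constructor
    · intro h
      rw [eq_sub_of_add_eq h]
      abel
    · intro h
      rw [h]
      abel
  constructor
  · rintro ⟨hsol, L, S₀, μ, ρ, c, hL, hS₀, hvm⟩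
    obtain ⟨a, ha⟩ := exists_app_eq hPd.isUnit (r⁻¹ • ((2 : ℝ) • app Q H - app B' (μ - Δ₀)))
    have ha' : r • app (riccatiMatrix A r ℓ Q) a = (2 : ℝ) • app Q H - app B' (μ - Δ₀) := by
      rw [ha, smul_smul, mul_inv_cancel₀ hr.ne', one_smul]
    have hcost := LQGame.averagedCost_eq h1 h2 hS₀ (fun j => (hvm j).2)
    have hs : ∀ i, v i = quadratic (r • (S + A)) (-(r • app S a)) (valueConst A r k ℓ Q S a
        (app B' (μ - Δ₀)) H (mfConst (((N : ℝ) - 1) • C i)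
          ((((N : ℝ) - 1) * ((N : ℝ) - 2)) • D i) Δ₀ S₀ μ)) ∧
        m i = gaussianDensity a (k⁻¹ • S) := fun i => by
      have h3 := hsol i
      rw [hcost i, hGA] at h3
      exact (solvesHJBKFP_quadCost_iff hr hk hℓ hA hQ hS hP ha').1 h3
    -- The law is common, so a single player identifies it; `1 ≤ N` provides player 0.
    have hmi : gaussianDensity μ S₀ = gaussianDensity a (k⁻¹ • S) :=
      (hvm ⟨0, hN⟩).2.symm.trans (hs ⟨0, hN⟩).2
    have hμa : μ = a := gaussianDensity_injective_mean hS₀ hkS hmi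
    subst hμa
    refine ⟨μ, (hlin μ).2 ha', fun i => ⟨?_, (hs i).2⟩⟩
    rw [(hs i).1, qgValue, mfConst, mfConst, hmi]
  · rintro ⟨μ, hμ, hvm⟩
    refine ⟨fun i => ?_, r • (S + A), k⁻¹ • S, μ, _, _, ((isSymm_of_posDef hS).add hA).smul r, hkS,
      hvm⟩
    rw [LQGame.averagedCost_eq h1 h2 hkS (fun j => (hvm j).2), hGA]
    exact (solvesHJBKFP_quadCost_iff hr hk hℓ hA hQ hS hP ((hlin μ).1 hμ)).2 (hvm i)

end Game

/-! ### Dependence of the coefficients on the data -/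

section Coefficients

variable {d : ℕ} {ι : Type*} {F : Filter ι}

lemma continuous_toEuclideanCLM :
    Continuous fun M : Mat d => Matrix.toEuclideanCLM (n := Fin d) (𝕜 := ℝ) M :=
  (Matrix.toEuclideanCLM (n := Fin d) (𝕜 := ℝ)).toAlgEquiv.toLinearMap.continuous_of_finiteDimensional

lemma tendsto_app {M : ι → Mat d} {M₀ : Mat d} {x : ι → E d} {x₀ : E d}
    (hM : Tendsto M F (𝓝 M₀)) (hx : Tendsto x F (𝓝 x₀)) :
    Tendsto (fun n => app (M n) (x n)) F (𝓝 (app M₀ x₀)) := by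
  have h : Continuous fun z : Mat d × E d => app z.1 z.2 :=
    (continuous_toEuclideanCLM.comp continuous_fst).clm_apply continuous_snd
  exact (h.tendsto (M₀, x₀)).comp (hM.prodMk_nhds hx)

lemma tendsto_bil {M : ι → Mat d} {M₀ : Mat d} {x y : ι → E d} {x₀ y₀ : E d}
    (hM : Tendsto M F (𝓝 M₀)) (hx : Tendsto x F (𝓝 x₀)) (hy : Tendsto y F (𝓝 y₀)) :
    Tendsto (fun n => bil (M n) (x n) (y n)) F (𝓝 (bil M₀ x₀ y₀)) :=
  hx.inner (tendsto_app hM hy)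

lemma tendsto_riccatiMatrix (A : Mat d) (r ℓ : ℝ) {Q : ι → Mat d} {Q₀ : Mat d}
    (hQ : Tendsto Q F (𝓝 Q₀)) :
    Tendsto (fun n => riccatiMatrix A r ℓ (Q n)) F (𝓝 (riccatiMatrix A r ℓ Q₀)) :=
  tendsto_const_nhds.add (hQ.const_smul _)

/-- Coercivity is uniform along a convergent family of matrices. -/
lemma exists_eventually_coercive {M : ι → Mat d} {M₀ : Mat d} (hM : Tendsto M F (𝓝 M₀))
    (h₀ : M₀.PosDef) :
    ∃ ε : ℝ, 0 < ε ∧ (∀ x, ε * ‖x‖ ^ 2 ≤ bil M₀ x x) ∧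
      ∀ᶠ n in F, ∀ x, ε * ‖x‖ ^ 2 ≤ bil (M n) x x := by
  obtain ⟨ε, hε, hc⟩ := exists_coercive h₀
  refine ⟨ε / 2, half_pos hε, fun x => ?_, ?_⟩
  · nlinarith [hc x, sq_nonneg ‖x‖]
  · have h := (continuous_toEuclideanCLM.tendsto M₀).comp hM
    filter_upwards [Metric.tendsto_nhds.1 h (ε / 2) (half_pos hε)] with n hn x
    rw [Function.comp_apply, dist_eq_norm] at hn
    have h1 : |bil (M n) x x - bil M₀ x x| ≤ ε / 2 * ‖x‖ ^ 2 := by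
      rw [bil, bil, ← inner_sub_right, app_eq_toEuclideanCLM, app_eq_toEuclideanCLM,
        ← _root_.sub_apply]
      refine (abs_real_inner_le_norm _ _).trans ?_
      have h2 := (ContinuousLinearMap.le_opNorm (Matrix.toEuclideanCLM (n := Fin d) (𝕜 := ℝ) (M n) -
        Matrix.toEuclideanCLM (n := Fin d) (𝕜 := ℝ) M₀) x).trans
        (mul_le_mul_of_nonneg_right hn.le (norm_nonneg x))
      nlinarith [norm_nonneg x]
    linarith [hc x, (abs_le.1 h1).1]

lemma eventually_posDef {M : ι → Mat d} {M₀ : Mat d} (hM : Tendsto M F (𝓝 M₀)) (h₀ : M₀.PosDef)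
    (hs : ∀ᶠ n in F, (M n).IsSymm) : ∀ᶠ n in F, (M n).PosDef := by
  obtain ⟨ε, hε, _, h⟩ := exists_eventually_coercive hM h₀
  filter_upwards [h, hs] with n hn hsn
  refine posDef_of_bil_pos hsn fun x hx => lt_of_lt_of_le ?_ (hn x)
  have := norm_pos_iff.2 hx
  positivity

lemma eventually_isUnit {M : ι → Mat d} {M₀ : Mat d} (hM : Tendsto M F (𝓝 M₀)) (h₀ : IsUnit M₀) :
    ∀ᶠ n in F, IsUnit (M n) := by
  simp only [Matrix.isUnit_iff_isUnit_det, isUnit_iff_ne_zero] at h₀ ⊢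
  exact ((continuous_id.matrix_det.tendsto M₀).comp hM).eventually_ne h₀

lemma tendsto_of_app_eq {M : ι → Mat d} {M₀ : Mat d} {x y : ι → E d} {x₀ y₀ : E d}
    (hM : Tendsto M F (𝓝 M₀)) (h₀ : IsUnit M₀) (hy : Tendsto y F (𝓝 y₀))
    (hx : ∀ᶠ n in F, app (M n) (x n) = y n) (hx₀ : app M₀ x₀ = y₀) : Tendsto x F (𝓝 x₀) := by
  have hinv : Tendsto (fun n => (M n)⁻¹) F (𝓝 M₀⁻¹) := by
    simp only [Matrix.inv_def, Ring.inverse_eq_inv']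
    refine Tendsto.smul (Tendsto.inv₀ ((continuous_id.matrix_det.tendsto M₀).comp hM) ?_)
      ((continuous_id.matrix_adjugate.tendsto M₀).comp hM)
    exact isUnit_iff_ne_zero.1 ((Matrix.isUnit_iff_isUnit_det _).1 h₀)
  have hcancel : ∀ {N : Mat d} {z : E d}, IsUnit N → app N⁻¹ (app N z) = z := fun {N z} hN => by
    rw [← app_mul, Matrix.nonsing_inv_mul _ ((Matrix.isUnit_iff_isUnit_det _).1 hN), app_one]
  have h := tendsto_app hinv hy
  rw [← hx₀, hcancel h₀] at h
  refine h.congr' ?_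
  filter_upwards [hx, eventually_isUnit hM h₀] with n hn hu
  rw [← hn, hcancel hu]

/-- The positive definite solution of `S² + ℓ S = P` depends continuously on `P`. -/
lemma tendsto_of_mul_self_add_smul {S P : ι → Mat d} {S₀ P₀ : Mat d} {ℓ : ℝ} (hℓ : 0 < ℓ)
    (hP : Tendsto P F (𝓝 P₀)) (h₀ : S₀.PosDef) (h₀' : S₀ * S₀ + ℓ • S₀ = P₀)
    (h : ∀ᶠ n in F, (S n).PosDef ∧ S n * S n + ℓ • S n = P n) : Tendsto S F (𝓝 S₀) := by
  have hPij : ∀ i j, Tendsto (fun n => P n i j) F (𝓝 (P₀ i j)) := fun i j =>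
    (tendsto_pi_nhds.1 (tendsto_pi_nhds.1 hP i)) j
  have hlim : Tendsto (fun n => (∑ i, ∑ j, (P n i j - P₀ i j) ^ 2) / ℓ ^ 2) F (𝓝 0) := by
    have h1 : Tendsto (fun n => (∑ i, ∑ j, (P n i j - P₀ i j) ^ 2) / ℓ ^ 2) F
        (𝓝 ((∑ i, ∑ j, (P₀ i j - P₀ i j) ^ 2) / ℓ ^ 2)) :=
      (tendsto_finsetSum _ fun i _ => tendsto_finsetSum _ fun j _ =>
        ((hPij i j).sub_const _).pow 2).div_const _
    simpa using h1
  refine tendsto_pi_nhds.2 fun i => tendsto_pi_nhds.2 fun j => ?_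
  have hsq : Tendsto (fun n => (S n i j - S₀ i j) ^ 2) F (𝓝 0) := by
    refine tendsto_of_tendsto_of_tendsto_of_le_of_le' tendsto_const_nhds hlim
      (Eventually.of_forall fun n => sq_nonneg _) ?_
    filter_upwards [h] with n hn
    refine le_trans ?_ (sum_sq_sub_le hℓ h₀ hn.1 h₀' hn.2)
    refine le_trans ?_ (Finset.single_le_sum (f := fun i => ∑ j, (S n i j - S₀ i j) ^ 2)
      (fun i _ => Finset.sum_nonneg fun j _ => sq_nonneg _) (Finset.mem_univ i))
    exact Finset.single_le_sum (f := fun j => (S n i j - S₀ i j) ^ 2) (fun j _ => sq_nonneg _)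
      (Finset.mem_univ j)
  have habs := hsq.sqrt
  simp only [Real.sqrt_sq_eq_abs, Real.sqrt_zero] at habs
  exact tendsto_iff_dist_tendsto_zero.2 habs

lemma tendsto_valueConst (A : Mat d) (r k ℓ : ℝ) (H : E d) {Q S : ι → Mat d} {Q₀ S₀ : Mat d}
    {a w : ι → E d} {a₀ w₀ : E d} {κ : ι → ℝ} {κ₀ : ℝ} (hQ : Tendsto Q F (𝓝 Q₀))
    (hS : Tendsto S F (𝓝 S₀)) (ha : Tendsto a F (𝓝 a₀)) (hw : Tendsto w F (𝓝 w₀))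
    (hκ : Tendsto κ F (𝓝 κ₀)) :
    Tendsto (fun n => valueConst A r k ℓ (Q n) (S n) (a n) (w n) H (κ n)) F
      (𝓝 (valueConst A r k ℓ Q₀ S₀ a₀ w₀ H κ₀)) := by
  have htr : Tendsto (fun n => (S n + A).trace) F (𝓝 (S₀ + A).trace) :=
    ((continuous_id.matrix_trace).tendsto _).comp (hS.add_const A)
  exact ((((hκ.add (tendsto_bil hQ tendsto_const_nhds tendsto_const_nhds)).sub
    (hw.inner tendsto_const_nhds)).add (htr.const_mul _)).sub
    (((tendsto_app hS ha).norm.pow 2).const_mul _)).div_const _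

end Coefficients

/-! ### Convergence of Gaussian densities and of quadratic functions -/

section Convergence

variable {d : ℕ} {ι : Type*} {F : Filter ι}

lemma tendsto_gaussian_normalization {S : ι → Mat d} {S₀ : Mat d} (hS : Tendsto S F (𝓝 S₀)) :
    Tendsto (fun n => Real.sqrt ((S n).det / (2 * Real.pi) ^ d)) F
      (𝓝 (Real.sqrt (S₀.det / (2 * Real.pi) ^ d))) :=
  (((continuous_id.matrix_det.tendsto S₀).comp hS).div_const _).sqrt

/-- Uniform coercivity of the precision matrices and bounded means give one Gaussian-type majorant
for dominated convergence. -/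
lemma tendsto_secondMoment_gaussianDensity [F.IsCountablyGenerated] {S : ι → Mat d} {S₀ : Mat d}
    {μ : ι → E d} {μ₀ : E d} (hS : Tendsto S F (𝓝 S₀)) (h₀ : S₀.PosDef)
    (hμ : Tendsto μ F (𝓝 μ₀)) (z : E d) (i j : Fin d) :
    Tendsto (fun n => secondMoment (gaussianDensity (μ n) (S n)) z i j) F
      (𝓝 (secondMoment (gaussianDensity μ₀ S₀) z i j)) := by
  obtain ⟨ε, hε, -, hc⟩ := exists_eventually_coercive hS h₀
  have hs := tendsto_gaussian_normalization hS
  have hsb := hs.eventually_le_const (lt_add_one _)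
  have hμb := hμ.norm.eventually_le_const (lt_add_one _)
  set K := ‖μ₀‖ + 1
  set s := Real.sqrt (S₀.det / (2 * Real.pi) ^ d) + 1
  refine tendsto_integral_filter_of_dominated_convergence
    (fun x => s * Real.exp (ε / 2 * K ^ 2) * (2 * (‖x‖ ^ 2 * Real.exp (-(ε / 4) * ‖x‖ ^ 2)) +
      2 * ‖z‖ ^ 2 * Real.exp (-(ε / 4) * ‖x‖ ^ 2))) ?_ ?_ ?_ ?_
  · refine Eventually.of_forall fun n => Continuous.aestronglyMeasurable ?_
    have := continuous_gaussianDensity (μ n) (S n)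
    fun_prop
  · filter_upwards [hc, hsb, hμb] with n hcn hsn hμn
    refine Eventually.of_forall fun x => ?_
    have h1 := exp_neg_bil_le hε hcn hμn x
    have hi := PiLp.norm_apply_le (x - z) i
    have hj := PiLp.norm_apply_le (x - z) j
    have h3 : ‖x - z‖ ^ 2 ≤ 2 * ‖x‖ ^ 2 + 2 * ‖z‖ ^ 2 := by
      nlinarith [norm_sub_le x z, norm_nonneg (x - z), sq_nonneg (‖x‖ - ‖z‖)]
    have h4 : ‖gaussianDensity (μ n) (S n) x‖ ≤
        s * (Real.exp (ε / 2 * K ^ 2) * Real.exp (-(ε / 4) * ‖x‖ ^ 2)) := by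
      rw [gaussianDensity, Real.norm_eq_abs, abs_of_nonneg (by positivity)]
      exact mul_le_mul hsn h1 (by positivity) ((Real.sqrt_nonneg _).trans hsn)
    rw [norm_mul, norm_mul]
    calc _ ≤ ‖x - z‖ * ‖x - z‖ * _ := by gcongr
      _ ≤ (2 * ‖x‖ ^ 2 + 2 * ‖z‖ ^ 2) *
          (s * (Real.exp (ε / 2 * K ^ 2) * Real.exp (-(ε / 4) * ‖x‖ ^ 2))) := by
        refine mul_le_mul (by rwa [← sq]) h4 (norm_nonneg _) (by positivity)
      _ = _ := by ring
  · exact (((integrable_norm_sq_mul_exp (by positivity)).const_mul 2).add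
      ((integrable_exp_neg_mul_norm_sq (by positivity)).const_mul _)).const_mul _
  · refine Eventually.of_forall fun x => Tendsto.const_mul _ ?_
    exact hs.mul ((Real.continuous_exp.tendsto _).comp
      ((tendsto_bil hS (hμ.const_sub x) (hμ.const_sub x)).div_const 2).neg)

lemma tendsto_mfConst [F.IsCountablyGenerated] {C D S : ι → Mat d} {C₀ D₀ S₀ : Mat d}
    {μ : ι → E d} {μ₀ : E d} (hC : Tendsto C F (𝓝 C₀)) (hD : Tendsto D F (𝓝 D₀))
    (hS : Tendsto S F (𝓝 S₀)) (h₀ : S₀.PosDef) (hμ : Tendsto μ F (𝓝 μ₀)) (z : E d) :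
    Tendsto (fun n => mfConst (C n) (D n) z (S n) (μ n)) F (𝓝 (mfConst C₀ D₀ z S₀ μ₀)) := by
  refine Tendsto.add (tendsto_finsetSum _ fun i _ => tendsto_finsetSum _ fun j _ => ?_)
    (tendsto_bil hD (hμ.sub_const z) (hμ.sub_const z))
  exact ((tendsto_pi_nhds.1 (tendsto_pi_nhds.1 hC i)) j).mul
    (tendsto_secondMoment_gaussianDensity hS h₀ hμ z i j)

/-- The derivatives of a smooth family of functions depend on the parameter locally uniformly. -/
lemma tendstoLocallyUniformly_iteratedFDeriv {P : Type*} [NormedAddCommGroup P] [NormedSpace ℝ P]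
    {f : P × E d → ℝ} (hf : ContDiff ℝ (⊤ : ℕ∞) f) {p : ι → P} {p₀ : P} (hp : Tendsto p F (𝓝 p₀))
    (j : ℕ) :
    TendstoLocallyUniformly (fun n => iteratedFDeriv ℝ j fun x => f (p n, x))
      (iteratedFDeriv ℝ j fun x => f (p₀, x)) F := by
  -- The derivative in `x` alone is the full derivative restricted to the second factor, hence
  -- jointly continuous in parameter and point.
  have heq : ∀ q x, iteratedFDeriv ℝ j (fun x => f (q, x)) x =
      (iteratedFDeriv ℝ j f (q, x)).compContinuousLinearMap
        fun _ => ContinuousLinearMap.inr ℝ P (E d) := fun q x => by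
    have h1 : (fun x => f (q, x)) =
        (fun y => f ((q, 0) + y)) ∘ ContinuousLinearMap.inr ℝ P (E d) := by
      funext x
      simp
    have h2 : ContDiff ℝ (⊤ : ℕ∞) fun y => f ((q, 0) + y) :=
      hf.comp (contDiff_const.add contDiff_id)
    rw [h1, ContinuousLinearMap.iteratedFDeriv_comp_right _ h2 x (by exact_mod_cast le_top),
      iteratedFDeriv_comp_add_left]
    simp
  have hcont : Continuous fun z : P × E d => iteratedFDeriv ℝ j (fun x => f (z.1, x)) z.2 := by
    simp only [heq]
    exact (ContinuousMultilinearMap.compContinuousLinearMapL (𝕜 := ℝ) (F := ℝ)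
      fun _ : Fin j => ContinuousLinearMap.inr ℝ P (E d)).continuous.comp
      (hf.continuous_iteratedFDeriv (by exact_mod_cast le_top))
  -- Currying yields a map that is continuous for the compact-open topology, where convergence means
  -- locally uniform convergence.
  have h := ((ContinuousMap.curry ⟨_, hcont⟩).continuous.tendsto p₀).comp hp
  exact ContinuousMap.tendsto_iff_tendstoLocallyUniformly.1 h

lemma tendstoLocallyUniformly_iteratedFDeriv_quadratic {L : ι → Mat d} {L₀ : Mat d} {ρ : ι → E d}
    {ρ₀ : E d} {c : ι → ℝ} {c₀ : ℝ} (hL : Tendsto L F (𝓝 L₀)) (hρ : Tendsto ρ F (𝓝 ρ₀))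
    (hc : Tendsto c F (𝓝 c₀)) (j : ℕ) :
    TendstoLocallyUniformly (fun n => iteratedFDeriv ℝ j (quadratic (L n) (ρ n) (c n)))
      (iteratedFDeriv ℝ j (quadratic L₀ ρ₀ c₀)) F := by
  have hf : ContDiff ℝ (⊤ : ℕ∞) fun z : ((E d →L[ℝ] E d) × E d × ℝ) × E d =>
      inner ℝ z.2 (z.1.1 z.2) / 2 + inner ℝ z.1.2.1 z.2 + z.1.2.2 := by
    refine ContDiff.add (ContDiff.add (ContDiff.div_const (ContDiff.inner ℝ contDiff_snd
      (ContDiff.clm_apply (by fun_prop) contDiff_snd)) 2) (ContDiff.inner ℝ ?_ contDiff_snd)) ?_ <;>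
    fun_prop
  exact tendstoLocallyUniformly_iteratedFDeriv hf
    (((continuous_toEuclideanCLM.tendsto L₀).comp hL).prodMk_nhds (hρ.prodMk_nhds hc)) j

lemma tendstoLocallyUniformly_iteratedFDeriv_gaussianDensity {S : ι → Mat d} {S₀ : Mat d}
    {μ : ι → E d} {μ₀ : E d} (hS : Tendsto S F (𝓝 S₀)) (hμ : Tendsto μ F (𝓝 μ₀)) (j : ℕ) :
    TendstoLocallyUniformly (fun n => iteratedFDeriv ℝ j (gaussianDensity (μ n) (S n)))
      (iteratedFDeriv ℝ j (gaussianDensity μ₀ S₀)) F := by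
  -- The normalising constant is a separate parameter: the square root of a determinant is not a
  -- smooth function of every matrix.
  have hf : ContDiff ℝ (⊤ : ℕ∞) fun z : ((E d →L[ℝ] E d) × E d × ℝ) × E d =>
      z.1.2.2 * Real.exp (-(inner ℝ (z.2 - z.1.2.1) (z.1.1 (z.2 - z.1.2.1)) / 2)) := by
    refine ContDiff.mul (by fun_prop) (ContDiff.exp (ContDiff.neg (ContDiff.div_const
      (ContDiff.inner ℝ ?_ (ContDiff.clm_apply ?_ ?_)) 2))) <;>
    fun_prop
  exact tendstoLocallyUniformly_iteratedFDeriv hf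
    (((continuous_toEuclideanCLM.tendsto S₀).comp hS).prodMk_nhds
      (hμ.prodMk_nhds (tendsto_gaussian_normalization hS))) j

/-- The bilinear form `xᵀ M y`, as a continuous bilinear map. -/
def bilCLM (M : Mat d) : E d →L[ℝ] E d →L[ℝ] ℝ :=
  LinearMap.mkContinuous₂
    ((innerₗ (E d)).compl₂ (Matrix.toEuclideanCLM (n := Fin d) (𝕜 := ℝ) M).toLinearMap)
    ‖Matrix.toEuclideanCLM (n := Fin d) (𝕜 := ℝ) M‖ fun x y => by
      refine (norm_inner_le_norm x (Matrix.toEuclideanCLM (n := Fin d) (𝕜 := ℝ) M y)).trans ?_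
      rw [mul_comm _ ‖x‖, mul_assoc]
      exact mul_le_mul_of_nonneg_left (ContinuousLinearMap.le_opNorm _ _) (norm_nonneg _)

lemma bilCLM_apply (M : Mat d) (x y : E d) : bilCLM M x y = bil M x y := rfl

lemma norm_bilCLM_le (M : Mat d) :
    ‖bilCLM M‖ ≤ ‖Matrix.toEuclideanCLM (n := Fin d) (𝕜 := ℝ) M‖ :=
  LinearMap.mkContinuous₂_norm_le _ (norm_nonneg _) _

lemma fderiv_quadratic {L : Mat d} (hL : L.IsSymm) (ρ : E d) (c : ℝ) :
    fderiv ℝ (quadratic L ρ c) = fun x => bilCLM L x + innerSL ℝ ρ := by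
  funext x
  refine (hasGradientAt_quadratic hL ρ c x).hasFDerivAt.fderiv.trans ?_
  ext y
  simp only [InnerProductSpace.toDual_apply_apply, _root_.add_apply, bilCLM_apply, bil,
    innerSL_apply_apply, inner_add_left, inner_app_of_isSymm hL]

lemma fderiv_fderiv_quadratic {L : Mat d} (hL : L.IsSymm) (ρ : E d) (c : ℝ) :
    fderiv ℝ (fderiv ℝ (quadratic L ρ c)) = fun _ => bilCLM L := by
  funext x
  rw [fderiv_quadratic hL]
  exact ((bilCLM L).hasFDerivAt.add_const _).fderiv

/-- The first derivative grows linearly, the second is constant and the others vanish. The power `i`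
puts the bound in the form required by the estimate for derivatives of a composition. -/
lemma norm_iteratedFDeriv_quadratic_le {L : Mat d} (hL : L.IsSymm) {ρ : E d} (c : ℝ) {K : ℝ}
    (hLK : ‖Matrix.toEuclideanCLM (n := Fin d) (𝕜 := ℝ) L‖ ≤ K) (hρ : ‖ρ‖ ≤ K) {i : ℕ}
    (hi : 1 ≤ i) (x : E d) :
    ‖iteratedFDeriv ℝ i (quadratic L ρ c) x‖ ≤ (1 + 2 * K + K * ‖x‖) ^ i := by
  have hK : 0 ≤ K := (norm_nonneg _).trans hρ
  have hb : ‖bilCLM L‖ ≤ K := (norm_bilCLM_le L).trans hLK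
  have h1 : 1 ≤ 1 + 2 * K + K * ‖x‖ := by nlinarith [norm_nonneg x]
  refine le_trans ?_ (le_self_pow₀ h1 (by omega))
  obtain ⟨i, rfl⟩ : ∃ j, i = j + 1 := ⟨i - 1, by omega⟩
  rw [← norm_iteratedFDeriv_fderiv]
  rcases i with _ | i
  · rw [norm_iteratedFDeriv_zero, fderiv_quadratic hL]
    refine (norm_add_le _ _).trans ?_
    rw [innerSL_apply_norm]
    have := ((bilCLM L).le_opNorm x).trans (mul_le_mul_of_nonneg_right hb (norm_nonneg x))
    linarith
  · rw [← norm_iteratedFDeriv_fderiv, fderiv_fderiv_quadratic hL]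
    rcases i with _ | i
    · rw [norm_iteratedFDeriv_zero]
      nlinarith [norm_nonneg x]
    · rw [iteratedFDeriv_succ_const, Pi.zero_apply, norm_zero]
      linarith

/-- The second derivative of a quadratic function does not depend on the point, so convergence at
the origin is already uniform. -/
lemma convergesValue_quadratic {L : ℕ → Mat d} {L₀ : Mat d} {ρ : ℕ → E d} {ρ₀ : E d} {c : ℕ → ℝ}
    {c₀ : ℝ} (hL : Tendsto L atTop (𝓝 L₀)) (hρ : Tendsto ρ atTop (𝓝 ρ₀))
    (hc : Tendsto c atTop (𝓝 c₀)) (hLs : ∀ n, (L n).IsSymm) (hL₀ : L₀.IsSymm) :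
    ConvergesValue (fun n => quadratic (L n) (ρ n) (c n)) (quadratic L₀ ρ₀ c₀) := by
  have hloc := tendstoLocallyUniformly_iteratedFDeriv_quadratic hL hρ hc
  refine ⟨fun j _ => hloc j, ?_⟩
  have hconst : ∀ {M : Mat d} {τ : E d} {e : ℝ} (x : E d), M.IsSymm →
      iteratedFDeriv ℝ 2 (quadratic M τ e) x = iteratedFDeriv ℝ 2 (quadratic M τ e) 0 :=
    fun {M τ e} x hM => by
      ext u
      rw [iteratedFDeriv_two_apply, iteratedFDeriv_two_apply, fderiv_fderiv_quadratic hM]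
  rw [Metric.tendstoUniformly_iff]
  intro ε hε
  obtain ⟨t, ht, h⟩ := Metric.tendstoLocallyUniformly_iff.1 (hloc 2) ε hε 0
  filter_upwards [h] with n hn x
  rw [hconst x (hLs n), hconst x hL₀]
  exact hn 0 (mem_of_mem_nhds ht)

lemma neg_bil_sub_div_two {S : Mat d} (hS : S.IsSymm) (μ x : E d) :
    -(bil S (x - μ) (x - μ) / 2) = quadratic (-S) (app S μ) (-(bil S μ μ / 2)) x := by
  have h1 : app (-S) x = -app S x := by
    rw [← neg_one_smul ℝ S, app_smul_left, neg_one_smul]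
  have h2 : inner ℝ (app S μ) x = inner ℝ μ (app S x) := inner_app_of_isSymm hS μ x
  have h3 : inner ℝ x (app S μ) = inner ℝ μ (app S x) := by rw [real_inner_comm, h2]
  simp only [quadratic, bil, h1, app_sub_right, inner_sub_left, inner_sub_right, inner_neg_right,
    h2, h3]
  ring

/-- All the derivatives of Gaussian densities decay, locally uniformly in the parameters. -/
lemma norm_iteratedFDeriv_gaussianDensity_le {S : Mat d} (hS : S.IsSymm) {ε : ℝ} (hε : 0 < ε)
    (hc : ∀ x : E d, ε * ‖x‖ ^ 2 ≤ bil S x x) {μ : E d} {K : ℝ}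
    (hs : Real.sqrt (S.det / (2 * Real.pi) ^ d) ≤ K)
    (hSK : ‖Matrix.toEuclideanCLM (n := Fin d) (𝕜 := ℝ) S‖ ≤ K) (hμ : ‖μ‖ ≤ K)
    (hSμ : ‖app S μ‖ ≤ K) (j : ℕ) (x : E d) :
    ‖iteratedFDeriv ℝ j (gaussianDensity μ S) x‖ ≤ K * (j.factorial *
      (Real.exp (ε / 2 * K ^ 2) * Real.exp (-(ε / 4) * ‖x‖ ^ 2)) *
        (1 + 2 * K + K * ‖x‖) ^ j) := by
  set q := quadratic (-S) (app S μ) (-(bil S μ μ / 2)) with hq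
  have hqx : ∀ y, -(bil S (y - μ) (y - μ) / 2) = q y := neg_bil_sub_div_two hS μ
  have hfun : gaussianDensity μ S =
      Real.sqrt (S.det / (2 * Real.pi) ^ d) • (Real.exp ∘ q) := by
    funext y
    simp [gaussianDensity, hqx]
  have hcd : ContDiff ℝ (⊤ : ℕ∞) q := contDiff_quadratic _ _ _
  rw [hfun, iteratedFDeriv_const_smul_apply
    ((Real.contDiff_exp.comp (hcd.of_le (by exact_mod_cast le_top))).contDiffAt), norm_smul,
    Real.norm_eq_abs, abs_of_nonneg (Real.sqrt_nonneg _)]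
  refine mul_le_mul hs ?_ (norm_nonneg _) ((Real.sqrt_nonneg _).trans hs)
  -- All derivatives of exp at q(x) equal exp(q(x)), which decays like a Gaussian; those of `q`
  -- contribute a polynomial factor.
  refine norm_iteratedFDeriv_comp_le (N := (⊤ : ℕ∞)) Real.contDiff_exp hcd
    (by exact_mod_cast le_top) x (fun i _ => ?_) fun i hi _ => ?_
  · rw [norm_iteratedFDeriv_eq_norm_iteratedDeriv, iteratedDeriv_eq_iterate, Real.iter_deriv_exp,
      Real.norm_eq_abs, Real.abs_exp, ← hqx]
    exact exp_neg_bil_le hε hc hμ x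
  · exact norm_iteratedFDeriv_quadratic_le hS.neg _ (by rwa [map_neg, norm_neg]) hSμ hi x

/-- Since t ≤ ct² + 1/(4c), the Gaussian factor is at most a constant times exp(-t), which beats
every polynomial. -/
lemma tendsto_pow_mul_exp_neg_sq {c : ℝ} (hc : 0 < c) (a b : ℝ) (ha : 0 ≤ a) (hb : 0 ≤ b) (j : ℕ) :
    Tendsto (fun t : ℝ => (a + b * t) ^ j * Real.exp (-c * t ^ 2)) atTop (𝓝 0) := by
  have h := (Polynomial.tendsto_div_exp_atTop
    ((Polynomial.C a + Polynomial.C b * Polynomial.X) ^ j)).mul_const (Real.exp (1 / (4 * c)))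
  rw [zero_mul] at h
  refine squeeze_zero' ?_ ?_ h
  · filter_upwards [eventually_ge_atTop 0] with t ht
    positivity
  · filter_upwards [eventually_ge_atTop 0] with t ht
    simp only [Polynomial.eval_pow, Polynomial.eval_add, Polynomial.eval_mul, Polynomial.eval_C,
      Polynomial.eval_X]
    rw [div_mul_eq_mul_div, mul_div_assoc, ← Real.exp_sub]
    refine mul_le_mul_of_nonneg_left (Real.exp_le_exp.2 ?_) (by positivity)
    have h1 : 1 / (4 * c) - t + c * t ^ 2 = (2 * c * t - 1) ^ 2 / (4 * c) := by
      field_simp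
      ring
    have h2 : 0 ≤ (2 * c * t - 1) ^ 2 / (4 * c) := by positivity
    linarith

/-- On a large ball locally uniform convergence applies; outside it, both derivatives are small by a
decay bound uniform along the family. -/
lemma tendstoUniformly_iteratedFDeriv_gaussianDensity {S : ι → Mat d} {S₀ : Mat d}
    {μ : ι → E d} {μ₀ : E d} (hS : Tendsto S F (𝓝 S₀)) (hμ : Tendsto μ F (𝓝 μ₀))
    (h₀ : S₀.PosDef) (hSs : ∀ n, (S n).IsSymm) (j : ℕ) :
    TendstoUniformly (fun n => iteratedFDeriv ℝ j (gaussianDensity (μ n) (S n)))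
      (iteratedFDeriv ℝ j (gaussianDensity μ₀ S₀)) F := by
  obtain ⟨ε, hε, hc₀, hc⟩ := exists_eventually_coercive hS h₀
  have hloc := tendstoLocallyUniformly_iff_forall_isCompact.1
    (tendstoLocallyUniformly_iteratedFDeriv_gaussianDensity hS hμ j)
  have hs := tendsto_gaussian_normalization hS
  have hT := ((continuous_toEuclideanCLM.tendsto S₀).comp hS).norm
  have hSμ := (tendsto_app hS hμ).norm
  -- One constant strictly above all four limits, hence eventually above the four quantities
  -- themselves.
  set K := 1 + (Real.sqrt (S₀.det / (2 * Real.pi) ^ d) +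
    ‖Matrix.toEuclideanCLM (n := Fin d) (𝕜 := ℝ) S₀‖ + ‖μ₀‖ + ‖app S₀ μ₀‖) with hK
  have n1 := Real.sqrt_nonneg (S₀.det / (2 * Real.pi) ^ d)
  have n2 := norm_nonneg (Matrix.toEuclideanCLM (n := Fin d) (𝕜 := ℝ) S₀)
  have n3 := norm_nonneg μ₀
  have n4 := norm_nonneg (app S₀ μ₀)
  have k1 : Real.sqrt (S₀.det / (2 * Real.pi) ^ d) < K := by linarith
  have k2 : ‖Matrix.toEuclideanCLM (n := Fin d) (𝕜 := ℝ) S₀‖ < K := by linarith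
  have k3 : ‖μ₀‖ < K := by linarith
  have k4 : ‖app S₀ μ₀‖ < K := by linarith
  have hK0 : 0 ≤ K := n3.trans k3.le
  set h : ℝ → ℝ := fun t => K * (j.factorial * (Real.exp (ε / 2 * K ^ 2) *
    Real.exp (-(ε / 4) * t ^ 2)) * (1 + 2 * K + K * t) ^ j) with hh
  have hlim : Tendsto h atTop (𝓝 0) := by
    have h1 := (tendsto_pow_mul_exp_neg_sq (c := ε / 4) (by positivity) (1 + 2 * K) K
      (by positivity) hK0 j).const_mul (K * j.factorial * Real.exp (ε / 2 * K ^ 2))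
    rw [mul_zero] at h1
    refine h1.congr fun t => ?_
    simp only [hh]
    ring
  rw [Metric.tendstoUniformly_iff]
  intro δ hδ
  obtain ⟨R, hR⟩ := eventually_atTop.1 (hlim.eventually_lt_const (half_pos hδ))
  have hball := Metric.tendstoUniformlyOn_iff.1 (hloc _ (isCompact_closedBall (0 : E d) R)) δ hδ
  filter_upwards [hball, hc, hs.eventually_le_const k1, hT.eventually_le_const k2,
    hμ.norm.eventually_le_const k3, hSμ.eventually_le_const k4] with n hn hcn hsn hTn hμn hSμn x
  by_cases hx : ‖x‖ ≤ R
  · exact hn x (by simpa using hx)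
  · have hxR := hR ‖x‖ (not_le.1 hx).le
    have e1 := norm_iteratedFDeriv_gaussianDensity_le (hSs n) hε hcn hsn hTn hμn hSμn j x
    have e2 := norm_iteratedFDeriv_gaussianDensity_le (isSymm_of_posDef h₀) hε hc₀ k1.le k2.le
      k3.le k4.le j x
    rw [dist_eq_norm]
    refine (norm_sub_le _ _).trans_lt ?_
    have e3 : h ‖x‖ < δ / 2 := hxR
    simp only [hh] at e3
    linarith

lemma convergesDensity_gaussianDensity {S : ℕ → Mat d} {S₀ : Mat d} {μ : ℕ → E d} {μ₀ : E d}
    (hS : Tendsto S atTop (𝓝 S₀)) (hμ : Tendsto μ atTop (𝓝 μ₀)) (h₀ : S₀.PosDef)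
    (hSs : ∀ n, (S n).IsSymm) :
    ConvergesDensity (fun n => gaussianDensity (μ n) (S n)) (gaussianDensity μ₀ S₀) :=
  fun _ j _ => tendstoUniformly_iteratedFDeriv_gaussianDensity hS hμ h₀ hSs j

lemma ConvergesValue.congr {w w' : ℕ → E d → ℝ} {v : E d → ℝ} (h : ConvergesValue w v)
    (hw : ∀ᶠ n in atTop, w n = w' n) : ConvergesValue w' v := by
  refine ⟨fun j hj u hu x => ?_, fun u hu => ?_⟩
  · obtain ⟨t, ht, h'⟩ := h.1 j hj u hu x
    refine ⟨t, ht, ?_⟩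
    filter_upwards [h', hw] with n hn hwn
    rwa [← hwn]
  · filter_upwards [h.2 u hu, hw] with n hn hwn
    rwa [← hwn]

lemma ConvergesDensity.congr {p p' : ℕ → E d → ℝ} {m : E d → ℝ} (h : ConvergesDensity p m)
    (hp : ∀ᶠ n in atTop, p n = p' n) : ConvergesDensity p' m := by
  intro n j hj u hu
  filter_upwards [h n j hj u hu, hp] with N hN hpN
  rwa [← hpN]

end Convergence

/-! ### Large numbers of players -/

section ManyPlayers

variable {d : ℕ}

/-- The number of ordered pairs of opponents is asymptotic to (N - 1)². -/
lemma tendsto_smul_of_sq_smul {D : ℕ → Mat d} {D₀ : Mat d}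
    (hD : Tendsto (fun N : ℕ => ((N : ℝ) - 1) ^ 2 • D N) atTop (𝓝 D₀)) :
    Tendsto (fun N : ℕ => (((N : ℝ) - 1) * ((N : ℝ) - 2)) • D N) atTop (𝓝 D₀) := by
  have h1 : Tendsto (fun N : ℕ => (N : ℝ) - 1) atTop atTop :=
    tendsto_atTop_add_const_right _ _ tendsto_natCast_atTop_atTop
  have h2 : Tendsto (fun N : ℕ => 1 - ((N : ℝ) - 1)⁻¹) atTop (𝓝 1) := by
    simpa using (tendsto_inv_atTop_zero.comp h1).const_sub (1 : ℝ)
  have h3 := h2.smul hD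
  rw [one_smul] at h3
  refine h3.congr' ?_
  filter_upwards [eventually_ge_atTop 2] with N hN
  have h4 : (2 : ℝ) ≤ N := by exact_mod_cast hN
  have h5 : (N : ℝ) - 1 ≠ 0 := by linarith
  rw [smul_smul]
  congr 1
  field_simp
  ring

/-- Existence, uniqueness and convergence of the Quadratic-Gaussian solutions of the games. -/
theorem convergence_of_games {A Qh Bh Ch Dh : Mat d} {r k ℓ : ℝ} (hr : 0 < r) (hk : 0 < k)
    (hℓ : 0 < ℓ) (hA : A.IsSymm) (hQh : Qh.IsSymm) (hB : Bh.IsSymm)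
    (hPd : (riccatiMatrix A r ℓ Qh).PosDef) {H Δ₀ : E d}
    (hunit : IsUnit (limitMatrix A r ℓ Qh Bh)) (G : (N : ℕ) → LQGame d N) (Q B : ℕ → Mat d)
    (C D : ℕ → ℕ → Mat d)
    (hG : ∀ N, 1 ≤ N → (G N).A = A ∧ (G N).H1 ∧
      (G N).H2 (Q N) (B N) (fun i => C N i) (fun i => D N i) H Δ₀)
    (hQ : Tendsto Q atTop (𝓝 Qh))
    (hBN : Tendsto (fun N : ℕ => ((N : ℝ) - 1) • B N) atTop (𝓝 Bh))
    (hC : ∀ i, Tendsto (fun N : ℕ => ((N : ℝ) - 1) • C N i) atTop (𝓝 Ch))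
    (hD : ∀ i, Tendsto (fun N : ℕ => ((N : ℝ) - 1) ^ 2 • D N i) atTop (𝓝 Dh)) :
    (∀ᶠ N in atTop, ∃! p : (Fin N → E d → ℝ) × (Fin N → E d → ℝ),
      (G N).IsSolution r k ℓ p.1 p.2 ∧ IsQGProfile p.1 p.2) ∧
    ∃ v m : E d → ℝ, IsMFSolution A r k ℓ Qh Bh Ch Dh H Δ₀ v m ∧ IsQG v m ∧
      ∀ vN mN : ℕ → ℕ → E d → ℝ,
        (∀ᶠ N in atTop, (G N).IsSolution r k ℓ (fun i => vN N i) (fun i => mN N i) ∧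
          IsQGProfile (N := N) (fun i => vN N i) (fun i => mN N i)) →
        ∀ i : ℕ, ConvergesValue (fun N => vN N i) v ∧ ConvergesDensity (fun N => mN N i) m := by
  have hP := tendsto_riccatiMatrix A r ℓ hQ
  have hM : IsUnit (r • riccatiMatrix A r ℓ Qh + Bh) := (isUnit_limitMatrix_iff A hr ℓ Qh Bh).1 hunit
  have hMN : Tendsto (fun N : ℕ => r • riccatiMatrix A r ℓ (Q N) + ((N : ℝ) - 1) • B N) atTop
      (𝓝 (r • riccatiMatrix A r ℓ Qh + Bh)) := (hP.const_smul r).add hBN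
  have hy : Tendsto (fun N : ℕ => (2 : ℝ) • app (Q N) H + app (((N : ℝ) - 1) • B N) Δ₀) atTop
      (𝓝 ((2 : ℝ) • app Qh H + app Bh Δ₀)) :=
    ((tendsto_app hQ tendsto_const_nhds).const_smul _).add (tendsto_app hBN tendsto_const_nhds)
  have hunitN := eventually_isUnit hMN hM
  have hPN : ∀ᶠ N in atTop, (riccatiMatrix A r ℓ (Q N)).PosDef := by
    refine eventually_posDef hP hPd ?_
    filter_upwards [eventually_ge_atTop 1] with N hN
    exact isSymm_riccatiMatrix hA (isSymm_of_posDef (hG N hN).2.2.Q_posDef) r ℓ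
  obtain ⟨S₀, hS₀, hSP₀⟩ := exists_posDef_solution hPd ℓ
  obtain ⟨μ₀, hμ₀⟩ := exists_app_eq hM ((2 : ℝ) • app Qh H + app Bh Δ₀)
  -- For the exceptional `N` the default is the identity, so that `S N` is positive definite, and in
  -- particular symmetric, for every `N`.
  have hS : ∀ N, ∃ S : Mat d, S.PosDef ∧
      ((riccatiMatrix A r ℓ (Q N)).PosDef → S * S + ℓ • S = riccatiMatrix A r ℓ (Q N)) :=
    fun N => by
      by_cases h : (riccatiMatrix A r ℓ (Q N)).PosDef
      · obtain ⟨S, h1, h2⟩ := exists_posDef_solution h ℓ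
        exact ⟨S, h1, fun _ => h2⟩
      · exact ⟨1, Matrix.PosDef.one, fun h' => absurd h' h⟩
  choose S hSd hSP using hS
  have hμ : ∀ N : ℕ, ∃ μ : E d, IsUnit (r • riccatiMatrix A r ℓ (Q N) + ((N : ℝ) - 1) • B N) →
      app (r • riccatiMatrix A r ℓ (Q N) + ((N : ℝ) - 1) • B N) μ =
        (2 : ℝ) • app (Q N) H + app (((N : ℝ) - 1) • B N) Δ₀ := fun N => by
    by_cases h : IsUnit (r • riccatiMatrix A r ℓ (Q N) + ((N : ℝ) - 1) • B N)
    · obtain ⟨μ, h1⟩ := exists_app_eq h ((2 : ℝ) • app (Q N) H + app (((N : ℝ) - 1) • B N) Δ₀)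
      exact ⟨μ, fun _ => h1⟩
    · exact ⟨0, fun h' => absurd h' h⟩
  choose μ hμ using hμ
  have hStend : Tendsto S atTop (𝓝 S₀) :=
    tendsto_of_mul_self_add_smul hℓ hP hS₀ hSP₀ (hPN.mono fun N hN => ⟨hSd N, hSP N hN⟩)
  have hμtend : Tendsto μ atTop (𝓝 μ₀) := tendsto_of_app_eq hMN hM hy (hunitN.mono hμ) hμ₀
  have hkS₀ : (k⁻¹ • S₀).PosDef := hS₀.smul (inv_pos.2 hk)
  have hkS := hStend.const_smul k⁻¹
  set V : ℕ → ℕ → E d → ℝ := fun N i => qgValue A r k ℓ (Q N) (S N)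
    (app (((N : ℝ) - 1) • B N) (μ N - Δ₀)) H (mfConst (((N : ℝ) - 1) • C N i)
      ((((N : ℝ) - 1) * ((N : ℝ) - 2)) • D N i) Δ₀ (k⁻¹ • S N) (μ N)) (μ N) with hV
  -- For large `N` the linear system has the single solution `μ N`, so the Quadratic-Gaussian
  -- solution is this explicit one; existence, uniqueness and convergence are all read off from it.
  have hiff : ∀ᶠ N : ℕ in atTop, ∀ v m : Fin N → E d → ℝ,
      ((G N).IsSolution r k ℓ v m ∧ IsQGProfile v m) ↔
        ∀ i, v i = V N i ∧ m i = gaussianDensity (μ N) (k⁻¹ • S N) := by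
    filter_upwards [hunitN, hPN, eventually_ge_atTop 1] with N hu hp hN v m
    rw [LQGame.isSolution_and_isQGProfile_iff hN (hG N hN).1 (hG N hN).2.1 (hG N hN).2.2 hr hk hℓ hA
      hp (hSd N) (hSP N hp)]
    constructor
    · rintro ⟨μ', hμ', h⟩
      obtain rfl : μ' = μ N := app_injective hu (hμ'.trans (hμ N hu).symm)
      exact h
    · exact fun h => ⟨μ N, hμ N hu, h⟩
  refine ⟨?_, qgValue A r k ℓ Qh S₀ (app Bh (μ₀ - Δ₀)) H (mfConst Ch Dh Δ₀ (k⁻¹ • S₀) μ₀) μ₀,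
    gaussianDensity μ₀ (k⁻¹ • S₀), ?_, isQG_qgValue hA hS₀ hk ℓ _ H _ μ₀, ?_⟩
  · filter_upwards [hiff] with N hN
    refine ⟨(fun i => V N i, fun _ => gaussianDensity (μ N) (k⁻¹ • S N)),
      (hN _ _).2 fun i => ⟨rfl, rfl⟩, ?_⟩
    rintro ⟨v, m⟩ h
    have h' := (hN v m).1 h
    exact Prod.ext (funext fun i => (h' i).1) (funext fun i => (h' i).2)
  · exact (isMFSolution_iff hr hk hℓ hA hQh hB hPd hS₀ hSP₀).2 ⟨μ₀, hμ₀, rfl, rfl⟩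
  · intro vN mN hsol i
    have heq : ∀ᶠ N in atTop, V N i = vN N i ∧
        gaussianDensity (μ N) (k⁻¹ • S N) = mN N i := by
      -- Player `i` takes part in the game only when `N > i`.
      filter_upwards [hiff, hsol, eventually_gt_atTop i] with N hN hs hi
      have h := (hN _ _).1 hs ⟨i, hi⟩
      exact ⟨h.1.symm, h.2.symm⟩
    refine ⟨ConvergesValue.congr ?_ (heq.mono fun N h => h.1),
      ConvergesDensity.congr ?_ (heq.mono fun N h => h.2)⟩
    · have hw : Tendsto (fun N : ℕ => app (((N : ℝ) - 1) • B N) (μ N - Δ₀)) atTop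
          (𝓝 (app Bh (μ₀ - Δ₀))) := tendsto_app hBN (hμtend.sub_const Δ₀)
      exact convergesValue_quadratic ((hStend.add_const A).const_smul r)
        ((tendsto_app hStend hμtend).const_smul r).neg
        (tendsto_valueConst A r k ℓ H hQ hStend hμtend hw
          (tendsto_mfConst (hC i) (tendsto_smul_of_sq_smul (hD i)) hkS hkS₀ hμtend Δ₀))
        (fun N => ((isSymm_of_posDef (hSd N)).add hA).smul r)
        (((isSymm_of_posDef hS₀).add hA).smul r)
    · exact convergesDensity_gaussianDensity hkS hμtend hkS₀
        fun N => (isSymm_of_posDef (hSd N)).smul _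

end ManyPlayers

end LQMFG

end

/-! ### The main theorem. -/

theorem mainTheorem2 (d : ℕ) (r k : ℝ) (hr : 0 < r) (hk : 0 < k)
    (A : LQMFG.Mat d) (hA : A.IsSymm)
    (Qh Bh Ch Dh : LQMFG.Mat d) (hQ : Qh.PosDef) (hB : Bh.IsSymm)
    (H Δ₀ : LQMFG.E d) :
    ∃ ℓh : ℝ, 0 < ℓh ∧
      -- (a) solutions of the mean field system
      (∀ ℓ : ℝ, 0 < ℓ → ℓ < ℓh →
        ((∃! p : (LQMFG.E d → ℝ) × (LQMFG.E d → ℝ),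
            LQMFG.IsMFSolution A r k ℓ Qh Bh Ch Dh H Δ₀ p.1 p.2 ∧ LQMFG.IsQG p.1 p.2) ↔
          IsUnit (LQMFG.limitMatrix A r ℓ Qh Bh))) ∧
      -- (b) uniqueness among all solutions with the same value at the origin
      (∀ ℓ : ℝ, 0 < ℓ → ℓ < ℓh → Bh.PosSemidef →
        ∃ v m : LQMFG.E d → ℝ,
          LQMFG.IsMFSolution A r k ℓ Qh Bh Ch Dh H Δ₀ v m ∧ LQMFG.IsQG v m ∧
          ∀ v' m' : LQMFG.E d → ℝ,
            LQMFG.IsMFSolution A r k ℓ Qh Bh Ch Dh H Δ₀ v' m' → v' 0 = v 0 →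
              v' = v ∧ m' = m) ∧
      -- (c) convergence as the number of players tends to infinity
      (∀ ℓ : ℝ, 0 < ℓ → ℓ < ℓh →
        ∀ (σ : LQMFG.Mat d) (G : (N : ℕ) → LQMFG.LQGame d N)
          (Q B : ℕ → LQMFG.Mat d) (C D : ℕ → ℕ → LQMFG.Mat d),
          (∀ N, 1 ≤ N → (G N).A = A ∧ (G N).σ = σ ∧ (G N).H1 ∧
            (G N).H2 (Q N) (B N) (fun i => C N i) (fun i => D N i) H Δ₀ ∧ (G N).H3 r k) →
          Tendsto Q atTop (𝓝 Qh) →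
          Tendsto (fun N : ℕ => ((N : ℝ) - 1) • B N) atTop (𝓝 Bh) →
          (∀ i, Tendsto (fun N : ℕ => ((N : ℝ) - 1) • C N i) atTop (𝓝 Ch)) →
          (∀ i, Tendsto (fun N : ℕ => ((N : ℝ) - 1) ^ 2 • D N i) atTop (𝓝 Dh)) →
          (∃! p : (LQMFG.E d → ℝ) × (LQMFG.E d → ℝ),
            LQMFG.IsMFSolution A r k ℓ Qh Bh Ch Dh H Δ₀ p.1 p.2 ∧ LQMFG.IsQG p.1 p.2) →
          (∀ᶠ N in atTop,
            ∃! p : (Fin N → LQMFG.E d → ℝ) × (Fin N → LQMFG.E d → ℝ),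
              (G N).IsSolution r k ℓ p.1 p.2 ∧ LQMFG.IsQGProfile p.1 p.2) ∧
          ∃ v m : LQMFG.E d → ℝ,
            LQMFG.IsMFSolution A r k ℓ Qh Bh Ch Dh H Δ₀ v m ∧ LQMFG.IsQG v m ∧
            -- `vN N i`, `mN N i` matter for the players `i < N` only
            ∀ vN mN : ℕ → ℕ → LQMFG.E d → ℝ,
              (∀ᶠ N in atTop,
                (G N).IsSolution r k ℓ (fun i => vN N i) (fun i => mN N i) ∧
                LQMFG.IsQGProfile (N := N) (fun i => vN N i) (fun i => mN N i)) →
              ∀ i : ℕ, LQMFG.ConvergesValue (fun N => vN N i) v ∧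
                LQMFG.ConvergesDensity (fun N => mN N i) m) := by
  have hQs := LQMFG.isSymm_of_posDef hQ
  -- Smallness of ℓ enters all three claims only through positive definiteness of the limiting
  -- Riccati matrix.
  obtain ⟨ℓh, hℓh, hPd⟩ := LQMFG.exists_riccatiMatrix_posDef hA hQ hr
  refine ⟨ℓh, hℓh, fun ℓ hℓ hlt => ?_, fun ℓ hℓ hlt hBp => ?_, ?_⟩
  · exact LQMFG.existsUnique_qg_iff hr hk hℓ hA hQs hB (hPd ℓ hℓ hlt)
  · obtain ⟨v, m, h1, h2, h3⟩ := LQMFG.exists_qg_unique_of_posSemidef (C := Ch) (D := Dh)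
      (H := H) (Δ₀ := Δ₀) hr hk hℓ hA hQs hB (hPd ℓ hℓ hlt) hBp
    exact ⟨v, m, h1, h2, fun v' m' h _ => h3 v' m' h⟩
  · intro ℓ hℓ hlt σ G Q B C D hG hQN hBN hC hD huniq
    -- Claim (a) converts the assumed uniqueness for the mean field system into invertibility of the
    -- limit matrix.
    exact LQMFG.convergence_of_games hr hk hℓ hA hQs hB (hPd ℓ hℓ hlt)
      ((LQMFG.existsUnique_qg_iff hr hk hℓ hA hQs hB (hPd ℓ hℓ hlt)).1 huniq) G Q B C D
      (fun N hN => ⟨(hG N hN).1, (hG N hN).2.2.1, (hG N hN).2.2.2.1⟩) hQN hBN hC hD
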